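/- Let $K$ be a field and let $A$ be a finite-dimensional connected $K$-algebra (i.e. $A\neq 0$ and $0,1$ are the only central idempotents of $A$). Modules are finite-dimensional left modules; $D=\mathrm{Hom}_K(-,K)$ is the standard duality between left and right modules (equivalently, between modules over $A$ and over $A^{op}$), $\mathrm{Tr}$ is the transpose (the cokernel of $\mathrm{Hom}_A(P_0,A)\to \mathrm{Hom}_A(P_1,A)$ for a minimal projective presentation $P_1\to P_0\to M\to 0$), and $\tau=D\,\mathrm{Tr}$. An $A$-module $M$ is Gorenstein projective if $\mathrm{Ext}_A^i(M,A)=0$ and $\mathrm{Ext}_{A^{op}}^i(\mathrm{Tr}\,M,A)=0$ for all $i\ge 1$; it is Gorenstein injective if $D(M)$ is Gorenstein projective over $A^{op}$; it is Gorenstein projective-injective if it is both. $A$ is CM-finite if there are only finitely many indecomposable Gorenstein projective $A$-modules up to isomorphism. The dominant dimension of $A$ is at least $2$ if the first two terms $I_0,I_1$ of a minimal injective resolution of the regular module $A$ are projective. $A$ is gendo-symmetric if it has dominant dimension at least $2$ and, for an idempotent $e$ such that $Ae$ is the minimal faithful projective-injective module, $Ae\cong D(eA)$ as $(A,eAe)$-bimodules.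 The Auslander–Reiten quiver of $A$ has as vertices the isomorphism classes of indecomposable modules and an arrow $[X]\to[Y]$ whenever there is an irreducible morphism $X\to Y$; an Auslander–Reiten component is a connected component of it. A stable Auslander–Reiten component is a connected component of the stable Auslander–Reiten quiver, the full subquiver on those vertices whose $\tau$-orbit contains no projective and no injective module. Assume that $A$ is gendo-symmetric and not selfinjective. Then: 1. If an Auslander–Reiten component of $A$ contains a nonprojective Gorenstein projective-injective module, then all modules in this component are Gorenstein projective-injective. Moreover, the set of (isomorphism classes of) indecomposable nonprojective Gorenstein projective-injective $A$-modules is a union of stable Auslander–Reiten components of $A$. 2. If $A$ is CM-finite, then every Gorenstein projective-injective $A$-module is projective. -/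

import Mathlib

open CategoryTheory

universe u

namespace FinDimAlg

noncomputable section

/-! Throughout, `A` is a finite-dimensional algebra over a field `K`, and `A`-modules are left
modules, as objects of `ModuleCat A`; the right `A`-modules are the objects of `ModuleCat Aᵐᵒᵖ`.
Finite-dimensionality of a module `M` is `Module.Finite A M`. -/

section Dual

variable (K : Type u) [Field K] {R : Type u} [Ring R] [Algebra K R]

open scoped ModuleCat in
/-- The `R`-action from the other side on `Hom_K(M, K)`: `(φ r)(m) = φ (r m)`. -/
@[reducible]
def dualModule (M : ModuleCat.{u} R) : Module Rᵐᵒᵖ (M →ₗ[K] K) where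
  smul r φ := φ ∘ₗ Algebra.lsmul K K M r.unop
  one_smul φ := LinearMap.ext fun m => congrArg φ (one_smul R m)
  mul_smul r s φ := LinearMap.ext fun m => congrArg φ (mul_smul s.unop r.unop m)
  smul_zero _ := rfl
  smul_add _ _ _ := rfl
  add_smul r s φ := LinearMap.ext fun m =>
    (congrArg φ (add_smul r.unop s.unop m)).trans (map_add φ _ _)
  zero_smul φ := LinearMap.ext fun m => (congrArg φ (zero_smul R m)).trans (map_zero φ)

open scoped ModuleCat in
/-- The duality `D = Hom_K(-, K)` (on objects) from left to right modules. -/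
def D (M : ModuleCat.{u} R) : ModuleCat.{u} Rᵐᵒᵖ :=
  letI := dualModule K M
  ModuleCat.of Rᵐᵒᵖ (M →ₗ[K] K)

end Dual

section Ring

variable {R : Type u} [Ring R]

/-- The submodule `N` of `M` is superfluous. -/
def IsSuperfluous {M : Type u} [AddCommGroup M] [Module R M] (N : Submodule R M) : Prop :=
  ∀ L : Submodule R M, N ⊔ L = ⊤ → L = ⊤

/-- The submodule `N` of `M` is essential. -/
def IsEssential {M : Type u} [AddCommGroup M] [Module R M] (N : Submodule R M) : Prop :=
  ∀ L : Submodule R M, N ⊓ L = ⊥ → L = ⊥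

/-- `ι : M ⟶ I` is an injective envelope. -/
structure IsInjectiveEnvelope {M I : ModuleCat.{u} R} (ι : M ⟶ I) : Prop where
  injective : Module.Injective R I
  mono : Function.Injective ι.hom
  essential : IsEssential (LinearMap.range ι.hom)

/-- `n ≤ domdim M`: the first `n` terms `I₀, …, Iₙ₋₁` of a minimal injective resolution of `M`
are projective. -/
def DomDimAtLeast : ℕ → ModuleCat.{u} R → Prop
  | 0, _ => True
  | n + 1, M => ∃ (I : ModuleCat.{u} R) (ι : M ⟶ I), IsInjectiveEnvelope ι ∧
      Module.Projective R I ∧ DomDimAtLeast n (ModuleCat.of R (I ⧸ LinearMap.range ι.hom))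

/-- A minimal projective presentation `P₁ ⟶ P₀ ⟶ M ⟶ 0`. -/
structure MinProjPresentation (M : ModuleCat.{u} R) where
  P₁ : ModuleCat.{u} R
  P₀ : ModuleCat.{u} R
  d : P₁ ⟶ P₀
  π : P₀ ⟶ M
  projective₁ : Module.Projective R P₁
  projective₀ : Module.Projective R P₀
  surjective : Function.Surjective π.hom
  exact : LinearMap.range d.hom = LinearMap.ker π.hom
  superfluous₀ : IsSuperfluous (LinearMap.ker π.hom)
  superfluous₁ : IsSuperfluous (LinearMap.ker d.hom)

/-- The map of right modules `Hom_R(N, R) → Hom_R(M, R)` induced by `f : M ⟶ N`; here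
`Hom_R(M, R)` has the right action `(φ r)(m) = φ(m) r`. -/
def homToRing {M N : ModuleCat.{u} R} (f : M ⟶ N) : (N →ₗ[R] R) →ₗ[Rᵐᵒᵖ] (M →ₗ[R] R) where
  toFun φ := φ ∘ₗ f.hom
  map_add' _ _ := rfl
  map_smul' _ _ := rfl

/-- The transpose `Tr M = coker (Hom_R(P₀, R) → Hom_R(P₁, R))`, computed with the minimal
projective presentation `p` of `M`. -/
def MinProjPresentation.Tr {M : ModuleCat.{u} R} (p : MinProjPresentation M) :
    ModuleCat.{u} Rᵐᵒᵖ :=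
  ModuleCat.of Rᵐᵒᵖ ((p.P₁ →ₗ[R] R) ⧸ LinearMap.range (homToRing p.d))

/-- `M` is Gorenstein projective: `Extⁱ(M, R) = 0 = Extⁱ(Tr M, R)` for all `i ≥ 1`. -/
def IsGorensteinProjective (M : ModuleCat.{u} R) : Prop :=
  (∀ i : ℕ, 1 ≤ i → Subsingleton (Abelian.Ext M (ModuleCat.of R R) i)) ∧
  ∃ p : MinProjPresentation M,
    ∀ i : ℕ, 1 ≤ i → Subsingleton (Abelian.Ext p.Tr (ModuleCat.of Rᵐᵒᵖ R) i)

/-- `f` is an irreducible morphism in the category of finitely generated modules. -/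
def IsIrreducibleMor {X Y : ModuleCat.{u} R} (f : X ⟶ Y) : Prop :=
  ¬ IsSplitMono f ∧ ¬ IsSplitEpi f ∧
  ∀ (Z : ModuleCat.{u} R) (g : X ⟶ Z) (h : Z ⟶ Y), Module.Finite R Z → g ≫ h = f →
    IsSplitMono g ∨ IsSplitEpi h

variable (R) in
/-- The indecomposable finitely generated modules. -/
def IndMod : Type (u + 1) :=
  {M : ModuleCat.{u} R // Module.Finite R M ∧ Indecomposable M}

/-- `X` and `Y` represent the same vertex of the Auslander–Reiten quiver, or there is an arrow
from (the vertex of) `X` to (the vertex of) `Y`. -/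
def AREdge (X Y : IndMod R) : Prop :=
  Nonempty (X.1 ≅ Y.1) ∨ ∃ f : X.1 ⟶ Y.1, IsIrreducibleMor f

/-- `C` is (the class of all modules belonging to) a connected component of the Auslander–Reiten
quiver of `R`. -/
def IsARComponent (C : Set (IndMod R)) : Prop :=
  ∃ X : IndMod R, C = {Y | Relation.EqvGen AREdge X Y}

end Ring

section Algebra

variable (K : Type u) [Field K] {A : Type u} [Ring A] [Algebra K A]

/-- `M` is Gorenstein injective: `D(M)` is a Gorenstein projective module over the opposite
algebra. -/
def IsGorensteinInjective (M : ModuleCat.{u} A) : Prop :=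
  IsGorensteinProjective (D K M)

/-- `M` is Gorenstein projective-injective. -/
def IsGorensteinProjInj (M : ModuleCat.{u} A) : Prop :=
  IsGorensteinProjective M ∧ IsGorensteinInjective K M

/-- `N ≅ τ(M) = D(Tr M)`, the Auslander–Reiten translate of `M`. -/
def IsTau (M N : ModuleCat.{u} A) : Prop :=
  ∃ p : MinProjPresentation M,
    Nonempty (N ≅ (ModuleCat.restrictScalars (RingEquiv.opOp A).toRingHom).obj (D K p.Tr))

/-- `M` is a stable vertex of the Auslander–Reiten quiver: `τⁿ(M)` is defined and not projective
for all `n ∈ ℤ`, that is, the `τ`-orbit of `M` contains neither projective nor injective modules.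
The family `X` is `n ↦ τⁿ(M)`. -/
def IsStable (M : IndMod A) : Prop :=
  ∃ X : ℤ → IndMod A, X 0 = M ∧ (∀ n, ¬ Module.Projective A (X n).1) ∧
    ∀ n, IsTau K (X n).1 (X (n + 1)).1

/-- `C` is a connected component of the stable Auslander–Reiten quiver, the full subquiver on the
stable vertices. -/
def IsStableARComponent (C : Set (IndMod A)) : Prop :=
  ∃ X : IndMod A, IsStable K X ∧
    C = {Y | Relation.EqvGen (fun U V => IsStable K U ∧ IsStable K V ∧ AREdge U V) X Y}

variable (A)

/-- `A` is CM-finite: there are only finitely many indecomposable finite-dimensional Gorenstein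
projective modules up to isomorphism. -/
def IsCMFinite : Prop :=
  ∃ S : Set (ModuleCat.{u} A), S.Finite ∧
    ∀ M : IndMod A, IsGorensteinProjective M.1 → ∃ N ∈ S, Nonempty (M.1 ≅ N)

/-- `A` is connected (indecomposable as an algebra). -/
def IsConnectedAlg : Prop :=
  Nontrivial A ∧ ∀ c : A, IsIdempotentElem c → c ∈ Subring.center A → c = 0 ∨ c = 1

variable {A}

/-- `Ae`, for an idempotent `e`, is the minimal faithful projective-injective left module: it is
injective, faithful, and a direct summand of every faithful finite-dimensional module. -/
def IsMinFaithfulProjInj (e : A) : Prop :=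
  Module.Injective A (Submodule.span A {e}) ∧ FaithfulSMul A (Submodule.span A {e}) ∧
  ∀ M : ModuleCat.{u} A, Module.Finite A M → FaithfulSMul A M →
    ∃ f : ModuleCat.of A (Submodule.span A {e}) ⟶ M, IsSplitMono f

/-- `Ae ≅ D(eA)` as `(A, eAe)`-bimodules. The action of `a ∈ A` on `D(eA)` is
`(aψ)(y) = ψ(ya)`, that of `b ∈ eAe` is `(ψb)(y) = ψ(by)`. -/
def BimoduleIsoDual (e : A) : Prop :=
  ∃ Φ : Submodule.span A {e} ≃ₗ[K] (Submodule.span Aᵐᵒᵖ {e} →ₗ[K] K),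
    (∀ (a : A) (x : Submodule.span A {e}) (y : Submodule.span Aᵐᵒᵖ {e}),
      Φ (a • x) y = Φ x (MulOpposite.op a • y)) ∧
    ∀ (a : A) (x x' : Submodule.span A {e}) (y y' : Submodule.span Aᵐᵒᵖ {e}),
      (x' : A) = x * (e * a * e) → (y' : A) = (e * a * e) * y → Φ x' y = Φ x y'

variable (A)

/-- `A` is gendo-symmetric: it has dominant dimension at least `2`, and for the minimal faithful
projective-injective module `Ae` one has `Ae ≅ D(eA)` as `(A, eAe)`-bimodules. -/
def IsGendoSymmetric : Prop :=
  DomDimAtLeast 2 (ModuleCat.of A A) ∧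
  ∃ e : A, IsIdempotentElem e ∧ IsMinFaithfulProjInj e ∧ BimoduleIsoDual K e

end Algebra

end

end FinDimAlg

/-! Let `Ae` be the minimal faithful projective-injective module. The bimodule isomorphism `Ae ≅
D(eA)` amounts to a functional `lam` on `A` that is a trace form on `eAe` and pairs `Ae` with `eA`
perfectly. Dominant dimension at least 2 adds the double centralizer property: every `eAe`-balanced
form on `Ae × eA` is `(x, y) ↦ lam (y a x)`. From these data (`IsSymmIdempotent`) every module `M`
gets a natural map `D(M) → Hom(M, A)`, and its bijectivity (`DualIsHom`) expresses codominant
dimension at least 2.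

Call `M` biperfect if `DualIsHom` holds and `Extⁱ(M, A) = 0` for `i ≥ 1`, and the same is true of
`D(M)` over the opposite algebra. A finitely generated module is biperfect exactly when it is
Gorenstein projective-injective. A Gorenstein projective module is reflexive, hence has dominant
dimension at least 2 (`MinProjPresentation.homIsSelf`). Conversely, the projective cover of a
biperfect `M` lies in `add(Ae)`, where `Hom(-, A) ≅ D`; so `Tr M ≅ D(Ω²M)`, and `Ω²M` is again
biperfect. In particular `τ M ≅ Ω²M`. Biperfect modules are closed under extensions, direct
summands, and syzygies and cosyzygies taken with middle term in `add(Ae)`.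

For the first statement, the almost split sequences at an indecomposable nonprojective biperfect
module have biperfect end terms, so their middle terms are biperfect and irreducible maps do not
leave the class. If such a map reaches a projective `P`, then `P` is projective-injective with
isomorphic top and socle, the neighbouring module is `rad P` or `P/soc P`, and so the top of `P` is
biperfect. Then `rad P` and `P/soc P` are both biperfect and one can continue. The class closed
under passing along edges is `IsGood`; its nonprojective members, `IsCore`, are stable under `τ` and
`τ⁻¹`, which gives the statement on stable components.

For the second statement, suppose there are finitely many good modules, and at least one. A map from
a good module to an indecomposable one that is not good factors through left almost split maps again
and again, so it vanishes because the radical of the endomorphism ring of the sum of all good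
modules is nilpotent (`IsGood.hom_eq_zero`). The trace pairing kills maps in the other direction
into good projectives. Thus the good summands of `A` split off as a block; by connectedness they are
all of `A`, and `A` is selfinjective (`injective_of_finite`). -/

namespace FinDimAlg

noncomputable section

/-! ### Vanishing of Ext in short exact sequences. -/

section Extensions

variable {R : Type u} [Ring R]

/-- `0 → K → P → M → 0` is exact. -/
structure IsShortExact {K P M : Type u} [AddCommGroup K] [AddCommGroup P] [AddCommGroup M]
    [Module R K] [Module R P] [Module R M] (i : K →ₗ[R] P) (p : P →ₗ[R] M) : Prop where
  inj : Function.Injective i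
  surj : Function.Surjective p
  exact : ∀ x, p x = 0 ↔ ∃ k, i k = x

theorem IsShortExact.comp_eq_zero {K P M : Type u} [AddCommGroup K] [AddCommGroup P]
    [AddCommGroup M] [Module R K] [Module R P] [Module R M] {i : K →ₗ[R] P} {p : P →ₗ[R] M}
    (h : IsShortExact i p) (k : K) : p (i k) = 0 := (h.exact _).2 ⟨k, rfl⟩

theorem isShortExact_ker {P M : Type u} [AddCommGroup P] [AddCommGroup M] [Module R P]
    [Module R M] {p : P →ₗ[R] M} (hp : Function.Surjective p) :
    IsShortExact (LinearMap.ker p).subtype p :=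
  ⟨Subtype.val_injective, hp, fun x => ⟨fun hx => ⟨⟨x, hx⟩, rfl⟩, by rintro ⟨k, rfl⟩; exact k.2⟩⟩

theorem isShortExact_mkQ {P : Type u} [AddCommGroup P] [Module R P] (N : Submodule R P) :
    IsShortExact N.subtype N.mkQ :=
  ⟨Subtype.val_injective, N.mkQ_surjective, fun x => by simp⟩

theorem isShortExact_range {K P : Type u} [AddCommGroup K] [AddCommGroup P] [Module R K]
    [Module R P] {i : K →ₗ[R] P} (hi : Function.Injective i) :
    IsShortExact i (LinearMap.range i).mkQ :=
  ⟨hi, Submodule.mkQ_surjective _, fun x => by simp⟩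

/-- `Extⁱ(M, Y) = 0` for all `i ≥ 1`. -/
def ExtVanish (M Y : ModuleCat.{u} R) : Prop :=
  ∀ i : ℕ, 1 ≤ i → Subsingleton (Abelian.Ext M Y i)

variable {K P M X Y Z : ModuleCat.{u} R}

theorem ExtVanish.of_retract (h : ExtVanish M Y) (i : X →ₗ[R] M) (r : M →ₗ[R] X)
    (hri : ∀ x, r (i x) = x) : ExtVanish X Y := by
  intro n hn
  have := h n hn
  refine subsingleton_of_forall_eq 0 fun a => ?_
  have e : ModuleCat.ofHom i ≫ ModuleCat.ofHom r = 𝟙 X := by ext x; exact hri x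
  rw [← Abelian.Ext.mk₀_id_comp a, ← e, ← Abelian.Ext.mk₀_comp_mk₀_assoc,
    Subsingleton.elim ((Abelian.Ext.mk₀ (ModuleCat.ofHom r)).comp a (zero_add n)) 0,
    Abelian.Ext.comp_zero]

theorem ExtVanish.of_linearEquiv (h : ExtVanish M Y) (i : X ≃ₗ[R] M) : ExtVanish X Y :=
  h.of_retract i.toLinearMap i.symm.toLinearMap (by simp)

theorem ExtVanish.of_coeff_linearEquiv (h : ExtVanish M Y) (i : Z ≃ₗ[R] Y) : ExtVanish M Z := by
  intro n hn
  have := h n hn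
  refine subsingleton_of_forall_eq 0 fun a => ?_
  have e : ModuleCat.ofHom i.toLinearMap ≫ ModuleCat.ofHom i.symm.toLinearMap = 𝟙 Z := by
    ext x; simp
  rw [← Abelian.Ext.comp_mk₀_id a, ← e, ← Abelian.Ext.mk₀_comp_mk₀,
    ← Abelian.Ext.comp_assoc_of_second_deg_zero,
    Subsingleton.elim (a.comp (Abelian.Ext.mk₀ (ModuleCat.ofHom i.toLinearMap)) (add_zero n)) 0,
    Abelian.Ext.zero_comp]

theorem extVanish_of_projective [Module.Projective R P] : ExtVanish P Y := by
  intro n hn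
  obtain ⟨m, rfl⟩ : ∃ m, n = m + 1 := ⟨n - 1, by omega⟩
  have : Projective P := (IsProjective.iff_projective P).1 inferInstance
  exact Abelian.Ext.subsingleton_of_projective _ _ _

theorem IsShortExact.shortExact {i : K →ₗ[R] P} {p : P →ₗ[R] M} (h : IsShortExact i p) :
    (ShortComplex.mk (ModuleCat.ofHom i) (ModuleCat.ofHom p)
      (by ext x; exact h.comp_eq_zero x)).ShortExact where
  exact := (ShortComplex.ShortExact.moduleCat_exact_iff_function_exact _).2 h.exact
  mono_f := (ModuleCat.mono_iff_injective _).2 h.inj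
  epi_g := (ModuleCat.epi_iff_surjective _).2 h.surj

theorem ExtVanish.exists_extension {i : K →ₗ[R] P} {p : P →ₗ[R] M} (hM : ExtVanish M Y)
    (h : IsShortExact i p) (φ : K →ₗ[R] Y) : ∃ ψ : P →ₗ[R] Y, ∀ k, ψ (i k) = φ k := by
  have := hM 1 le_rfl
  obtain ⟨x, hx⟩ := Abelian.Ext.contravariant_sequence_exact₁ h.shortExact Y
    (Abelian.Ext.mk₀ (ModuleCat.ofHom φ)) (n₁ := 1) rfl (Subsingleton.elim _ _)
  obtain ⟨ψ, rfl⟩ := (Abelian.Ext.mk₀_bijective _ _).2 x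
  refine ⟨ψ.hom, fun k => ?_⟩
  rw [Abelian.Ext.mk₀_comp_mk₀] at hx
  have := (Abelian.Ext.mk₀_bijective _ _).1 hx
  exact congrArg (fun f => f.hom k) this

theorem ExtVanish.ker {i : K →ₗ[R] P} {p : P →ₗ[R] M} (hM : ExtVanish M Y) (hP : ExtVanish P Y)
    (h : IsShortExact i p) : ExtVanish K Y := by
  intro n hn
  have := hM (1 + n) (by omega)
  have := hP n hn
  refine subsingleton_of_forall_eq 0 fun a => ?_
  obtain ⟨x, rfl⟩ := Abelian.Ext.contravariant_sequence_exact₁ h.shortExact Y a rfl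
    (Subsingleton.elim _ _)
  rw [Subsingleton.elim x 0, Abelian.Ext.comp_zero]

/-- The extension hypothesis handles degree 1: the connecting map from `Hom(K, Y)` is onto `Ext¹(M,
Y)`, and it kills every map that extends to `P`. Higher degrees are dimension shifting. -/
theorem ExtVanish.coker {i : K →ₗ[R] P} {p : P →ₗ[R] M} (hK : ExtVanish K Y)
    (hP : ExtVanish P Y) (h : IsShortExact i p)
    (hex : ∀ φ : K →ₗ[R] Y, ∃ ψ : P →ₗ[R] Y, ∀ k, ψ (i k) = φ k) : ExtVanish M Y := by
  intro n hn
  have := hP n hn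
  refine subsingleton_of_forall_eq 0 fun a => ?_
  obtain ⟨m, rfl⟩ : ∃ m, n = 1 + m := ⟨n - 1, by omega⟩
  obtain ⟨x, rfl⟩ := Abelian.Ext.contravariant_sequence_exact₃ h.shortExact Y a
    (Subsingleton.elim _ _) (n₀ := m) rfl
  rcases Nat.eq_zero_or_pos m with rfl | hm
  · obtain ⟨φ, rfl⟩ := (Abelian.Ext.mk₀_bijective _ _).2 x
    obtain ⟨ψ, hψ⟩ := hex φ.hom
    have e : φ = ModuleCat.ofHom i ≫ ModuleCat.ofHom ψ := by ext k; exact (hψ k).symm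
    rw [e, ← Abelian.Ext.mk₀_comp_mk₀, ← Abelian.Ext.comp_assoc_of_second_deg_zero]
    erw [h.shortExact.extClass_comp]
    simp
  · have := hK m hm
    rw [Subsingleton.elim x 0, Abelian.Ext.comp_zero]

theorem ExtVanish.extension {i : K →ₗ[R] P} {p : P →ₗ[R] M} (hK : ExtVanish K Y)
    (hM : ExtVanish M Y) (h : IsShortExact i p) : ExtVanish P Y := by
  intro n hn
  have := hK n hn
  have := hM n hn
  refine subsingleton_of_forall_eq 0 fun a => ?_
  obtain ⟨x, rfl⟩ := Abelian.Ext.contravariant_sequence_exact₂ h.shortExact Y a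
    (Subsingleton.elim _ _)
  rw [Subsingleton.elim x 0, Abelian.Ext.comp_zero]

/-- Dimension shifting inside a class that contains a syzygy of each of its members. It reduces the
vanishing of all Ext groups to a statement about extending linear maps, which can be transported
between rings. -/
theorem extVanish_of_forall (C : ModuleCat.{u} R → Prop)
    (hC : ∀ M, C M → ∃ (K P : ModuleCat.{u} R) (i : K →ₗ[R] P) (p : P →ₗ[R] M), C K ∧
      Module.Projective R P ∧ IsShortExact i p ∧
        ∀ φ : K →ₗ[R] Y, ∃ ψ : P →ₗ[R] Y, ∀ k, ψ (i k) = φ k) (hM : C M) : ExtVanish M Y := by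
  intro n hn
  induction n, hn using Nat.le_induction generalizing M with
  | base =>
    obtain ⟨K, P, i, p, hK, hP, h, hex⟩ := hC M hM
    have := extVanish_of_projective (Y := Y) (P := P) 1 le_rfl
    refine subsingleton_of_forall_eq 0 fun a => ?_
    obtain ⟨x, rfl⟩ := Abelian.Ext.contravariant_sequence_exact₃ h.shortExact Y a
      (Subsingleton.elim _ _) (n₀ := 0) rfl
    obtain ⟨φ, rfl⟩ := (Abelian.Ext.mk₀_bijective _ _).2 x
    obtain ⟨ψ, hψ⟩ := hex φ.hom
    have e : φ = ModuleCat.ofHom i ≫ ModuleCat.ofHom ψ := by ext k; exact (hψ k).symm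
    rw [e, ← Abelian.Ext.mk₀_comp_mk₀, ← Abelian.Ext.comp_assoc_of_second_deg_zero]
    erw [h.shortExact.extClass_comp]
    simp
  | succ m hm ih =>
    obtain ⟨K, P, i, p, hK, hP, h, hex⟩ := hC M hM
    have := extVanish_of_projective (Y := Y) (P := P) (m + 1) (by omega)
    have := ih hK
    refine subsingleton_of_forall_eq 0 fun a => ?_
    obtain ⟨x, rfl⟩ := Abelian.Ext.contravariant_sequence_exact₃ h.shortExact Y a
      (Subsingleton.elim _ _) (n₀ := m) (add_comm _ _)
    rw [Subsingleton.elim x 0, Abelian.Ext.comp_zero]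

theorem exists_free_cover (M : ModuleCat.{u} R) :
    ∃ (K P : ModuleCat.{u} R) (i : K →ₗ[R] P) (p : P →ₗ[R] M),
      Nonempty (P ≃ₗ[R] (M →₀ R)) ∧ IsShortExact i p :=
  ⟨ModuleCat.of R (LinearMap.ker (Finsupp.linearCombination R (id : M → M))),
    ModuleCat.of R (M →₀ R), (LinearMap.ker _).subtype, Finsupp.linearCombination R id,
    ⟨LinearEquiv.refl _ _⟩, isShortExact_ker (Finsupp.linearCombination_id_surjective R M)⟩

/-- Vanishing of `Extⁱ(-, R)` for `i ≥ 1` does not change under an isomorphism of rings. -/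
theorem ExtVanish.of_ringEquiv {S : Type u} [Ring S] (σ : R ≃+* S) {N : ModuleCat.{u} S}
    (h : ExtVanish ((ModuleCat.restrictScalars σ.toRingHom).obj N) (ModuleCat.of R R)) :
    ExtVanish N (ModuleCat.of S S) := by
  refine extVanish_of_forall
    (fun N => ExtVanish ((ModuleCat.restrictScalars σ.toRingHom).obj N) (ModuleCat.of R R))
    (fun N hN => ?_) h
  have symm_mul : ∀ (r : R) (s : S), σ.symm (σ r * s) = r * σ.symm s := fun r s => by
    rw [map_mul, RingEquiv.symm_apply_apply]
  obtain ⟨K, P, i, p, ⟨f⟩, hi⟩ := exists_free_cover N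
  let i' := ((ModuleCat.restrictScalars σ.toRingHom).map (ModuleCat.ofHom i)).hom
  let p' := ((ModuleCat.restrictScalars σ.toRingHom).map (ModuleCat.ofHom p)).hom
  have hi' : IsShortExact i' p' := ⟨hi.inj, hi.surj, hi.exact⟩
  have hPR : Module.Projective R ((ModuleCat.restrictScalars σ.toRingHom).obj P) := by
    let e : ((ModuleCat.restrictScalars σ.toRingHom).obj P) ≃ₗ[R] (N →₀ R) :=
      { f.toAddEquiv.trans (Finsupp.mapRange.addEquiv (ι := N) σ.symm.toAddEquiv) with
        map_smul' := fun r x => Finsupp.ext fun n =>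
          (congrArg (fun z => σ.symm (z n)) (f.map_smul (σ r) x)).trans (symm_mul r (f x n)) }
    exact Module.Projective.of_equiv e.symm
  refine ⟨K, P, i, p, hN.ker extVanish_of_projective hi', Module.Projective.of_equiv f.symm, hi, fun φ => ?_⟩
  let φ' : ((ModuleCat.restrictScalars σ.toRingHom).obj K) →ₗ[R] (ModuleCat.of R R) :=
    { toFun := fun k => σ.symm (φ k)
      map_add' := fun a b => (congrArg σ.symm (φ.map_add a b)).trans (map_add σ.symm _ _)
      map_smul' := fun r k => (congrArg σ.symm (φ.map_smul (σ r) k)).trans (symm_mul r (φ k)) }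
  obtain ⟨ψ, hψ⟩ := hN.exists_extension hi' φ'
  have hsmul : ∀ (s : S) (x : P), ψ (show P from s • x) = σ.symm s * (ψ x : R) := fun s x => by
    have h : (show P from s • x) = (show P from σ (σ.symm s) • x) := by
      rw [RingEquiv.apply_symm_apply]
    rw [h]
    exact ψ.map_smul (σ.symm s) x
  exact ⟨{ toFun := fun x => σ (ψ x)
           map_add' := fun a b => (congrArg σ (ψ.map_add a b)).trans (map_add σ _ _)
           map_smul' := fun s x => (congrArg σ (hsmul s x)).trans ((map_mul σ _ _).trans
            (congrArg (· * σ (ψ x)) (RingEquiv.apply_symm_apply σ s))) },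
    fun k => (congrArg σ (hψ k)).trans (RingEquiv.apply_symm_apply σ _)⟩

end Extensions

open scoped ModuleCat

/-! ### The duality `D` on finite-dimensional modules. -/

section Duality

theorem exists_factor {S : Type*} [Ring S] {P M X : Type*} [AddCommGroup P] [AddCommGroup M]
    [AddCommGroup X] [Module S P] [Module S M] [Module S X] (p : P →ₗ[S] M)
    (hp : Function.Surjective p) (f : P →ₗ[S] X) (hf : ∀ x, p x = 0 → f x = 0) :
    ∃ g : M →ₗ[S] X, ∀ x, g (p x) = f x :=
  ⟨(LinearMap.ker p).liftQ f (fun x hx => hf x hx) ∘ₗ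
    (p.quotKerEquivOfSurjective hp).symm.toLinearMap, fun x => by
      have : (p.quotKerEquivOfSurjective hp).symm (p x) = (LinearMap.ker p).mkQ x := by
        rw [LinearEquiv.symm_apply_eq]; rfl
      rw [LinearMap.comp_apply, LinearEquiv.coe_coe, this]
      exact Submodule.liftQ_apply _ f x⟩

variable (K : Type u) [Field K] {R : Type u} [Ring R] [Algebra K R]

theorem exists_extend_functional {V W : Type*} [AddCommGroup V] [AddCommGroup W] [Module K V]
    [Module K W] (i : V →ₗ[K] W) (hi : Function.Injective i) (f : V →ₗ[K] K) :
    ∃ g : W →ₗ[K] K, ∀ x, g (i x) = f x := by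
  obtain ⟨r, hr⟩ := i.exists_leftInverse_of_injective (LinearMap.ker_eq_bot.2 hi)
  exact ⟨f ∘ₗ r, fun x => congrArg f (LinearMap.congr_fun hr x)⟩

theorem exists_functional_ne {V : Type*} [AddCommGroup V] [Module K V] {v : V}
    (h : ∀ f : V →ₗ[K] K, f v = 0) : v = 0 :=
  (Module.forall_dual_apply_eq_zero_iff K v).1 h

theorem exists_eval {V : Type*} [AddCommGroup V] [Module K V] [FiniteDimensional K V]
    (F : (V →ₗ[K] K) →ₗ[K] K) : ∃ v : V, ∀ f, F f = f v := by
  obtain ⟨v, rfl⟩ := (Module.evalEquiv K V).surjective F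
  exact ⟨v, fun f => rfl⟩

/-- Elements of `D(M)` are linear functionals on `M`. -/
def dEquiv (M : ModuleCat.{u} R) : D K M ≃ₗ[K] (M →ₗ[K] K) :=
  { (AddEquiv.refl (M →ₗ[K] K) : D K M ≃+ (M →ₗ[K] K)) with
    map_smul' := fun k f => LinearMap.ext fun m => by
      change (show M →ₗ[K] K from f) ((algebraMap K R k) • m) = k • (show M →ₗ[K] K from f) m
      rw [algebraMap_smul, map_smul] }

theorem dEquiv_smul {M : ModuleCat.{u} R} (r : Rᵐᵒᵖ) (F : D K M) (m : M) :
    dEquiv K M (r • F) m = dEquiv K M F (r.unop • m) := rfl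

/-- The map `D(f) : D(N) → D(M)`. -/
def dMap {M N : ModuleCat.{u} R} (f : M →ₗ[R] N) : D K N →ₗ[Rᵐᵒᵖ] D K M where
  toFun F := (dEquiv K M).symm (dEquiv K N F ∘ₗ f.restrictScalars K)
  map_add' F G := by
    apply (dEquiv K M).injective
    rw [map_add]
    simp only [LinearEquiv.apply_symm_apply, map_add, LinearMap.add_comp]
  map_smul' r F := by
    apply (dEquiv K M).injective
    ext m
    simp only [LinearEquiv.apply_symm_apply, RingHom.id_apply, dEquiv_smul, LinearMap.comp_apply,
      LinearMap.coe_restrictScalars, map_smul]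

theorem dEquiv_dMap {M N : ModuleCat.{u} R} (f : M →ₗ[R] N) (F : D K N) (m : M) :
    dEquiv K M (dMap K f F) m = dEquiv K N F (f m) := by
  simp [dMap]

theorem dual_ext {M : ModuleCat.{u} R} {F G : D K M}
    (h : ∀ m, dEquiv K M F m = dEquiv K M G m) : F = G :=
  (dEquiv K M).injective (LinearMap.ext h)

theorem IsShortExact.dual {X P M : ModuleCat.{u} R} {i : X →ₗ[R] P} {p : P →ₗ[R] M}
    (h : IsShortExact i p) : IsShortExact (dMap K p) (dMap K i) where
  inj F G hFG := dual_ext K fun m => by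
    obtain ⟨x, rfl⟩ := h.surj m
    rw [← dEquiv_dMap, hFG, dEquiv_dMap]
  surj F := by
    obtain ⟨g, hg⟩ := exists_extend_functional K (i.restrictScalars K) h.inj (dEquiv K X F)
    refine ⟨(dEquiv K P).symm g, dual_ext K fun m => ?_⟩
    rw [dEquiv_dMap, LinearEquiv.apply_symm_apply]
    exact hg m
  exact F := by
    constructor
    · intro hF
      obtain ⟨g, hg⟩ := exists_factor (p.restrictScalars K) h.surj (dEquiv K P F) (fun x hx => by
        obtain ⟨k, rfl⟩ := (h.exact x).1 hx
        rw [← dEquiv_dMap, hF, map_zero, LinearMap.zero_apply])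
      refine ⟨(dEquiv K M).symm g, dual_ext K fun m => ?_⟩
      rw [dEquiv_dMap, LinearEquiv.apply_symm_apply]
      exact hg m
    · rintro ⟨G, rfl⟩
      refine dual_ext K fun m => ?_
      rw [dEquiv_dMap, dEquiv_dMap, h.comp_eq_zero, map_zero, map_zero, LinearMap.zero_apply]

/-- The evaluation map `M → D(D(M))`. -/
def evalDual (M : ModuleCat.{u} R) : M →ₗ[K] D K (D K M) :=
  (dEquiv K (D K M)).symm.toLinearMap ∘ₗ (dEquiv K M).toLinearMap.flip

theorem dEquiv_evalDual {M : ModuleCat.{u} R} (m : M) (F : D K M) :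
    dEquiv K (D K M) (evalDual K M m) F = dEquiv K M F m := by
  simp [evalDual]

/-- The double dual is a module over the double opposite ring, so evaluation is only semilinear
along `R ≅ Rᵐᵒᵖᵐᵒᵖ`. -/
theorem evalDual_smul {M : ModuleCat.{u} R} (r : R) (m : M) :
    evalDual K M (r • m) = MulOpposite.op (MulOpposite.op r) • evalDual K M m := by
  refine dual_ext K fun F => ?_
  rw [dEquiv_evalDual, dEquiv_smul, dEquiv_evalDual, dEquiv_smul]
  rfl

section Finite

variable [FiniteDimensional K R]

theorem finiteDimensional_of_finite (M : ModuleCat.{u} R) [Module.Finite R M] :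
    FiniteDimensional K M := Module.Finite.trans R M

theorem evalDual_bijective (M : ModuleCat.{u} R) [Module.Finite R M] :
    Function.Bijective (evalDual K M) := by
  have := finiteDimensional_of_finite K M
  constructor
  · refine (injective_iff_map_eq_zero _).2 fun m hm => exists_functional_ne K fun f => ?_
    have := dEquiv_evalDual K m ((dEquiv K M).symm f)
    rwa [hm, map_zero, LinearMap.zero_apply, LinearEquiv.apply_symm_apply, eq_comm] at this
  · intro F
    obtain ⟨m, hm⟩ := exists_eval K
      (dEquiv K (D K M) F ∘ₗ (dEquiv K M).symm.toLinearMap)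
    refine ⟨m, dual_ext K fun G => ?_⟩
    have := hm (dEquiv K M G)
    rw [LinearMap.comp_apply, LinearEquiv.coe_coe, LinearEquiv.symm_apply_apply] at this
    rw [this, dEquiv_evalDual]

instance finite_dual (M : ModuleCat.{u} R) [Module.Finite R M] : Module.Finite Rᵐᵒᵖ (D K M) := by
  have := finiteDimensional_of_finite K M
  have : Module.Finite K (D K M) := Module.Finite.equiv (dEquiv K M).symm
  exact Module.Finite.of_restrictScalars_finite K Rᵐᵒᵖ (D K M)

end Finite

end Duality

/-! ### The trace form on `eRe` and the comparison of `D(M)` with `Hom(M, R)`. -/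

section SymmetricIdempotent

variable {K : Type u} [Field K] {R : Type u} [Ring R] [Algebra K R]

/-- The idempotent `e` and the functional `lam` exhibit `R` as a gendo-symmetric algebra: `lam` is
a trace form on `eRe` inducing a perfect pairing between `Re` and `eR`, the module `Re` is
faithful, and the balanced bilinear forms on `Re × eR` are the forms `(x, y) ↦ lam (y a x)`. -/
structure IsSymmIdempotent (e : R) (lam : R →ₗ[K] K) : Prop where
  idem : e * e = e
  supp : ∀ z, lam z = lam (e * z * e)
  symm : ∀ a q, lam (e * a * e * q) = lam (q * (e * a * e))
  nondeg_left : ∀ x, x * e = x → (∀ y, lam (y * x) = 0) → x = 0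
  nondeg_right : ∀ y, e * y = y → (∀ x, lam (y * x) = 0) → y = 0
  faithful_left : ∀ a, (∀ x, a * x * e = 0) → a = 0
  faithful_right : ∀ a, (∀ y, e * y * a = 0) → a = 0
  exists_form : ∀ γ : R →ₗ[K] R →ₗ[K] K, (∀ x y, γ (x * e) (e * y) = γ x y) →
    (∀ a x y, γ (x * (e * a * e)) y = γ x (e * a * e * y)) → ∃ a, ∀ x y, γ x y = lam (y * a * x)

variable {e : R} {lam : R →ₗ[K] K}

namespace IsSymmIdempotent

variable (h : IsSymmIdempotent e lam)

include h

theorem lam_mul_e (z : R) : lam (z * e) = lam z := by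
  rw [h.supp, h.supp z, mul_assoc, mul_assoc, h.idem, ← mul_assoc]

theorem lam_e_mul (z : R) : lam (e * z) = lam z := by
  rw [h.supp, h.supp z, ← mul_assoc e e, h.idem]

theorem lam_comm {p : R} (hp : e * p = p) (hp' : p * e = p) (q : R) :
    lam (p * q) = lam (q * p) := by
  have := h.symm p q
  rwa [hp, hp'] at this

/-- The axioms are left-right symmetric, so everything proved from them also applies to right
modules. -/
theorem op : IsSymmIdempotent (MulOpposite.op e)
    (lam ∘ₗ (MulOpposite.opLinearEquiv K).symm.toLinearMap) where
  idem := congrArg MulOpposite.op h.idem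
  supp z := by simpa [mul_assoc] using h.supp z.unop
  symm a q := by simpa [mul_assoc] using (h.symm a.unop q.unop).symm
  nondeg_left x hx hl := MulOpposite.unop_injective <|
    h.nondeg_right x.unop (congrArg MulOpposite.unop hx) fun y => by
      simpa using hl (MulOpposite.op y)
  nondeg_right x hx hl := MulOpposite.unop_injective <|
    h.nondeg_left x.unop (congrArg MulOpposite.unop hx) fun y => by
      simpa using hl (MulOpposite.op y)
  faithful_left a ha := MulOpposite.unop_injective <| h.faithful_right a.unop fun y => by
    simpa [mul_assoc] using congrArg MulOpposite.unop (ha (MulOpposite.op y))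
  faithful_right a ha := MulOpposite.unop_injective <| h.faithful_left a.unop fun y => by
    simpa [mul_assoc] using congrArg MulOpposite.unop (ha (MulOpposite.op y))
  exists_form γ h₁ h₂ := by
    let ι := (MulOpposite.opLinearEquiv K : R ≃ₗ[K] Rᵐᵒᵖ).toLinearMap
    obtain ⟨a, ha⟩ := h.exists_form (γ.compl₁₂ ι ι).flip
      (fun x y => by simpa [ι] using h₁ (MulOpposite.op y) (MulOpposite.op x))
      (fun a x y => by
        simpa [ι, mul_assoc] using
          (h₂ (MulOpposite.op a) (MulOpposite.op y) (MulOpposite.op x)).symm)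
    refine ⟨MulOpposite.op a, fun x y => ?_⟩
    simpa [ι, mul_assoc] using ha y.unop x.unop

end IsSymmIdempotent

/-- The functional `f` on `M` corresponds to the linear map `φ : M → R` under the natural map
`D(M) → Hom(M, R)`. -/
def Corresponds (e : R) (lam : R →ₗ[K] K) {M : ModuleCat.{u} R} (f : M →ₗ[K] K)
    (φ : M →ₗ[R] R) : Prop :=
  ∀ x m, f ((x * e) • m) = lam (φ m * (x * e))

/-- For fixed `m` the form `(x, y) ↦ f (x e y m)` is balanced over `eRe`, and `φ m` is the element
that represents it. Faithfulness and nondegeneracy make that element unique, whence linearity. -/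
theorem IsSymmIdempotent.exists_corresponds (h : IsSymmIdempotent e lam) {M : ModuleCat.{u} R}
    (f : M →ₗ[K] K) : ∃ φ : M →ₗ[R] R, Corresponds e lam f φ := by
  have key : ∀ m : M, ∃ a : R, ∀ x y, f ((x * e * y) • m) = lam (y * a * x) := by
    intro m
    refine h.exists_form (LinearMap.mk₂ K (fun x y => f ((x * e * y) • m)) ?_ ?_ ?_ ?_) ?_ ?_
    · intro x x' y; simp [add_mul, add_smul]
    · intro c x y; simp
    · intro x y y'; simp [mul_add, add_smul]
    · intro c x y; simp
    · intro x y
      simp only [LinearMap.mk₂_apply]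
      rw [mul_assoc x e e, h.idem, ← mul_assoc (x * e) e y, mul_assoc x e e, h.idem]
    · intro a x y
      simp only [LinearMap.mk₂_apply]
      congr 2
      simp only [mul_assoc]
      rw [← mul_assoc e e y, h.idem, ← mul_assoc e e (a * _), h.idem]
  choose φ hφ using key
  have uniq : ∀ a b : R, (∀ x y, lam (y * a * x) = lam (y * b * x)) → a = b := by
    intro a b hab
    refine sub_eq_zero.1 (h.faithful_right _ fun y => ?_)
    refine h.nondeg_right _ (by simp only [← mul_assoc, h.idem]) fun x => ?_
    rw [mul_sub, sub_mul, map_sub, hab, sub_self]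
  refine ⟨{ toFun := φ, map_add' := fun m n => uniq _ _ fun x y => ?_,
            map_smul' := fun r m => uniq _ _ fun x y => ?_ }, fun x m => ?_⟩
  · rw [← hφ, smul_add, map_add, hφ, hφ, ← map_add]; congr 1; noncomm_ring
  · rw [← hφ, ← mul_smul, mul_assoc, hφ]; simp [mul_assoc]
  · have := hφ m x 1
    simp only [mul_one, one_mul] at this
    rw [this, ← mul_assoc, h.lam_mul_e]; rfl

theorem IsSymmIdempotent.corresponds_unique (h : IsSymmIdempotent e lam) {M : ModuleCat.{u} R}
    {f : M →ₗ[K] K} {φ ψ : M →ₗ[R] R} (hφ : Corresponds e lam f φ) (hψ : Corresponds e lam f ψ) :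
    φ = ψ := by
  ext m
  refine sub_eq_zero.1 (h.faithful_right _ fun y => ?_)
  refine h.nondeg_right _ (by simp only [← mul_assoc, h.idem]) fun x => ?_
  have h₁ := hφ x (y • m)
  have h₂ := hψ x (y • m)
  rw [h₁, map_smul, map_smul, smul_eq_mul, smul_eq_mul, ← mul_assoc, ← mul_assoc, h.lam_mul_e,
    h.lam_mul_e] at h₂
  rw [mul_assoc, mul_assoc, h.lam_e_mul, sub_mul, mul_sub, map_sub, ← mul_assoc, ← mul_assoc, h₂,
    sub_self]

theorem Corresponds.comp {M N : ModuleCat.{u} R} {f : N →ₗ[K] K} {φ : N →ₗ[R] R}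
    (h : Corresponds e lam f φ) (g : M →ₗ[R] N) :
    Corresponds e lam (f ∘ₗ g.restrictScalars K) (φ ∘ₗ g) := fun x m => by
  simpa using h x (g m)

theorem Corresponds.add {M : ModuleCat.{u} R} {f f' : M →ₗ[K] K} {φ φ' : M →ₗ[R] R}
    (h : Corresponds e lam f φ) (h' : Corresponds e lam f' φ') :
    Corresponds e lam (f + f') (φ + φ') := fun x m => by
  simp only [LinearMap.add_apply, h x m, h' x m, add_mul, map_add]

theorem corresponds_zero {M : ModuleCat.{u} R} :
    Corresponds e lam (0 : M →ₗ[K] K) 0 := fun x m => by simp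

/-- The natural map `D(M) → Hom(M, R)` is bijective. Equivalently, `M` has codominant dimension
at least `2`. -/
structure DualIsHom (e : R) (lam : R →ₗ[K] K) (M : ModuleCat.{u} R) : Prop where
  inj : ∀ f : M →ₗ[K] K, (∀ x m, f ((x * e) • m) = 0) → f = 0
  surj : ∀ φ : M →ₗ[R] R, ∃ f : M →ₗ[K] K, Corresponds e lam f φ

variable {X P M : ModuleCat.{u} R}

theorem DualIsHom.unique (hM : DualIsHom e lam M) {f g : M →ₗ[K] K} {φ : M →ₗ[R] R}
    (hf : Corresponds e lam f φ) (hg : Corresponds e lam g φ) : f = g :=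
  sub_eq_zero.1 (hM.inj _ fun x m => by rw [LinearMap.sub_apply, hf, hg, sub_self])

theorem DualIsHom.of_retract (hM : DualIsHom e lam M) (i : X →ₗ[R] M) (r : M →ₗ[R] X)
    (hri : ∀ x, r (i x) = x) : DualIsHom e lam X where
  inj f hf := by
    have := hM.inj (f ∘ₗ r.restrictScalars K) (fun x m => by simpa using hf x (r m))
    ext x
    simpa [hri] using LinearMap.congr_fun this (i x)
  surj φ := by
    obtain ⟨f, hf⟩ := hM.surj (φ ∘ₗ r)
    refine ⟨f ∘ₗ i.restrictScalars K, ?_⟩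
    have := hf.comp i
    rwa [LinearMap.comp_assoc, show r ∘ₗ i = LinearMap.id from LinearMap.ext hri] at this

/-- A five lemma argument: `D` and `Hom(-, R)` both turn cokernels into kernels, and the comparison
map is natural. -/
theorem DualIsHom.coker {i : X →ₗ[R] P} {p : P →ₗ[R] M} (hX : DualIsHom e lam X)
    (hP : DualIsHom e lam P) (h : IsShortExact i p) : DualIsHom e lam M where
  inj f hf := by
    have := hP.inj (f ∘ₗ p.restrictScalars K) (fun x m => by simpa using hf x (p m))
    ext m
    obtain ⟨y, rfl⟩ := h.surj m
    exact LinearMap.congr_fun this y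
  surj φ := by
    obtain ⟨f, hf⟩ := hP.surj (φ ∘ₗ p)
    have h0 := hf.comp i
    rw [show (φ ∘ₗ p) ∘ₗ i = 0 from LinearMap.ext fun k => by simp [h.comp_eq_zero]] at h0
    have h1 := hX.unique h0 corresponds_zero
    obtain ⟨g, hg⟩ := exists_factor (p.restrictScalars K) h.surj f (fun y hy => by
      obtain ⟨k, rfl⟩ := (h.exact y).1 hy
      exact LinearMap.congr_fun h1 k)
    refine ⟨g, fun x m => ?_⟩
    obtain ⟨y, rfl⟩ := h.surj m
    have := hf x y
    rw [← hg] at this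
    simpa using this

/-- Translate `φ` into a functional, extend the functional linearly over `K`, and translate back.
The codominant dimension of the submodule thus does the work of a vanishing `Ext¹` of the quotient.
-/
theorem IsSymmIdempotent.exists_extension (hs : IsSymmIdempotent e lam) {i : X →ₗ[R] P}
    (hi : Function.Injective i) (hX : DualIsHom e lam X) (φ : X →ₗ[R] R) :
    ∃ ψ : P →ₗ[R] R, ∀ x, ψ (i x) = φ x := by
  obtain ⟨f, hf⟩ := hX.surj φ
  obtain ⟨g, hg⟩ := exists_extend_functional K (i.restrictScalars K) hi f
  obtain ⟨ψ, hψ⟩ := hs.exists_corresponds g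
  have h1 := hψ.comp i
  rw [show g ∘ₗ i.restrictScalars K = f from LinearMap.ext hg] at h1
  exact ⟨ψ, LinearMap.congr_fun (hs.corresponds_unique h1 hf)⟩

theorem DualIsHom.ker {i : X →ₗ[R] P} {p : P →ₗ[R] M} (hs : IsSymmIdempotent e lam)
    (hM : DualIsHom e lam M) (hP : DualIsHom e lam P) (h : IsShortExact i p)
    (hex : ∀ φ : X →ₗ[R] R, ∃ ψ : P →ₗ[R] R, ∀ x, ψ (i x) = φ x) : DualIsHom e lam X where
  inj f hf := by
    obtain ⟨F, hF⟩ := exists_extend_functional K (i.restrictScalars K) h.inj f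
    have hFi : F ∘ₗ i.restrictScalars K = f := LinearMap.ext hF
    obtain ⟨ψ, hψ⟩ := hs.exists_corresponds F
    have h1 := hψ.comp i
    rw [hFi] at h1
    have h2 : ψ ∘ₗ i = 0 := hs.corresponds_unique h1 (fun x m => by simpa using hf x m)
    obtain ⟨χ, hχ⟩ := exists_factor p h.surj ψ (fun y hy => by
      obtain ⟨k, rfl⟩ := (h.exact y).1 hy
      exact LinearMap.congr_fun h2 k)
    obtain ⟨g, hg⟩ := hM.surj χ
    have h3 := hg.comp p
    rw [show χ ∘ₗ p = ψ from LinearMap.ext hχ] at h3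
    rw [← hFi, hP.unique hψ h3]
    ext k
    simp [h.comp_eq_zero]
  surj φ := by
    obtain ⟨ψ, hψ⟩ := hex φ
    obtain ⟨F, hF⟩ := hP.surj ψ
    refine ⟨F ∘ₗ i.restrictScalars K, ?_⟩
    have := hF.comp i
    rwa [show ψ ∘ₗ i = φ from LinearMap.ext hψ] at this

/-- For surjectivity, first match `ψ` on `X` by extending a functional from `X` to `P`; the
remaining difference factors through `M`, where it again comes from a functional. -/
theorem DualIsHom.extension {i : X →ₗ[R] P} {p : P →ₗ[R] M} (hs : IsSymmIdempotent e lam)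
    (hX : DualIsHom e lam X) (hM : DualIsHom e lam M) (h : IsShortExact i p) :
    DualIsHom e lam P where
  inj f hf := by
    have h1 := hX.inj (f ∘ₗ i.restrictScalars K) (fun x m => by simpa using hf x (i m))
    obtain ⟨g, hg⟩ := exists_factor (p.restrictScalars K) h.surj f (fun y hy => by
      obtain ⟨k, rfl⟩ := (h.exact y).1 hy
      exact LinearMap.congr_fun h1 k)
    have h2 := hM.inj g (fun x m => by
      obtain ⟨y, rfl⟩ := h.surj m
      have := hg ((x * e) • y)
      rw [hf] at this
      simpa using this)
    ext y
    rw [← hg, h2]; rfl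
  surj ψ := by
    obtain ⟨f, hf⟩ := hX.surj (ψ ∘ₗ i)
    obtain ⟨F, hF⟩ := exists_extend_functional K (i.restrictScalars K) h.inj f
    obtain ⟨ψ', hψ'⟩ := hs.exists_corresponds F
    have h1 := hψ'.comp i
    rw [show F ∘ₗ i.restrictScalars K = f from LinearMap.ext hF] at h1
    have h2 := hs.corresponds_unique hf h1
    obtain ⟨χ, hχ⟩ := exists_factor p h.surj (ψ - ψ') (fun y hy => by
      obtain ⟨k, rfl⟩ := (h.exact y).1 hy
      exact sub_eq_zero.2 (LinearMap.congr_fun h2 k))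
    obtain ⟨g, hg⟩ := hM.surj χ
    refine ⟨F + g ∘ₗ p.restrictScalars K, ?_⟩
    have := hψ'.add (hg.comp p)
    rwa [show χ ∘ₗ p = ψ - ψ' from LinearMap.ext hχ, add_sub_cancel] at this

end SymmetricIdempotent

/-! ### The modules in `add(Re)`: trace form, injectivity, embeddings. -/

section AddIdempotent

/-- A functional on a finite-dimensional space `V` that vanishes on the common kernel of a linear
family of functionals belongs to the family. -/
theorem exists_eq_of_vanish {K V W : Type*} [Field K] [AddCommGroup V] [AddCommGroup W]
    [Module K V] [Module K W] [FiniteDimensional K V] (T : W →ₗ[K] V →ₗ[K] K) (g : V →ₗ[K] K)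
    (hg : ∀ v, (∀ w, T w v = 0) → g v = 0) : ∃ w, T w = g := by
  have : g ∈ (LinearMap.range T).dualCoannihilator.dualAnnihilator := by
    rw [Submodule.mem_dualAnnihilator]
    intro v hv
    rw [Submodule.mem_dualCoannihilator] at hv
    exact hg v fun w => hv _ ⟨w, rfl⟩
  rw [Subspace.dualCoannihilator_dualAnnihilator_eq] at this
  exact this

variable {K : Type u} [Field K] {R : Type u} [Ring R] [Algebra K R]

/-- A dual basis of `P` exhibiting `P` as a direct summand of a power of `Re`. -/
structure DualBasis (e : R) (P : ModuleCat.{u} R) where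
  n : ℕ
  gen : Fin n → P
  coord : Fin n → (P →ₗ[R] R)
  e_smul_gen : ∀ i, e • gen i = gen i
  coord_mul_e : ∀ i x, coord i x * e = coord i x
  sum_coord : ∀ x, ∑ i, coord i x • gen i = x

variable {e : R} {lam : R →ₗ[K] K} {P Q X Z M : ModuleCat.{u} R}

namespace DualBasis

/-- A direct summand of `P` inherits a dual basis. -/
def ofRetract (b : DualBasis e P) (i : X →ₗ[R] P) (r : P →ₗ[R] X) (hri : ∀ x, r (i x) = x) :
    DualBasis e X where
  n := b.n
  gen j := r (b.gen j)
  coord j := b.coord j ∘ₗ i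
  e_smul_gen j := by rw [← map_smul, b.e_smul_gen]
  coord_mul_e j x := b.coord_mul_e j (i x)
  sum_coord x := by
    conv_rhs => rw [← hri x, ← b.sum_coord (i x)]
    simp

theorem projective (b : DualBasis e P) : Module.Projective R P :=
  Module.Projective.of_split (LinearMap.pi b.coord)
    (Fintype.linearCombination R b.gen) (LinearMap.ext fun x => by
      simpa [Fintype.linearCombination_apply] using b.sum_coord x)

theorem finite (b : DualBasis e P) : Module.Finite R P :=
  Module.Finite.of_surjective (Fintype.linearCombination R b.gen) fun x =>
    ⟨fun i => b.coord i x, by simpa [Fintype.linearCombination_apply] using b.sum_coord x⟩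

theorem e_mul_apply (b : DualBasis e P) (φ : P →ₗ[R] R) (i : Fin b.n) :
    e * φ (b.gen i) = φ (b.gen i) := by
  conv_rhs => rw [← b.e_smul_gen, map_smul, smul_eq_mul]

theorem apply_eq_sum (b : DualBasis e P) {N : Type*} [AddCommGroup N] [Module R N]
    (φ : P →ₗ[R] N) (x : P) : φ x = ∑ i, b.coord i x • φ (b.gen i) := by
  conv_lhs => rw [← b.sum_coord x]
  simp

/-- The functional on `P` corresponding to `φ : P → R`. -/
def functional (lam : R →ₗ[K] K) (b : DualBasis e P) (φ : P →ₗ[R] R) : P →ₗ[K] K :=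
  ∑ i, lam ∘ₗ LinearMap.mulLeft K (φ (b.gen i)) ∘ₗ (b.coord i).restrictScalars K

theorem functional_apply (b : DualBasis e P) (φ : P →ₗ[R] R) (x : P) :
    b.functional lam φ x = ∑ i, lam (φ (b.gen i) * b.coord i x) := by
  simp [functional]

/-- After expanding `φ m` in the dual basis, each factor `φ (gen i) x e` lies in `eRe`, where the
trace property lets it move past `coord i m`. -/
theorem corresponds_functional (hs : IsSymmIdempotent e lam) (b : DualBasis e P)
    (φ : P →ₗ[R] R) : Corresponds e lam (b.functional lam φ) φ := by
  intro x m
  rw [functional_apply, b.apply_eq_sum φ m, Finset.sum_mul, map_sum]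
  refine Finset.sum_congr rfl fun i _ => ?_
  rw [map_smul, smul_eq_mul, smul_eq_mul, ← mul_assoc, ← mul_assoc,
    hs.lam_comm (p := φ (b.gen i) * x * e), ← mul_assoc, ← mul_assoc, ← mul_assoc]
  · rw [← mul_assoc, ← mul_assoc, b.e_mul_apply]
  · rw [mul_assoc, hs.idem]

theorem dualIsHom (hs : IsSymmIdempotent e lam) (b : DualBasis e P) : DualIsHom e lam P where
  inj f hf := by
    ext x
    rw [← b.sum_coord x, map_sum, LinearMap.zero_apply]
    refine Finset.sum_eq_zero fun i _ => ?_
    rw [← b.coord_mul_e, hf]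
  surj φ := ⟨_, b.corresponds_functional hs φ⟩

/-- The isomorphism `Hom(P, R) ≅ D(P)` of right modules. -/
def homEquivDual (hs : IsSymmIdempotent e lam) (b : DualBasis e P) :
    (P →ₗ[R] R) ≃ₗ[Rᵐᵒᵖ] D K P :=
  LinearEquiv.ofBijective
    { toFun := fun φ => (dEquiv K P).symm (b.functional lam φ)
      map_add' := fun φ ψ => by
        rw [← map_add]
        congr 1
        ext x
        simp [functional_apply, add_mul, Finset.sum_add_distrib]
      map_smul' := fun r φ => dual_ext K fun x => by
        rw [RingHom.id_apply, dEquiv_smul, LinearEquiv.apply_symm_apply,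
          LinearEquiv.apply_symm_apply, functional_apply, functional_apply]
        simp [mul_assoc] }
    ⟨fun φ ψ h => by
      have h' : b.functional lam φ = b.functional lam ψ := (dEquiv K P).symm.injective h
      have h1 := b.corresponds_functional hs φ
      rw [h'] at h1
      exact hs.corresponds_unique h1 (b.corresponds_functional hs ψ),
    fun F => by
      obtain ⟨φ, hφ⟩ := hs.exists_corresponds (dEquiv K P F)
      refine ⟨φ, ?_⟩
      exact (LinearEquiv.symm_apply_eq _).2
        ((b.dualIsHom hs).unique (b.corresponds_functional hs φ) hφ)⟩

theorem dEquiv_homEquivDual (hs : IsSymmIdempotent e lam) (b : DualBasis e P) (φ : P →ₗ[R] R) :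
    dEquiv K P (b.homEquivDual hs φ) = b.functional lam φ :=
  (dEquiv K P).apply_symm_apply _

/-- The dual basis of `D(P)`. -/
def dual (hs : IsSymmIdempotent e lam) (b : DualBasis e P) :
    DualBasis (MulOpposite.op e) (D K P) where
  n := b.n
  gen i := b.homEquivDual hs (b.coord i)
  coord i :=
    { toFun := fun F => MulOpposite.op ((b.homEquivDual hs).symm F (b.gen i))
      map_add' := fun F G => by simp
      map_smul' := fun r F => by simp }
  e_smul_gen i := by
    rw [← map_smul]
    congr 1
    ext x
    exact b.coord_mul_e i x
  coord_mul_e i F := congrArg MulOpposite.op (b.e_mul_apply _ i)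
  sum_coord F := by
    have : ∀ i, MulOpposite.op ((b.homEquivDual hs).symm F (b.gen i)) •
        b.homEquivDual hs (b.coord i) = b.homEquivDual hs
          (MulOpposite.op ((b.homEquivDual hs).symm F (b.gen i)) • b.coord i) :=
      fun i => (map_smul _ _ _).symm
    simp only [LinearMap.coe_mk, AddHom.coe_mk, this]
    rw [← map_sum, ← LinearEquiv.eq_symm_apply]
    ext x
    rw [b.apply_eq_sum ((b.homEquivDual hs).symm F) x]
    simp

/-- The trace form on the endomorphisms of `P`. -/
def trace (lam : R →ₗ[K] K) (b : DualBasis e P) (f : P →ₗ[R] P) : K :=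
  ∑ i, lam (b.coord i (f (b.gen i)))

theorem coord_apply_mem (b : DualBasis e P) (f : Q →ₗ[R] P) (i : Fin b.n) (q : Q)
    (hq : e • q = q) : e * b.coord i (f q) = b.coord i (f q) := by
  conv_rhs => rw [← hq, map_smul, map_smul, smul_eq_mul]

/-- The matrix entries of `f` and `g` with respect to the dual bases lie in `eRe`, so this is the
cyclicity of a matrix trace with values in a symmetric algebra. -/
theorem trace_comm (hs : IsSymmIdempotent e lam) (b : DualBasis e P) (c : DualBasis e Q)
    (f : P →ₗ[R] Q) (g : Q →ₗ[R] P) : b.trace lam (g ∘ₗ f) = c.trace lam (f ∘ₗ g) := by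
  have h1 : b.trace lam (g ∘ₗ f) = ∑ i, ∑ j,
      lam (c.coord j (f (b.gen i)) * b.coord i (g (c.gen j))) := by
    refine Finset.sum_congr rfl fun i _ => ?_
    rw [LinearMap.comp_apply, c.apply_eq_sum g]
    simp
  have h2 : c.trace lam (f ∘ₗ g) = ∑ j, ∑ i,
      lam (b.coord i (g (c.gen j)) * c.coord j (f (b.gen i))) := by
    refine Finset.sum_congr rfl fun j _ => ?_
    rw [LinearMap.comp_apply, b.apply_eq_sum f]
    simp
  rw [h1, h2, Finset.sum_comm]
  refine Finset.sum_congr rfl fun j _ => Finset.sum_congr rfl fun i _ => ?_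
  exact hs.lam_comm (c.coord_apply_mem f j _ (b.e_smul_gen i)) (c.coord_mul_e _ _) _

/-- The pairing `Hom(Z, P) × Hom(P, Z) → K` given by the trace form. -/
def pairing (lam : R →ₗ[K] K) (b : DualBasis e P) (Z : ModuleCat.{u} R) :
    (Z →ₗ[R] P) →ₗ[K] (P →ₗ[R] Z) →ₗ[K] K :=
  LinearMap.mk₂ K (fun u v => b.trace lam (u ∘ₗ v))
    (fun u u' v => by simp [trace, Finset.sum_add_distrib])
    (fun k u v => by simp [trace, Finset.mul_sum])
    (fun u v v' => by simp [trace, Finset.sum_add_distrib])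
    (fun k u v => by simp [trace, Finset.mul_sum])

theorem pairing_apply (b : DualBasis e P) (u : Z →ₗ[R] P) (v : P →ₗ[R] Z) :
    b.pairing lam Z u v = b.trace lam (u ∘ₗ v) := rfl

/-- Testing against the rank one maps `x ↦ coord i x • z` shows that `lam` vanishes on `coord i (u
z)` for all `z`; replacing `z` by `y • z` makes the nondegeneracy of `lam` applicable. -/
theorem pairing_left (hs : IsSymmIdempotent e lam) (b : DualBasis e P) (u : Z →ₗ[R] P)
    (hu : ∀ v : P →ₗ[R] Z, b.trace lam (u ∘ₗ v) = 0) : u = 0 := by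
  have key : ∀ i z, lam (b.coord i (u z)) = 0 := by
    intro i z
    rw [← hu (LinearMap.toSpanSingleton R Z z ∘ₗ b.coord i), b.apply_eq_sum (b.coord i) (u z),
      map_sum]
    refine Finset.sum_congr rfl fun k _ => ?_
    simp only [LinearMap.comp_apply, LinearMap.toSpanSingleton_apply, map_smul, smul_eq_mul]
    exact (hs.lam_comm (b.e_mul_apply _ _) (b.coord_mul_e _ _) _).symm
  ext z
  rw [LinearMap.zero_apply, ← b.sum_coord (u z)]
  refine Finset.sum_eq_zero fun i _ => ?_
  rw [hs.nondeg_left (b.coord i (u z)) (b.coord_mul_e _ _) fun y => ?_, zero_smul]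
  have := key i (y • z)
  rwa [map_smul, map_smul, smul_eq_mul] at this

end DualBasis

section Finite

variable [FiniteDimensional K R]

/-- This is `Hom(N, Re) ≅ D(eN)`, the adjunction form of `Re ≅ D(eR)`: for each `z`, the functional
`y ↦ F (e y z)` is represented by an element of `Re`. -/
theorem IsSymmIdempotent.exists_coord (hs : IsSymmIdempotent e lam) {N : Type u} [AddCommGroup N]
    [Module R N] [Module K N] [IsScalarTower K R N] (F : N →ₗ[K] K) :
    ∃ ξ : N →ₗ[R] R, (∀ z, ξ z * e = ξ z) ∧ ∀ y z, lam (y * ξ z) = F ((e * y) • z) := by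
  have key : ∀ z : N, ∃ x : R, x * e = x ∧ ∀ y, lam (y * x) = F ((e * y) • z) := by
    intro z
    let T : R →ₗ[K] R →ₗ[K] K :=
      ((LinearMap.mul K R).flip.comp (LinearMap.mulRight K e)).compr₂ lam
    have hT : ∀ x y, T x y = lam (y * (x * e)) := fun x y => rfl
    obtain ⟨x, hx⟩ := exists_eq_of_vanish T
      (F ∘ₗ (LinearMap.toSpanSingleton R N z).restrictScalars K ∘ₗ LinearMap.mulLeft K e)
      (fun y hy => by
        have : e * y = 0 := hs.nondeg_right _ (by rw [← mul_assoc, hs.idem]) fun x => by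
          rw [mul_assoc, hs.lam_e_mul, ← hs.lam_mul_e, mul_assoc, ← hT, hy]
        simp [this])
    refine ⟨x * e, by rw [mul_assoc, hs.idem], fun y => ?_⟩
    rw [← hT, hx]
    simp
  choose ξ hξ hξ' using key
  have uniq : ∀ a b : R, a * e = a → b * e = b → (∀ y, lam (y * a) = lam (y * b)) → a = b := by
    intro a b ha hb hab
    exact sub_eq_zero.1 (hs.nondeg_left _ (by rw [sub_mul, ha, hb]) fun y => by
      rw [mul_sub, map_sub, hab, sub_self])
  refine ⟨{ toFun := ξ, map_add' := fun a b => ?_, map_smul' := fun r a => ?_ }, hξ, fun y z => hξ' z y⟩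
  · refine uniq _ _ (hξ _) (by rw [add_mul, hξ, hξ]) fun y => ?_
    rw [hξ', mul_add, map_add, hξ', hξ', smul_add, map_add]
  · refine uniq _ _ (hξ _) (by rw [RingHom.id_apply, smul_eq_mul, mul_assoc, hξ]) fun y => ?_
    rw [hξ', RingHom.id_apply, smul_eq_mul, ← mul_assoc, hξ', ← mul_smul, ← mul_assoc]

namespace DualBasis

/-- An arbitrary functional `F` on `Z` is represented by some `ξ : Z → Re`; testing against `z ↦ ξ z
• gen i` yields `F (v (gen i)) = 0`. -/
theorem pairing_right (hs : IsSymmIdempotent e lam) (b : DualBasis e P) (v : P →ₗ[R] Z)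
    (hv : ∀ u : Z →ₗ[R] P, b.trace lam (u ∘ₗ v) = 0) : v = 0 := by
  have key : ∀ i, v (b.gen i) = 0 := by
    refine fun i => exists_functional_ne K fun F => ?_
    obtain ⟨ξ, hξ, hξ'⟩ := hs.exists_coord F
    rw [← hv (LinearMap.toSpanSingleton R P (b.gen i) ∘ₗ ξ)]
    have h1 : F (v (b.gen i)) = lam (ξ (v (b.gen i))) := by
      have := hξ' 1 (v (b.gen i))
      rw [one_mul, mul_one, ← map_smul, b.e_smul_gen] at this
      exact this.symm
    rw [h1, ← LinearMap.comp_apply, b.apply_eq_sum (ξ ∘ₗ v) (b.gen i), map_sum]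
    refine Finset.sum_congr rfl fun k _ => ?_
    simp only [LinearMap.comp_apply, LinearMap.toSpanSingleton_apply, map_smul, smul_eq_mul]
    exact hs.lam_comm (b.e_mul_apply _ _) (b.coord_mul_e _ _) _
  ext x
  rw [b.apply_eq_sum v x]
  simp [key]

/-- The trace pairing is perfect, `Hom(Z, P) ≅ D Hom(P, Z)`. Maps into `P` can therefore be
prescribed by functionals; this is how the almost split sequences are built. -/
theorem exists_pairing_eq (hs : IsSymmIdempotent e lam) (b : DualBasis e P)
    [Module.Finite R Z] (g : (P →ₗ[R] Z) →ₗ[K] K) :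
    ∃ u : Z →ₗ[R] P, ∀ v, b.trace lam (u ∘ₗ v) = g v := by
  have := finiteDimensional_of_finite K Z
  have := b.finite
  have := finiteDimensional_of_finite K P
  have : FiniteDimensional K (P →ₗ[R] Z) := Module.Finite.of_injective
    (LinearMap.restrictScalarsₗ K R P Z K) (LinearMap.restrictScalars_injective K)
  obtain ⟨u, hu⟩ := exists_eq_of_vanish (b.pairing lam Z) g (fun v hv => by
    rw [b.pairing_right hs v hv, map_zero])
  exact ⟨u, fun v => LinearMap.congr_fun hu v⟩

/-- Each coordinate is a map to `Re`, hence determined by a functional, and functionals extend along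
injections. -/
theorem injective (hs : IsSymmIdempotent e lam) (b : DualBasis e P) : Module.Injective R P where
  out X Y _ _ _ _ i hi g := by
    let : Module K X := Module.compHom X (algebraMap K R)
    let : Module K Y := Module.compHom Y (algebraMap K R)
    have : IsScalarTower K R X := ⟨fun k r x => by
      change (k • r) • x = algebraMap K R k • r • x
      rw [Algebra.smul_def, mul_smul]⟩
    have : IsScalarTower K R Y := ⟨fun k r x => by
      change (k • r) • x = algebraMap K R k • r • x
      rw [Algebra.smul_def, mul_smul]⟩
    have key : ∀ j, ∃ ξ : Y →ₗ[R] R, ∀ x, ξ (i x) = b.coord j (g x) := by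
      intro j
      obtain ⟨F, hF⟩ := exists_extend_functional K (i.restrictScalars K) hi
        (lam ∘ₗ (b.coord j ∘ₗ g).restrictScalars K)
      obtain ⟨ξ, hξ, hξ'⟩ := hs.exists_coord F
      refine ⟨ξ, fun x => sub_eq_zero.1 (hs.nondeg_left _ ?_ fun y => ?_)⟩
      · rw [sub_mul, hξ, b.coord_mul_e]
      · rw [mul_sub, map_sub, hξ', ← map_smul]
        erw [hF]
        simp [mul_assoc, hs.lam_e_mul]
    choose ξ hξ using key
    refine ⟨∑ j, LinearMap.toSpanSingleton R P (b.gen j) ∘ₗ ξ j, fun x => ?_⟩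
    rw [← b.sum_coord (g x)]
    simp [hξ]

end DualBasis

/-- A finitely generated projective module generated by `eP` is a direct summand of a power of
`Re`. -/
theorem nonempty_dualBasis_of_span (K : Type u) [Field K] [Algebra K R] [FiniteDimensional K R]
    [Module.Finite R P] [Module.Projective R P] (he : e * e = e)
    (hP : Submodule.span R (Set.range fun x : P => e • x) = ⊤) : Nonempty (DualBasis e P) := by
  obtain ⟨n, s, hs⟩ := (finiteDimensional_of_finite K P).exists_fin
  have hsurj : Function.Surjective (Fintype.linearCombination R fun i => e • s i) := by
    rw [← LinearMap.range_eq_top, Fintype.range_linearCombination, eq_top_iff, ← hP,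
      Submodule.span_le]
    rintro _ ⟨x, rfl⟩
    have hx : x ∈ Submodule.span K (Set.range s) := hs ▸ Submodule.mem_top
    change e • x ∈ Submodule.span R _
    induction hx using Submodule.span_induction with
    | mem x hx =>
      obtain ⟨i, rfl⟩ := hx
      exact Submodule.subset_span ⟨i, rfl⟩
    | zero => simp
    | add x y _ _ hx hy => rw [smul_add]; exact add_mem hx hy
    | smul k x _ hx =>
      rw [smul_comm]
      exact Submodule.smul_of_tower_mem _ k hx
  obtain ⟨t, ht⟩ := Module.projective_lifting_property _ LinearMap.id hsurj
  refine ⟨⟨n, fun i => e • s i, fun i => LinearMap.toSpanSingleton R R e ∘ₗ LinearMap.proj i ∘ₗ t,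
    fun i => ?_, fun i x => ?_, fun x => ?_⟩⟩
  · rw [← mul_smul, he]
  · simp [mul_assoc, he]
  · have := LinearMap.congr_fun ht x
    simp only [LinearMap.comp_apply, Fintype.linearCombination_apply, LinearMap.id_apply] at this
    conv_rhs => rw [← this]
    refine Finset.sum_congr rfl fun i _ => ?_
    simp [← mul_smul, mul_assoc, he]

/-- A module on which `eR` acts faithfully embeds into a direct sum of copies of `Re`. -/
theorem exists_embedding (hs : IsSymmIdempotent e lam) [Module.Finite R M]
    (hM : ∀ m : M, (∀ y, (e * y) • m = 0) → m = 0) :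
    ∃ (Q : ModuleCat.{u} R) (_ : DualBasis e Q) (i : M →ₗ[R] Q), Function.Injective i := by
  have := finiteDimensional_of_finite K M
  obtain ⟨n, F, hF⟩ := Module.Finite.exists_fin (R := K) (M := M →ₗ[K] K)
  have key := fun i => hs.exists_coord (F i)
  choose ξ hξ hξ' using key
  -- `N` is `(Re)ⁿ`; the maps `ξ i` represent a finite spanning family of `D(M)`, so an element they
  -- all kill is annihilated by `eR`.
  let N : Submodule R (Fin n → R) :=
    { carrier := {v | ∀ i, v i * e = v i}
      add_mem' := fun {a b} ha hb i => by simp [add_mul, ha i, hb i]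
      zero_mem' := fun i => by simp
      smul_mem' := fun r a ha i => by simp [mul_assoc, ha i] }
  refine ⟨ModuleCat.of R N, ⟨n, fun i => ⟨Pi.single i e, fun j => ?_⟩,
    fun i => LinearMap.proj i ∘ₗ N.subtype, fun i => Subtype.ext ?_,
    fun i x => x.2 i, fun x => Subtype.ext ?_⟩,
    (LinearMap.pi ξ).codRestrict N fun m i => hξ i m, ?_⟩
  · by_cases h : j = i
    · subst h; simp [hs.idem]
    · simp [h]
  · ext j
    by_cases h : j = i
    · subst h; simp [hs.idem]
    · simp [h]
  · ext j
    simpa [Finset.sum_apply, Pi.single_apply] using x.2 j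
  · refine (injective_iff_map_eq_zero _).2 fun m hm => hM m fun y => ?_
    refine exists_functional_ne K fun f => ?_
    have hf : f ∈ Submodule.span K (Set.range F) := hF ▸ Submodule.mem_top
    induction hf using Submodule.span_induction with
    | mem f hf =>
      obtain ⟨i, rfl⟩ := hf
      rw [← hξ']
      have : ξ i m = 0 := congrFun (congrArg Subtype.val hm) i
      rw [this, mul_zero, map_zero]
    | zero => rfl
    | add f g _ _ hf hg => rw [LinearMap.add_apply, hf, hg, add_zero]
    | smul k f _ hf => rw [LinearMap.smul_apply, hf, smul_zero]

end Finite

end AddIdempotent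

/-! ### Biperfect modules, and why Gorenstein projective-injective modules are biperfect. -/

section GorensteinProjInj

variable {K : Type u} [Field K] {R : Type u} [Ring R] [Algebra K R]

/-- The functional `lam`, on the opposite algebra. -/
def opFunctional (lam : R →ₗ[K] K) : Rᵐᵒᵖ →ₗ[K] K :=
  lam ∘ₗ (MulOpposite.opLinearEquiv K).symm.toLinearMap

variable {e : R} {lam : R →ₗ[K] K}

theorem IsSymmIdempotent.opFunctional (hs : IsSymmIdempotent e lam) :
    IsSymmIdempotent (MulOpposite.op e) (opFunctional lam) := hs.op

/-- `M` has infinite dominant and codominant dimension. -/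
structure IsBiperfect (e : R) (lam : R →ₗ[K] K) (M : ModuleCat.{u} R) : Prop where
  ext : ExtVanish M (ModuleCat.of R R)
  hom : DualIsHom e lam M
  ext_dual : ExtVanish (D K M) (ModuleCat.of Rᵐᵒᵖ Rᵐᵒᵖ)
  hom_dual : DualIsHom (MulOpposite.op e) (opFunctional lam) (D K M)

namespace IsBiperfect

variable {X P M : ModuleCat.{u} R}

/-- The conditions feed each other. `Ext¹(M, R) = 0` supplies the extensions from `X` to `P` needed
for `DualIsHom` on `X`, while `DualIsHom` on `D(M)` supplies the extensions that kill `Ext¹(D(X),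
R)`. -/
theorem ker (hs : IsSymmIdempotent e lam) {i : X →ₗ[R] P} {p : P →ₗ[R] M}
    (h : IsShortExact i p) (b : DualBasis e P) (hM : IsBiperfect e lam M) :
    IsBiperfect e lam X := by
  have hP := b.projective
  have hDP := (b.dual hs).projective
  have hd := h.dual K
  exact {
    ext := hM.ext.ker extVanish_of_projective h
    hom := DualIsHom.ker hs hM.hom (b.dualIsHom hs) h (hM.ext.exists_extension h)
    ext_dual := ExtVanish.coker hM.ext_dual extVanish_of_projective hd
      (hs.opFunctional.exists_extension hd.inj hM.hom_dual)
    hom_dual := hM.hom_dual.coker ((b.dual hs).dualIsHom hs.opFunctional) hd }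

theorem coker (hs : IsSymmIdempotent e lam) {i : X →ₗ[R] P} {p : P →ₗ[R] M}
    (h : IsShortExact i p) (b : DualBasis e P) (hX : IsBiperfect e lam X) :
    IsBiperfect e lam M := by
  have hP := b.projective
  have hDP := (b.dual hs).projective
  have hd := h.dual K
  exact {
    ext := ExtVanish.coker hX.ext extVanish_of_projective h (hs.exists_extension h.inj hX.hom)
    hom := hX.hom.coker (b.dualIsHom hs) h
    ext_dual := hX.ext_dual.ker extVanish_of_projective hd
    hom_dual := DualIsHom.ker hs.opFunctional hX.hom_dual ((b.dual hs).dualIsHom hs.opFunctional)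
      hd (hX.ext_dual.exists_extension hd) }

theorem extension (hs : IsSymmIdempotent e lam) {i : X →ₗ[R] P} {p : P →ₗ[R] M}
    (h : IsShortExact i p) (hX : IsBiperfect e lam X) (hM : IsBiperfect e lam M) :
    IsBiperfect e lam P where
  ext := hX.ext.extension hM.ext h
  hom := DualIsHom.extension hs hX.hom hM.hom h
  ext_dual := hM.ext_dual.extension hX.ext_dual (h.dual K)
  hom_dual := DualIsHom.extension hs.opFunctional hM.hom_dual hX.hom_dual (h.dual K)

theorem of_retract (hM : IsBiperfect e lam M) (i : X →ₗ[R] M) (r : M →ₗ[R] X)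
    (hri : ∀ x, r (i x) = x) : IsBiperfect e lam X := by
  have hd : ∀ F, dMap K i (dMap K r F) = F := fun F => dual_ext K fun x => by
    rw [dEquiv_dMap, dEquiv_dMap, hri]
  exact {
    ext := hM.ext.of_retract i r hri
    hom := hM.hom.of_retract i r hri
    ext_dual := hM.ext_dual.of_retract _ _ hd
    hom_dual := hM.hom_dual.of_retract _ _ hd }

theorem of_linearEquiv (hM : IsBiperfect e lam M) (i : X ≃ₗ[R] M) : IsBiperfect e lam X :=
  hM.of_retract i.toLinearMap i.symm.toLinearMap (by simp)

theorem e_faithful (hM : IsBiperfect e lam M) (m : M) (hm : ∀ y, (e * y) • m = 0) : m = 0 := by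
  have h1 := hM.hom_dual.inj ((dEquiv K M).toLinearMap.flip m) (fun x F => by
    rw [LinearMap.flip_apply, LinearEquiv.coe_coe, dEquiv_smul]
    change dEquiv K M F ((e * x.unop) • m) = 0
    rw [hm, map_zero])
  refine exists_functional_ne K fun f => ?_
  have := LinearMap.congr_fun h1 ((dEquiv K M).symm f)
  simpa using this

end IsBiperfect

theorem DualIsHom.of_ringEquiv {S : Type u} [Ring S] [Algebra K S] (σ : R ≃+* S)
    {lamS : S →ₗ[K] K} (hlam : ∀ r, lamS (σ r) = lam r) {M : ModuleCat.{u} R}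
    {N : ModuleCat.{u} S} (E : M ≃ₗ[K] N) (hE : ∀ (r : R) m, E (r • m) = σ r • E m)
    (h : DualIsHom e lam M) : DualIsHom (σ e) lamS N where
  inj f hf := by
    have := h.inj (f ∘ₗ E.toLinearMap) (fun x m => by
      rw [LinearMap.comp_apply, LinearEquiv.coe_coe, hE, map_mul, hf])
    ext n
    simpa using LinearMap.congr_fun this (E.symm n)
  surj φ := by
    obtain ⟨F, hF⟩ := h.surj
      { toFun := fun m => σ.symm (φ (E m))
        map_add' := fun a b => by simp
        map_smul' := fun r a => by simp [hE] }
    refine ⟨F ∘ₗ E.symm.toLinearMap, fun x n => ?_⟩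
    obtain ⟨x, rfl⟩ := σ.surjective x
    obtain ⟨m, rfl⟩ := E.surjective n
    rw [← map_mul, ← hE, LinearMap.comp_apply, LinearEquiv.coe_coe, LinearEquiv.symm_apply_apply,
      hF, ← hlam]
    simp

section Bidual

variable [FiniteDimensional K R] {M : ModuleCat.{u} R} [Module.Finite R M]

theorem dualIsHom_bidual : DualIsHom (MulOpposite.op (MulOpposite.op e))
    (opFunctional (opFunctional lam)) (D K (D K M)) ↔ DualIsHom e lam M := by
  obtain ⟨E, hE⟩ : ∃ E : M ≃ₗ[K] D K (D K M), ∀ m, E m = evalDual K M m :=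
    ⟨LinearEquiv.ofBijective (evalDual K M) (evalDual_bijective K M), fun _ => rfl⟩
  have hsmul : ∀ (r : R) (m : M), E (r • m) = RingEquiv.opOp R r • E m :=
    fun r m => by rw [hE, hE, evalDual_smul]; rfl
  refine ⟨fun h => ?_, DualIsHom.of_ringEquiv (RingEquiv.opOp R) (fun _ => rfl) E hsmul⟩
  refine h.of_ringEquiv (RingEquiv.opOp R).symm (fun _ => rfl) E.symm fun r F => ?_
  rw [LinearEquiv.symm_apply_eq, hsmul, RingEquiv.apply_symm_apply, LinearEquiv.apply_symm_apply]

theorem IsBiperfect.dual (hM : IsBiperfect e lam M) :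
    IsBiperfect (MulOpposite.op e) (opFunctional lam) (D K M) where
  ext := hM.ext_dual
  hom := hM.hom_dual
  ext_dual := by
    refine ExtVanish.of_ringEquiv (RingEquiv.opOp R) ?_
    let E : M ≃ₗ[R] (ModuleCat.restrictScalars (RingEquiv.opOp R).toRingHom).obj (D K (D K M)) :=
      { (LinearEquiv.ofBijective (evalDual K M) (evalDual_bijective K M)).toAddEquiv with
        map_smul' := fun r m => evalDual_smul K r m }
    exact hM.ext.of_linearEquiv E.symm
  hom_dual := dualIsHom_bidual.2 hM.hom

end Bidual

/-- The natural map `M → Hom_{eRe}(eR, eM)` is bijective. -/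
structure HomIsSelf (K : Type u) [Field K] [Algebra K R] (e : R) (M : ModuleCat.{u} R) : Prop where
  inj : ∀ m : M, (∀ y, (e * y) • m = 0) → m = 0
  surj : ∀ h : R →ₗ[K] M, (∀ y, h (e * y) = h y) → (∀ a y, h (e * a * e * y) = (e * a * e) • h y) →
    ∃ m, ∀ y, h y = (e * y) • m

/-- Dominant dimension at least 2 of `M` becomes codominant dimension at least 2 of `D(M)`. A map `φ
: D(M) → R` gives an `eRe`-linear map `h : eR → M` through `f (h y) = lam (e y φ(f))`; the element
of `M` representing `h` is the functional sought on `D(M)`. -/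
theorem HomIsSelf.dualIsHom (hs : IsSymmIdempotent e lam) [FiniteDimensional K R]
    {M : ModuleCat.{u} R} [Module.Finite R M] (hM : HomIsSelf K e M) :
    DualIsHom (MulOpposite.op e) (opFunctional lam) (D K M) := by
  have := finiteDimensional_of_finite K M
  refine ⟨fun F hF => ?_, fun φ => ?_⟩
  · obtain ⟨m, hm⟩ := exists_eval K (F ∘ₗ (dEquiv K M).symm.toLinearMap)
    have hm' : ∀ G, F G = dEquiv K M G m := fun G => by simpa using hm (dEquiv K M G)
    have hm0 : m = 0 := hM.inj m fun y => exists_functional_ne K fun f => by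
      have := hF (MulOpposite.op y) ((dEquiv K M).symm f)
      rw [hm', dEquiv_smul, LinearEquiv.apply_symm_apply] at this
      exact this
    ext G
    rw [hm', hm0, map_zero, LinearMap.zero_apply]
  · let T : R →ₗ[K] ((M →ₗ[K] K) →ₗ[K] K) := LinearMap.mk₂ K
      (fun y f => lam (e * y * (φ ((dEquiv K M).symm f)).unop))
      (fun y y' f => by simp [mul_add, add_mul])
      (fun k y f => by simp)
      (fun y f f' => by simp [mul_add])
      (fun k y f => by
        rw [map_smul, ← algebraMap_smul Rᵐᵒᵖ k, map_smul, algebraMap_smul]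
        simp)
    let h : R →ₗ[K] M := (Module.evalEquiv K M).symm.toLinearMap ∘ₗ T
    have hh : ∀ (f : M →ₗ[K] K) y, f (h y) = lam (e * y * (φ ((dEquiv K M).symm f)).unop) := by
      intro f y
      have : (Module.evalEquiv K M) (h y) = T y := by simp [h]
      exact LinearMap.congr_fun this f
    obtain ⟨m, hm⟩ := hM.surj h
      (fun y => sub_eq_zero.1 <| exists_functional_ne K fun f => by
        rw [map_sub, hh, hh, ← mul_assoc, hs.idem, sub_self])
      (fun a y => sub_eq_zero.1 <| exists_functional_ne K fun f => by
        have h1 : f ((e * a * e) • h y) = (dEquiv K M (MulOpposite.op (e * a * e) •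
            (dEquiv K M).symm f)) (h y) := by
          rw [dEquiv_smul, LinearEquiv.apply_symm_apply]; rfl
        rw [map_sub, h1, hh, hh, LinearEquiv.symm_apply_apply, map_smul, smul_eq_mul,
          MulOpposite.unop_mul, MulOpposite.unop_op, ← mul_assoc (e * y), ← hs.symm,
          sub_eq_zero]
        congr 1
        simp only [mul_assoc]
        rw [← mul_assoc e e (a * _), hs.idem, ← mul_assoc e e (y * _), hs.idem])
    refine ⟨(dEquiv K M).toLinearMap.flip m, fun x F => ?_⟩
    rw [LinearMap.flip_apply, LinearEquiv.coe_coe, dEquiv_smul]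
    change dEquiv K M F ((e * x.unop) • m) = lam ((φ F * (x * MulOpposite.op e)).unop)
    rw [← hm, hh, LinearEquiv.symm_apply_apply]
    rfl

/-- The surjectivity in `HomIsSelf` for the regular module: `(x, y) ↦ lam (h(y) x)` is a balanced
form. -/
theorem IsSymmIdempotent.exists_mul (hs : IsSymmIdempotent e lam) (h : R →ₗ[K] R)
    (h₁ : ∀ y, h (e * y) = h y) (h₂ : ∀ a y, h (e * a * e * y) = (e * a * e) * h y) :
    ∃ a, ∀ y, h y = e * y * a := by
  obtain ⟨a, ha⟩ := hs.exists_form (((LinearMap.mul K R).comp h).compr₂ lam).flip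
    (fun x y => by
      simp only [LinearMap.flip_apply, LinearMap.compr₂_apply, LinearMap.comp_apply,
        LinearMap.mul_apply']
      rw [h₁, ← mul_assoc, hs.lam_mul_e])
    (fun a x y => by
      simp only [LinearMap.flip_apply, LinearMap.compr₂_apply, LinearMap.comp_apply,
        LinearMap.mul_apply']
      rw [h₂, ← mul_assoc, ← hs.symm, ← mul_assoc])
  refine ⟨a, fun y => sub_eq_zero.1 (hs.nondeg_right _ ?_ fun x => ?_)⟩
  · have := h₂ 1 y
    rw [mul_one, hs.idem, h₁] at this
    rw [mul_sub, ← this, ← mul_assoc, ← mul_assoc, hs.idem]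
  · have := ha x y
    simp only [LinearMap.flip_apply, LinearMap.compr₂_apply, LinearMap.comp_apply,
        LinearMap.mul_apply'] at this
    rw [sub_mul, map_sub, this, mul_assoc e, mul_assoc e, hs.lam_e_mul, sub_self]

section Transpose

variable {P : ModuleCat.{u} R}

theorem DualBasis.projective_hom (b : DualBasis e P) : Module.Projective Rᵐᵒᵖ (P →ₗ[R] R) :=
  Module.Projective.of_split
    (LinearMap.pi fun i : Fin b.n =>
      { toFun := fun φ => MulOpposite.op (φ (b.gen i))
        map_add' := fun _ _ => rfl
        map_smul' := fun _ _ => rfl } : (P →ₗ[R] R) →ₗ[Rᵐᵒᵖ] (Fin b.n → Rᵐᵒᵖ))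
    (Fintype.linearCombination Rᵐᵒᵖ b.coord) (LinearMap.ext fun φ => LinearMap.ext fun x => by
      rw [b.apply_eq_sum (LinearMap.id (R := Rᵐᵒᵖ) φ) x]
      simp [Fintype.linearCombination_apply])

theorem DualBasis.exists_eval (b : DualBasis e P) (Ψ : (P →ₗ[R] R) →ₗ[Rᵐᵒᵖ] R) :
    ∃ q : P, ∀ φ, Ψ φ = φ q := by
  refine ⟨∑ i, Ψ (b.coord i) • b.gen i, fun φ => ?_⟩
  have : φ = ∑ i, MulOpposite.op (φ (b.gen i)) • b.coord i := by
    ext x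
    rw [b.apply_eq_sum φ x]
    simp
  conv_lhs => rw [this]
  simp

theorem DualBasis.eq_of_forall_apply (b : DualBasis e P) {x y : P}
    (h : ∀ φ : P →ₗ[R] R, φ x = φ y) : x = y := by
  rw [← b.sum_coord x, ← b.sum_coord y]
  exact Finset.sum_congr rfl fun i _ => by rw [h]

variable {M : ModuleCat.{u} R}

theorem finite_of_superfluous [Module.Finite R M] (π : P →ₗ[R] M) (hπ : Function.Surjective π)
    (h : IsSuperfluous (LinearMap.ker π)) : Module.Finite R P := by
  obtain ⟨s, hs⟩ := (Module.finite_def (R := R) (M := M)).1 inferInstance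
  classical
  refine Module.finite_def.2 ⟨s.image (Function.surjInv hπ), h _ ?_⟩
  rw [eq_top_iff]
  intro x _
  have hx : π x ∈ (Submodule.span R (s.image (Function.surjInv hπ) : Set P)).map π := by
    rw [Submodule.map_span, Finset.coe_image, ← Set.image_comp]
    have : (π ∘ Function.surjInv hπ) '' (s : Set M) = s := by
      rw [Function.comp_surjInv hπ, Set.image_id]
    rw [this, hs]
    trivial
  obtain ⟨y, hy, hxy⟩ := hx
  rw [← sub_add_cancel x y]
  exact Submodule.add_mem_sup (by rw [LinearMap.mem_ker, map_sub, hxy, sub_self]) hy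

variable (K) in
theorem nonempty_dualBasis_one [FiniteDimensional K R] [Module.Finite R P]
    [Module.Projective R P] : Nonempty (DualBasis (1 : R) P) :=
  nonempty_dualBasis_of_span K (one_mul 1) (by simp)

variable [FiniteDimensional K R] [Module.Finite R M]

theorem MinProjPresentation.finite₀ (p : MinProjPresentation M) : Module.Finite R p.P₀ :=
  finite_of_superfluous p.π.hom p.surjective p.superfluous₀

theorem MinProjPresentation.finite₁ (K : Type u) [Field K] [Algebra K R] [FiniteDimensional K R]
    (p : MinProjPresentation M) : Module.Finite R p.P₁ := by
  have := p.finite₀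
  have : IsNoetherianRing R := isNoetherian_of_tower K inferInstance
  let d' : p.P₁ →ₗ[R] ModuleCat.of R (LinearMap.range p.d.hom) := p.d.hom.rangeRestrict
  refine finite_of_superfluous (M := ModuleCat.of R (LinearMap.range p.d.hom)) d'
    p.d.hom.surjective_rangeRestrict ?_
  have : LinearMap.ker d' = LinearMap.ker p.d.hom := p.d.hom.ker_rangeRestrict
  rw [this]
  exact p.superfluous₁

/-- By Auslander and Bridger, `Ext¹` and `Ext²` of `Tr M` are the kernel and cokernel of `M → M**`,
so `M` is reflexive; the double centralizer property then passes from `R` to the dual `M**`. -/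
theorem MinProjPresentation.homIsSelf (hs : IsSymmIdempotent e lam) (p : MinProjPresentation M)
    (h : ExtVanish p.Tr (ModuleCat.of Rᵐᵒᵖ R)) : HomIsSelf K e M := by
  have := p.finite₀
  have := p.finite₁ K
  have := p.projective₀
  have := p.projective₁
  obtain ⟨b₀⟩ := nonempty_dualBasis_one K (P := p.P₀)
  obtain ⟨b₁⟩ := nonempty_dualBasis_one K (P := p.P₁)
  have := b₀.projective_hom
  have := b₁.projective_hom
  let δ := homToRing p.d
  have hδ : ∀ (φ : p.P₀ →ₗ[R] R) x, δ φ x = φ (p.d.hom x) := fun _ _ => rfl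
  have hπd : ∀ x, p.π.hom (p.d.hom x) = 0 := fun x => by
    have : p.d.hom x ∈ LinearMap.ker p.π.hom := p.exact ▸ ⟨x, rfl⟩
    exact this
  have hfac : ∀ φ : p.P₀ →ₗ[R] R, δ φ = 0 → ∃ ψ : M →ₗ[R] R, ∀ x, ψ (p.π.hom x) = φ x := by
    intro φ hφ
    refine exists_factor p.π.hom p.surjective φ fun x hx => ?_
    have : x ∈ LinearMap.range p.d.hom := p.exact ▸ hx
    obtain ⟨y, rfl⟩ := this
    exact LinearMap.congr_fun hφ y
  have ses₁ := isShortExact_mkQ (LinearMap.range δ)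
  have ses₂ : IsShortExact (R := Rᵐᵒᵖ) (K := LinearMap.ker δ) (P := p.P₀ →ₗ[R] R)
      (M := LinearMap.range δ) (LinearMap.ker δ).subtype δ.rangeRestrict := by
    rw [← δ.ker_rangeRestrict]
    exact isShortExact_ker δ.surjective_rangeRestrict
  have hE₁ : ExtVanish (ModuleCat.of Rᵐᵒᵖ (LinearMap.range δ)) (ModuleCat.of Rᵐᵒᵖ R) :=
    ExtVanish.ker (P := ModuleCat.of Rᵐᵒᵖ (p.P₁ →ₗ[R] R)) h extVanish_of_projective ses₁
  have ext₁ : ∀ χ : LinearMap.range δ →ₗ[Rᵐᵒᵖ] R, ∃ Ψ : (p.P₁ →ₗ[R] R) →ₗ[Rᵐᵒᵖ] R,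
      ∀ k, Ψ ((LinearMap.range δ).subtype k) = χ k :=
    ExtVanish.exists_extension (K := ModuleCat.of Rᵐᵒᵖ (LinearMap.range δ))
      (P := ModuleCat.of Rᵐᵒᵖ (p.P₁ →ₗ[R] R)) h ses₁
  have ext₂ : ∀ χ : LinearMap.ker δ →ₗ[Rᵐᵒᵖ] R, ∃ Ψ : (p.P₀ →ₗ[R] R) →ₗ[Rᵐᵒᵖ] R,
      ∀ k, Ψ ((LinearMap.ker δ).subtype k) = χ k :=
    ExtVanish.exists_extension (K := ModuleCat.of Rᵐᵒᵖ (LinearMap.ker δ))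
      (P := ModuleCat.of Rᵐᵒᵖ (p.P₀ →ₗ[R] R)) hE₁ ses₂
  -- Torsionlessness from `Ext¹(Tr M, R) = 0`: evaluation at a lift `q` of `m` factors through the
  -- image of `P₀* → P₁*`, extends to `P₁*`, and is there evaluation at some `q₁`; so `q = d q₁`.
  have sep : ∀ m : M, (∀ φ : M →ₗ[R] R, φ m = 0) → m = 0 := by
    intro m hm
    obtain ⟨q, rfl⟩ := p.surjective m
    let ev : (p.P₀ →ₗ[R] R) →ₗ[Rᵐᵒᵖ] R :=
      { toFun := fun φ => φ q, map_add' := fun _ _ => rfl, map_smul' := fun _ _ => rfl }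
    obtain ⟨χ, hχ⟩ := exists_factor (S := Rᵐᵒᵖ) (P := p.P₀ →ₗ[R] R) (M := LinearMap.range δ)
      (X := R) δ.rangeRestrict δ.surjective_rangeRestrict ev (fun φ hφ => by
      obtain ⟨ψ, hψ⟩ := hfac φ (congrArg Subtype.val hφ)
      change φ q = 0
      rw [← hψ, hm])
    obtain ⟨Ψ, hΨ⟩ := ext₁ χ
    obtain ⟨q₁, hq₁⟩ := b₁.exists_eval Ψ
    have : q = p.d.hom q₁ := b₀.eq_of_forall_apply fun φ => by
      rw [← hδ, ← hq₁]
      exact ((hΨ (δ.rangeRestrict φ)).trans (hχ φ)).symm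
    rw [this, hπd]
  refine ⟨fun m hm => sep m fun φ => hs.faithful_right _ fun y => ?_, fun f h₁ h₂ => ?_⟩
  · rw [← smul_eq_mul, ← map_smul, hm, map_zero]
  · have key : ∀ φ : M →ₗ[R] R, ∃ a, ∀ y, φ (f y) = e * y * a := fun φ =>
      hs.exists_mul (φ.restrictScalars K ∘ₗ f) (fun y => by simp [h₁]) (fun a y => by simp [h₂])
    choose a ha using key
    have uniq : ∀ x y : R, (∀ z, e * z * x = e * z * y) → x = y := fun x y hxy =>
      sub_eq_zero.1 (hs.faithful_right _ fun z => by rw [mul_sub, hxy, sub_self])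
    let ι : (M →ₗ[R] R) →ₗ[Rᵐᵒᵖ] LinearMap.ker δ :=
      (homToRing p.π).codRestrict _ fun φ => LinearMap.ext fun x => by
        change φ (p.π.hom (p.d.hom x)) = 0
        rw [hπd, map_zero]
    have hι : Function.Bijective ι := by
      constructor
      · intro φ ψ hφψ
        ext m
        obtain ⟨q, rfl⟩ := p.surjective m
        exact LinearMap.congr_fun (congrArg Subtype.val hφψ) q
      · rintro ⟨φ, hφ⟩
        obtain ⟨ψ, hψ⟩ := hfac φ hφ
        exact ⟨ψ, Subtype.ext (LinearMap.ext hψ)⟩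
    let E := LinearEquiv.ofBijective ι hι
    let χ : (M →ₗ[R] R) →ₗ[Rᵐᵒᵖ] R :=
      { toFun := a
        map_add' := fun φ ψ => uniq _ _ fun z => by
          rw [← ha, LinearMap.add_apply, ha, ha, mul_add]
        map_smul' := fun r φ => uniq _ _ fun z => by
          rw [← ha, LinearMap.smul_apply, ha]
          simp [mul_assoc] }
    -- Here `Ext²(Tr M, R) = 0` enters: `χ ∈ M**` extends from `M* = ker δ` to `P₀*`, where it is
    -- evaluation at a point `q`.
    obtain ⟨Ψ, hΨ⟩ := ext₂ (χ ∘ₗ E.symm.toLinearMap)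
    obtain ⟨q, hq⟩ := b₀.exists_eval Ψ
    refine ⟨p.π.hom q, fun y => sub_eq_zero.1 (sep _ fun φ => ?_)⟩
    have h3 : a φ = φ (p.π.hom q) := by
      have h4 := hΨ (E φ)
      rw [hq] at h4
      simp only [LinearMap.comp_apply, LinearEquiv.coe_coe, LinearEquiv.symm_apply_apply] at h4
      exact h4.symm
    rw [map_sub, ha, h3, map_smul, smul_eq_mul, sub_self]

theorem IsGorensteinProjective.dualIsHom_dual (hs : IsSymmIdempotent e lam)
    (hM : IsGorensteinProjective M) :
    DualIsHom (MulOpposite.op e) (opFunctional lam) (D K M) := by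
  obtain ⟨-, p, hp⟩ := hM
  exact (p.homIsSelf hs hp).dualIsHom hs

theorem IsGorensteinProjInj.isBiperfect (hs : IsSymmIdempotent e lam)
    (hM : IsGorensteinProjInj K M) : IsBiperfect e lam M where
  ext := hM.1.1
  hom := dualIsHom_bidual.1 (IsGorensteinProjective.dualIsHom_dual hs.opFunctional hM.2)
  ext_dual := hM.2.1
  hom_dual := IsGorensteinProjective.dualIsHom_dual hs hM.1

end Transpose

end GorensteinProjInj

/-! ### Fitting's lemma and nonminimal covers and envelopes. -/

section Covers

variable {R : Type u} [Ring R]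

theorem exists_isCompl_ker_pow_range_pow [IsArtinianRing R] [IsNoetherianRing R] {M : Type*}
    [AddCommGroup M] [Module R M] [Module.Finite R M] (f : M →ₗ[R] M) :
    ∃ n, 0 < n ∧ IsCompl (LinearMap.ker (f ^ n)) (LinearMap.range (f ^ n)) := by
  obtain ⟨n, hn⟩ := Filter.eventually_atTop.1 f.eventually_isCompl_ker_pow_range_pow
  exact ⟨n + 1, n.succ_pos, hn _ n.le_succ⟩

theorem exists_retraction {M : Type*} [AddCommGroup M] [Module R M] {U V : Submodule R M}
    (h : IsCompl U V) : ∃ r : M →ₗ[R] V, (∀ v : V, r v = v) ∧ ∀ u ∈ U, r u = 0 :=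
  ⟨V.projectionOnto U h.symm, fun v => Submodule.projectionOnto_apply_left h.symm v,
    fun u hu => Submodule.projectionOnto_apply_right h.symm ⟨u, hu⟩⟩

variable [IsArtinianRing R] [IsNoetherianRing R]

/-- A surjection from a projective module whose kernel is not superfluous vanishes on a nonzero
direct summand. -/
theorem exists_summand_le_ker {P M : Type u} [AddCommGroup P] [Module R P] [AddCommGroup M]
    [Module R M] [Module.Finite R P] [Module.Projective R P] (p : P →ₗ[R] M)
    {L : Submodule R P} (hL : LinearMap.ker p ⊔ L = ⊤) (hL' : L ≠ ⊤) :
    ∃ U V : Submodule R P, IsCompl U V ∧ U ≤ LinearMap.ker p ∧ U ≠ ⊥ := by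
  have hsurj : ∀ x, ∃ l : L, p l = p x := by
    intro x
    have hx : x ∈ LinearMap.ker p ⊔ L := hL ▸ Submodule.mem_top
    obtain ⟨k, hk, l, hl, rfl⟩ := Submodule.mem_sup.1 hx
    exact ⟨⟨l, hl⟩, by rw [map_add, LinearMap.mem_ker.1 hk, zero_add]⟩
  let q : L →ₗ[R] LinearMap.range p := p.rangeRestrict ∘ₗ L.subtype
  have hq : Function.Surjective q := by
    rintro ⟨_, x, rfl⟩
    obtain ⟨l, hl⟩ := hsurj x
    exact ⟨l, Subtype.ext hl⟩
  obtain ⟨t, ht⟩ := Module.projective_lifting_property q p.rangeRestrict hq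
  -- `α` maps `P` into `L` and preserves `p`. Its Fitting kernel is a summand inside `ker p`,
  -- nonzero because the powers of `α` have image in the proper submodule `L`.
  let α : P →ₗ[R] P := L.subtype ∘ₗ t
  have hα : ∀ x, p (α x) = p x := fun x => congrArg Subtype.val (LinearMap.congr_fun ht x)
  have hαL : ∀ x, α x ∈ L := fun x => (t x).2
  have hαn : ∀ n x, p ((α ^ n) x) = p x := by
    intro n
    induction n with
    | zero => simp
    | succ n ih => intro x; rw [pow_succ', Module.End.mul_apply, hα, ih]
  obtain ⟨n, hn, hc⟩ := exists_isCompl_ker_pow_range_pow α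
  refine ⟨_, _, hc, fun x hx => ?_, fun h0 => hL' ?_⟩
  · rw [LinearMap.mem_ker, ← hαn n, LinearMap.mem_ker.1 hx, map_zero]
  · rw [h0] at hc
    have : LinearMap.range (α ^ n) = ⊤ := by simpa using hc.sup_eq_top
    rw [eq_top_iff, ← this]
    rintro _ ⟨x, rfl⟩
    obtain ⟨m, rfl⟩ : ∃ m, n = m + 1 := ⟨n - 1, by omega⟩
    rw [pow_succ', Module.End.mul_apply]
    exact hαL _

/-- If an embedding into an injective module is not essential, it lands in a proper direct
summand. -/
theorem exists_summand_ge_range {Q M : Type u} [AddCommGroup Q] [Module R Q] [AddCommGroup M]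
    [Module R M] [Module.Finite R Q] [Module.Injective R Q] (i : M →ₗ[R] Q)
    (hi : Function.Injective i) {L : Submodule R Q} (hL : LinearMap.range i ⊓ L = ⊥)
    (hL' : L ≠ ⊥) :
    ∃ U V : Submodule R Q, IsCompl U V ∧ LinearMap.range i ≤ V ∧ U ≠ ⊥ := by
  have hinj : Function.Injective (L.mkQ ∘ₗ i) := by
    refine (injective_iff_map_eq_zero _).2 fun m hm => ?_
    have h1 : i m ∈ L := by simpa using hm
    have h2 : i m ∈ LinearMap.range i ⊓ L := ⟨⟨m, rfl⟩, h1⟩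
    rw [hL, Submodule.mem_bot] at h2
    exact (injective_iff_map_eq_zero i).1 hi m h2
  obtain ⟨β, hβ⟩ := Module.Injective.out (L.mkQ ∘ₗ i) hinj i
  -- `α` fixes the image of `M` and kills `L`, so its Fitting image contains `M` and its Fitting
  -- kernel contains `L`.
  let α : Q →ₗ[R] Q := β ∘ₗ L.mkQ
  have hα : ∀ m, α (i m) = i m := hβ
  have hαL : ∀ x ∈ L, α x = 0 := fun x hx => by
    simp [α, (Submodule.Quotient.mk_eq_zero L).2 hx]
  have hαn : ∀ n m, (α ^ n) (i m) = i m := by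
    intro n
    induction n with
    | zero => simp
    | succ n ih => intro x; rw [pow_succ', Module.End.mul_apply, ih, hα]
  obtain ⟨n, hn, hc⟩ := exists_isCompl_ker_pow_range_pow α
  refine ⟨_, _, hc, ?_, fun h0 => hL' ?_⟩
  · rintro _ ⟨m, rfl⟩
    exact ⟨i m, hαn n m⟩
  · rw [eq_bot_iff, ← h0]
    intro x hx
    obtain ⟨m, rfl⟩ : ∃ m, n = m + 1 := ⟨n - 1, by omega⟩
    rw [LinearMap.mem_ker, pow_succ, Module.End.mul_apply, hαL x hx, map_zero]

end Covers

/-! ### Minimal presentations, and `Tr` and `τ` in terms of second syzygies. -/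

section Algebra

variable (K : Type u) [Field K] {R : Type u} [Ring R] [Algebra K R] [FiniteDimensional K R]

include K in
theorem isArtinianRing_of_finiteDimensional : IsArtinianRing R := isArtinian_of_tower K inferInstance

include K in
theorem isNoetherianRing_of_finiteDimensional : IsNoetherianRing R :=
  isNoetherian_of_tower K inferInstance

include K in
theorem exists_projectiveCover (M : ModuleCat.{u} R) [Module.Finite R M] :
    ∃ (P : ModuleCat.{u} R) (π : P →ₗ[R] M), Module.Finite R P ∧ Module.Projective R P ∧
      Function.Surjective π ∧ IsSuperfluous (LinearMap.ker π) := by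
  have := isArtinianRing_of_finiteDimensional K (R := R)
  have := isNoetherianRing_of_finiteDimensional K (R := R)
  -- A projective cover is a projective surjecting onto `M` of least dimension: otherwise a nonzero
  -- summand inside the kernel could be dropped.
  have hex : ∃ (d : ℕ) (P : ModuleCat.{u} R) (π : P →ₗ[R] M), Module.Finite R P ∧
      Module.Projective R P ∧ Function.Surjective π ∧ Module.finrank K P = d := by
    obtain ⟨n, f, hf⟩ := Module.Finite.exists_fin' R M
    exact ⟨_, ModuleCat.of R (Fin n → R), f, inferInstanceAs (Module.Finite R (Fin n → R)),
      inferInstanceAs (Module.Projective R (Fin n → R)), hf, rfl⟩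
  classical
  obtain ⟨P, π, hP, hP', hπ, hd⟩ := Nat.find_spec hex
  refine ⟨P, π, hP, hP', hπ, fun L hL => by_contra fun hL' => ?_⟩
  obtain ⟨U, V, hUV, hU, hU'⟩ := exists_summand_le_ker π hL hL'
  obtain ⟨r, hr, hr'⟩ := exists_retraction hUV
  refine Nat.find_min hex (m := Module.finrank K (ModuleCat.of R V)) ?_
    ⟨ModuleCat.of R V, π ∘ₗ V.subtype, Module.Finite.of_surjective r fun v => ⟨v, hr v⟩,
      Module.Projective.of_split V.subtype r (LinearMap.ext hr), fun m => ?_, rfl⟩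
  · rw [← hd]
    have := finiteDimensional_of_finite K P
    have hlt : Module.finrank K (V.restrictScalars K) < Module.finrank K P := by
      refine Submodule.finrank_lt (lt_top_iff_ne_top.2 fun h => hU' ?_).ne
      have hV : V = ⊤ := by simpa using h
      have := hUV.inf_eq_bot
      rwa [hV, inf_top_eq] at this
    refine lt_of_eq_of_lt ?_ hlt
    exact LinearEquiv.finrank_eq
      { toFun := fun v => v, invFun := fun v => v, map_add' := fun _ _ => rfl
        map_smul' := fun k v => Subtype.ext (algebraMap_smul R k (v : P))
        left_inv := fun _ => rfl, right_inv := fun _ => rfl }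
  · obtain ⟨x, rfl⟩ := hπ m
    refine ⟨r x, ?_⟩
    have hx : x - r x ∈ U := by
      obtain ⟨u, hu, v, hv, rfl⟩ := Submodule.mem_sup.1
        (hUV.sup_eq_top ▸ Submodule.mem_top : x ∈ U ⊔ V)
      rw [map_add, hr' u hu, zero_add, hr ⟨v, hv⟩]
      simpa using hu
    have := hU hx
    rw [LinearMap.mem_ker, map_sub, sub_eq_zero] at this
    exact this.symm

include K in
theorem nonempty_minProjPresentation (M : ModuleCat.{u} R) [Module.Finite R M] :
    Nonempty (MinProjPresentation M) := by
  have := isNoetherianRing_of_finiteDimensional K (R := R)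
  obtain ⟨P₀, π, hP, hP', hπ, hs⟩ := exists_projectiveCover K M
  obtain ⟨P₁, π', -, hP₁', hπ', hs'⟩ := exists_projectiveCover K (ModuleCat.of R (LinearMap.ker π))
  have hker : LinearMap.ker ((LinearMap.ker π).subtype ∘ₗ π') = LinearMap.ker π' :=
    LinearMap.ker_comp_of_ker_eq_bot _ (Submodule.ker_subtype _)
  have hrange : LinearMap.range ((LinearMap.ker π).subtype ∘ₗ π') = LinearMap.ker π := by
    rw [LinearMap.range_comp_of_range_eq_top _ (LinearMap.range_eq_top.2 hπ'),
      Submodule.range_subtype]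
  exact ⟨P₁, P₀, ModuleCat.ofHom ((LinearMap.ker π).subtype ∘ₗ π'), ModuleCat.ofHom π, hP₁', hP',
    hπ, hrange, hs, hker.symm ▸ hs'⟩

variable {K} {e : R} {lam : R →ₗ[K] K} {M X P : ModuleCat.{u} R}

-- A functional vanishing on the submodule generated by `eM` has zero image in `Hom(M, R)`. Hence
-- the projective cover of `M` is generated by its `e`-part and lies in `add(Re)`.
omit [FiniteDimensional K R] in
theorem DualIsHom.span_eq_top (hM : DualIsHom e lam M) :
    Submodule.span R (Set.range fun x : M => e • x) = ⊤ := by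
  by_contra h
  have h' : (Submodule.span R (Set.range fun x : M => e • x)).restrictScalars K < ⊤ := by
    rw [lt_top_iff_ne_top]
    simpa using h
  obtain ⟨f, hf, hle⟩ := Submodule.exists_le_ker_of_lt_top _ h'
  refine hf (hM.inj f fun x m => hle ?_)
  rw [mul_smul]
  exact Submodule.smul_mem _ x (Submodule.subset_span ⟨m, rfl⟩)

omit [FiniteDimensional K R] in
theorem span_eq_top_of_superfluous (π : P →ₗ[R] M) (hπ : IsSuperfluous (LinearMap.ker π))
    (hM : Submodule.span R (Set.range fun x : M => e • x) = ⊤) (hs : Function.Surjective π) :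
    Submodule.span R (Set.range fun x : P => e • x) = ⊤ := by
  refine hπ _ (eq_top_iff.2 fun x _ => ?_)
  have hx : π x ∈ (Submodule.span R (Set.range fun x : P => e • x)).map π := by
    rw [Submodule.map_span, ← Set.range_comp]
    have : Set.range (π ∘ fun x : P => e • x) = Set.range fun x : M => e • x := by
      ext m
      constructor
      · rintro ⟨y, rfl⟩
        exact ⟨π y, by simp⟩
      · rintro ⟨y, rfl⟩
        obtain ⟨z, rfl⟩ := hs y
        exact ⟨z, by simp⟩
    rw [this, hM]
    trivial
  obtain ⟨y, hy, hxy⟩ := hx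
  rw [← sub_add_cancel x y]
  exact Submodule.add_mem_sup (by rw [LinearMap.mem_ker, map_sub, hxy, sub_self]) hy

/-- The projective cover of a module of codominant dimension at least one. -/
theorem DualIsHom.nonempty_dualBasis (hs : IsSymmIdempotent e lam) (hM : DualIsHom e lam M)
    [Module.Finite R M] [Module.Projective R P] (π : P →ₗ[R] M)
    (hπ : IsSuperfluous (LinearMap.ker π)) (hsurj : Function.Surjective π) :
    Nonempty (DualBasis e P) := by
  have := finite_of_superfluous π hsurj hπ
  exact nonempty_dualBasis_of_span K hs.idem (span_eq_top_of_superfluous π hπ hM.span_eq_top hsurj)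

omit [FiniteDimensional K R] in
/-- The cokernel of `Hom(P₀, R) → Hom(P₁, R)` is dual to the kernel of `P₁ → P₀`, for direct
summands `P₀`, `P₁` of powers of `Re`. -/
theorem nonempty_coker_equiv_dual (hs : IsSymmIdempotent e lam) {P₀ P₁ L : ModuleCat.{u} R}
    (d : P₁ ⟶ P₀) (b₀ : DualBasis e P₀) (b₁ : DualBasis e P₁) (ι : L →ₗ[R] P₁)
    (hι : Function.Injective ι) (hex : ∀ x, d.hom x = 0 ↔ ∃ l, ι l = x) :
    Nonempty (((P₁ →ₗ[R] R) ⧸ LinearMap.range (homToRing d)) ≃ₗ[Rᵐᵒᵖ] D K L) := by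
  let Θ : (P₁ →ₗ[R] R) →ₗ[Rᵐᵒᵖ] D K L := dMap K ι ∘ₗ (b₁.homEquivDual hs).toLinearMap
  have hΘ : ∀ φ l, dEquiv K L (Θ φ) l = b₁.functional lam φ (ι l) := fun φ l => by
    change dEquiv K L (dMap K ι (b₁.homEquivDual hs φ)) l = _
    rw [dEquiv_dMap, DualBasis.dEquiv_homEquivDual]
  have hsurj : Function.Surjective Θ := by
    intro F
    obtain ⟨g, hg⟩ := exists_extend_functional K (ι.restrictScalars K) hι (dEquiv K L F)
    obtain ⟨φ, hφ⟩ := (b₁.homEquivDual hs).surjective ((dEquiv K P₁).symm g)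
    refine ⟨φ, dual_ext K fun l => ?_⟩
    rw [hΘ, ← DualBasis.dEquiv_homEquivDual hs, hφ, LinearEquiv.apply_symm_apply]
    exact hg l
  have hker : LinearMap.ker Θ = LinearMap.range (homToRing d) := by
    ext φ
    constructor
    · intro hφ
      have h0 : ∀ x, d.hom x = 0 → b₁.functional lam φ x = 0 := by
        intro x hx
        obtain ⟨l, rfl⟩ := (hex x).1 hx
        rw [← hΘ, LinearMap.mem_ker.1 hφ, map_zero, LinearMap.zero_apply]
      -- The functional of `φ` vanishes on `ker d`, so it descends to the image of `d` and extends
      -- to `P₀`; the map `P₀ → R` attached to the extension restricts to `φ`.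
      obtain ⟨g, hg⟩ := exists_factor (d.hom.rangeRestrict.restrictScalars K)
        d.hom.surjective_rangeRestrict (b₁.functional lam φ)
        (fun x hx => h0 x (congrArg Subtype.val hx))
      obtain ⟨G, hG⟩ := exists_extend_functional K
        ((LinearMap.range d.hom).subtype.restrictScalars K) Subtype.val_injective g
      obtain ⟨ψ, hψ⟩ := hs.exists_corresponds G
      refine ⟨ψ, hs.corresponds_unique (hψ.comp d.hom) ?_⟩
      have : G ∘ₗ d.hom.restrictScalars K = b₁.functional lam φ := LinearMap.ext fun x =>
        (hG (d.hom.rangeRestrict x)).trans (hg x)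
      rw [this]
      exact b₁.corresponds_functional hs φ
    · rintro ⟨ψ, rfl⟩
      refine dual_ext K fun l => ?_
      have h1 := (b₀.corresponds_functional hs ψ).comp d.hom
      have h2 := (b₁.dualIsHom hs).unique (b₁.corresponds_functional hs (homToRing d ψ)) h1
      rw [hΘ, h2]
      simp [(hex (ι l)).2 ⟨l, rfl⟩]
  exact ⟨(Submodule.quotEquivOfEq _ _ hker.symm).trans (Θ.quotKerEquivOfSurjective hsurj)⟩

/-- If `M` has infinite dominant and codominant dimension, then `Tr M` is the dual of the second
syzygy of `M`. -/
theorem IsBiperfect.nonempty_tr_equiv (hs : IsSymmIdempotent e lam) (hM : IsBiperfect e lam M)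
    [Module.Finite R M] (p : MinProjPresentation M) :
    Nonempty (p.Tr ≃ₗ[Rᵐᵒᵖ] D K (ModuleCat.of R (LinearMap.ker p.d.hom))) ∧
      IsBiperfect e lam (ModuleCat.of R (LinearMap.ker p.π.hom)) ∧
      IsBiperfect e lam (ModuleCat.of R (LinearMap.ker p.d.hom)) ∧
      Nonempty (DualBasis e p.P₀) ∧ Nonempty (DualBasis e p.P₁) := by
  have := isNoetherianRing_of_finiteDimensional K (R := R)
  have := p.projective₀
  have := p.projective₁
  obtain ⟨b₀⟩ := hM.hom.nonempty_dualBasis hs p.π.hom p.superfluous₀ p.surjective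
  have := b₀.finite
  have hX := IsBiperfect.ker (X := ModuleCat.of R (LinearMap.ker p.π.hom)) hs
    (isShortExact_ker p.surjective) b₀ hM
  obtain ⟨d', hd'⟩ : ∃ d' : p.P₁ →ₗ[R] ModuleCat.of R (LinearMap.ker p.π.hom),
      ∀ x, (LinearMap.ker p.π.hom).subtype (d' x) = p.d.hom x :=
    ⟨p.d.hom.codRestrict _ fun x => p.exact ▸ ⟨x, rfl⟩, fun x => rfl⟩
  have hker : LinearMap.ker d' = LinearMap.ker p.d.hom := by
    ext x
    rw [LinearMap.mem_ker, LinearMap.mem_ker, ← hd']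
    exact (Submodule.coe_eq_zero (x := d' x)).symm
  have hsurj : Function.Surjective d' := by
    rintro ⟨y, hy⟩
    have hy' : y ∈ LinearMap.range p.d.hom := p.exact ▸ hy
    obtain ⟨x, rfl⟩ := hy'
    exact ⟨x, Subtype.ext (hd' x)⟩
  obtain ⟨b₁⟩ := hX.hom.nonempty_dualBasis hs d' (hker ▸ p.superfluous₁) hsurj
  have ses : IsShortExact (R := R) (K := LinearMap.ker p.d.hom) (P := p.P₁)
      (M := LinearMap.ker p.π.hom) (LinearMap.ker p.d.hom).subtype d' :=
    ⟨Subtype.val_injective, hsurj, fun x => by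
      have : d' x = 0 ↔ x ∈ LinearMap.ker p.d.hom := by rw [← hker]; rfl
      exact this.trans ⟨fun h => ⟨⟨x, h⟩, rfl⟩, by rintro ⟨k, rfl⟩; exact k.2⟩⟩
  have hL := IsBiperfect.ker (X := ModuleCat.of R (LinearMap.ker p.d.hom)) hs ses b₁ hX
  exact ⟨nonempty_coker_equiv_dual (L := ModuleCat.of R (LinearMap.ker p.d.hom)) hs p.d b₀ b₁
    (LinearMap.ker p.d.hom).subtype Subtype.val_injective
    (fun x => ⟨fun h => ⟨⟨x, h⟩, rfl⟩, by rintro ⟨k, rfl⟩; exact k.2⟩), hX, hL, ⟨b₀⟩, ⟨b₁⟩⟩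

/-- `Tr M` is the dual of the biperfect module `Ω²M`, so the required vanishing for `Tr M` is the
condition `ext_dual` of `Ω²M`. -/
theorem IsBiperfect.isGorensteinProjective (hs : IsSymmIdempotent e lam)
    (hM : IsBiperfect e lam M) [Module.Finite R M] : IsGorensteinProjective M := by
  obtain ⟨p⟩ := nonempty_minProjPresentation K M
  obtain ⟨⟨E⟩, -, hL, -⟩ := hM.nonempty_tr_equiv hs p
  refine ⟨hM.ext, p, ?_⟩
  let op : R ≃ₗ[Rᵐᵒᵖ] Rᵐᵒᵖ :=
    { MulOpposite.opAddEquiv with map_smul' := fun r x => rfl }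
  exact (hL.ext_dual.of_linearEquiv E).of_coeff_linearEquiv (Z := ModuleCat.of Rᵐᵒᵖ R) op

theorem IsBiperfect.isGorensteinProjInj (hs : IsSymmIdempotent e lam)
    (hM : IsBiperfect e lam M) [Module.Finite R M] : IsGorensteinProjInj K M :=
  ⟨hM.isGorensteinProjective hs, hM.dual.isGorensteinProjective hs.opFunctional⟩

/-- For a module of infinite dominant and codominant dimension, the Auslander–Reiten translate is
the second syzygy. -/
theorem IsBiperfect.isTau (hs : IsSymmIdempotent e lam) (hM : IsBiperfect e lam M)
    [Module.Finite R M] (p : MinProjPresentation M) :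
    IsTau K M (ModuleCat.of R (LinearMap.ker p.d.hom)) := by
  have := isNoetherianRing_of_finiteDimensional K (R := R)
  have := p.finite₁ K
  obtain ⟨⟨E⟩, -⟩ := hM.nonempty_tr_equiv hs p
  obtain ⟨L, hL⟩ : ∃ L, L = ModuleCat.of R (LinearMap.ker p.d.hom) := ⟨_, rfl⟩
  have hfin : Module.Finite R L := hL ▸ inferInstanceAs (Module.Finite R (LinearMap.ker p.d.hom))
  rw [← hL] at E ⊢
  let T : L →ₗ[R] (ModuleCat.restrictScalars (RingEquiv.opOp R).toRingHom).obj (D K p.Tr) :=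
    { toFun := fun l => dMap K E.toLinearMap (evalDual K L l)
      map_add' := fun a b => by rw [map_add, map_add]; rfl
      map_smul' := fun r a => by rw [evalDual_smul, map_smul]; rfl }
  refine ⟨p, ⟨LinearEquiv.toModuleIso (LinearEquiv.ofBijective T ⟨fun a b hab => ?_,
    fun F => ?_⟩)⟩⟩
  · refine (evalDual_bijective K L).1 (dual_ext K fun G => ?_)
    have : dEquiv K p.Tr (dMap K E.toLinearMap (evalDual K L a)) (E.symm G) =
        dEquiv K p.Tr (dMap K E.toLinearMap (evalDual K L b)) (E.symm G) :=
      congrArg (fun z => dEquiv K p.Tr z (E.symm G)) hab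
    rwa [dEquiv_dMap, dEquiv_dMap, LinearEquiv.coe_coe, LinearEquiv.apply_symm_apply] at this
  · have key : ∀ F : D K p.Tr, ∃ l, dMap K E.toLinearMap (evalDual K L l) = F := by
      intro F
      obtain ⟨l, hl⟩ := (evalDual_bijective K L).2 (dMap K E.symm.toLinearMap F)
      refine ⟨l, ?_⟩
      rw [hl]
      refine dual_ext K fun x => ?_
      rw [dEquiv_dMap, dEquiv_dMap, LinearEquiv.coe_coe, LinearEquiv.coe_coe,
        LinearEquiv.symm_apply_apply]
    exact key F

end Algebra

/-! ### Indecomposability through endomorphisms; syzygies of local modules. -/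

section LocalModules

variable {R : Type u} [Ring R]

/-- The linear map `f` is a section. -/
def HasRetraction {M N : Type u} [AddCommGroup M] [AddCommGroup N] [Module R M] [Module R N]
    (f : M →ₗ[R] N) : Prop := ∃ r : N →ₗ[R] M, ∀ x, r (f x) = x

/-- The linear map `f` is a retraction. -/
def HasSection {M N : Type u} [AddCommGroup M] [AddCommGroup N] [Module R M] [Module R N]
    (f : M →ₗ[R] N) : Prop := ∃ s : N →ₗ[R] M, ∀ x, f (s x) = x

theorem isSplitMono_iff {M N : ModuleCat.{u} R} (f : M ⟶ N) :
    IsSplitMono f ↔ HasRetraction f.hom := by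
  constructor
  · rintro ⟨⟨s⟩⟩
    exact ⟨s.retraction.hom, fun x => congrArg (fun g => g.hom x) s.id⟩
  · rintro ⟨r, hr⟩
    exact ⟨⟨⟨ModuleCat.ofHom r, by ext x; exact hr x⟩⟩⟩

theorem isSplitEpi_iff {M N : ModuleCat.{u} R} (f : M ⟶ N) :
    IsSplitEpi f ↔ HasSection f.hom := by
  constructor
  · rintro ⟨⟨s⟩⟩
    exact ⟨s.section_.hom, fun x => congrArg (fun g => g.hom x) s.id⟩
  · rintro ⟨r, hr⟩
    exact ⟨⟨⟨ModuleCat.ofHom r, by ext x; exact hr x⟩⟩⟩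

/-- Every endomorphism of the nonzero module `M` is nilpotent or bijective. -/
def IsLocalModule (R : Type u) [Ring R] (M : Type u) [AddCommGroup M] [Module R M] : Prop :=
  Nontrivial M ∧ ∀ f : M →ₗ[R] M, (∃ n, ∀ x, (f ^ n) x = 0) ∨ Function.Bijective f

theorem isLocalModule_of_linearEquiv {M N : Type u} [AddCommGroup M] [Module R M]
    [AddCommGroup N] [Module R N] (E : M ≃ₗ[R] N) (h : IsLocalModule R M) :
    IsLocalModule R N := by
  refine ⟨have := h.1; E.symm.toEquiv.nontrivial, fun f => ?_⟩
  rcases h.2 (E.symm.toLinearMap ∘ₗ f ∘ₗ E.toLinearMap) with ⟨n, hn⟩ | hb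
  · left
    refine ⟨n, fun x => ?_⟩
    have : ∀ n x, ((E.symm.toLinearMap ∘ₗ f ∘ₗ E.toLinearMap) ^ n) x = E.symm ((f ^ n) (E x)) := by
      intro n
      induction n with
      | zero => simp
      | succ n ih => intro x; rw [pow_succ', Module.End.mul_apply, ih, pow_succ']; simp
    have h1 := hn (E.symm x)
    rwa [this, LinearEquiv.apply_symm_apply, LinearEquiv.map_eq_zero_iff] at h1
  · right
    have : (f : N → N) = E ∘ (E.symm.toLinearMap ∘ₗ f ∘ₗ E.toLinearMap) ∘ E.symm := by
      ext x; simp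
    rw [this]
    exact E.bijective.comp (hb.comp E.symm.bijective)

theorem IsLocalModule.bijective_of_retract {M X : Type u} [AddCommGroup M] [Module R M]
    [AddCommGroup X] [Module R X] (h : IsLocalModule R M) [hX : Nontrivial X] {i : X →ₗ[R] M}
    {r : M →ₗ[R] X} (hri : ∀ x, r (i x) = x) : Function.Bijective i := by
  refine ⟨Function.LeftInverse.injective hri, ?_⟩
  have hpow : ∀ n x, ((i ∘ₗ r) ^ n) (i x) = i x := by
    intro n
    induction n with
    | zero => simp
    | succ n ih => intro x; rw [pow_succ', Module.End.mul_apply, ih]; simp [hri]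
  rcases h.2 (i ∘ₗ r) with ⟨n, hn⟩ | hb
  · obtain ⟨x, hx⟩ := exists_ne (0 : X)
    exact absurd (by rw [← hri x, ← hpow n, hn, map_zero]) hx
  · intro m
    obtain ⟨y, rfl⟩ := hb.2 m
    exact ⟨r y, rfl⟩

theorem IsLocalModule.sub_bijective {M : Type u} [AddCommGroup M] [Module R M]
    (h : IsLocalModule R M) (f : M →ₗ[R] M) (hf : ¬ Function.Bijective f) :
    Function.Bijective (LinearMap.id - f : M →ₗ[R] M) := by
  have hf' := (h.2 f).resolve_right hf
  have : IsUnit (1 - f : Module.End R M) := by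
    obtain ⟨n, hn⟩ := hf'
    exact IsNilpotent.isUnit_one_sub ⟨n, LinearMap.ext hn⟩
  exact (Module.End.isUnit_iff _).1 this

theorem IsLocalModule.add_not_bijective {M : Type u} [AddCommGroup M] [Module R M]
    (h : IsLocalModule R M) {f g : M →ₗ[R] M} (hf : ¬ Function.Bijective f)
    (hg : ¬ Function.Bijective g) : ¬ Function.Bijective (f + g) := by
  intro hb
  let E := LinearEquiv.ofBijective (f + g) hb
  have h1 : ¬ Function.Bijective (E.symm.toLinearMap ∘ₗ f) := fun h' => hf (by
    have : (f : M → M) = E ∘ (E.symm.toLinearMap ∘ₗ f) := by ext; simp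
    rw [this]
    exact E.bijective.comp h')
  have h2 := h.sub_bijective _ h1
  have h3 : LinearMap.id - E.symm.toLinearMap ∘ₗ f = E.symm.toLinearMap ∘ₗ g := by
    ext x
    have : E.symm ((f + g) x) = x := E.symm_apply_apply x
    rw [LinearMap.add_apply, map_add] at this
    simp only [LinearMap.sub_apply, LinearMap.id_apply, LinearMap.comp_apply, LinearEquiv.coe_coe]
    rw [sub_eq_iff_eq_add', this]
  rw [h3] at h2
  refine hg ?_
  have : (g : M → M) = E ∘ (E.symm.toLinearMap ∘ₗ g) := by ext; simp
  rw [this]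
  exact E.bijective.comp h2

theorem indecomposable_iff {M : ModuleCat.{u} R} : Indecomposable M ↔ Nontrivial M ∧
    ∀ f : M →ₗ[R] M, (∀ x, f (f x) = f x) → (∀ x, f x = 0) ∨ ∀ x, f x = x := by
  constructor
  · rintro ⟨h0, h⟩
    refine ⟨not_subsingleton_iff_nontrivial.1 fun hM => h0 (ModuleCat.isZero_of_subsingleton M),
      fun f hf => ?_⟩
    let E : M ≃ₗ[R] LinearMap.range f × LinearMap.ker f :=
      { toFun := fun x => (⟨f x, x, rfl⟩, ⟨x - f x, by rw [LinearMap.mem_ker, map_sub, hf, sub_self]⟩)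
        invFun := fun y => y.1 + y.2
        map_add' := fun a b => by
          refine Prod.ext (Subtype.ext (map_add f a b)) (Subtype.ext ?_)
          simp only [map_add, Prod.snd_add, Submodule.coe_add]
          abel
        map_smul' := fun r a => by
          refine Prod.ext (Subtype.ext (map_smul f r a)) (Subtype.ext ?_)
          simp [smul_sub]
        left_inv := fun x => by simp
        right_inv := fun ⟨⟨_, a, rfl⟩, ⟨b, hb⟩⟩ => by
          have hb' : f b = 0 := hb
          refine Prod.ext (Subtype.ext ?_) (Subtype.ext ?_)
          · simp [hf, hb']
          · simp [hf, hb'] }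
    rcases h (ModuleCat.of R (LinearMap.range f)) (ModuleCat.of R (LinearMap.ker f))
      (E.toModuleIso ≪≫ (ModuleCat.biprodIsoProd (ModuleCat.of R (LinearMap.range f))
        (ModuleCat.of R (LinearMap.ker f))).symm) with h | h
    · left
      intro x
      have := ModuleCat.subsingleton_of_isZero h
      exact congrArg Subtype.val
        (Subsingleton.elim (⟨f x, x, rfl⟩ : LinearMap.range f) 0)
    · right
      intro x
      have := ModuleCat.subsingleton_of_isZero h
      have h1 := congrArg Subtype.val (Subsingleton.elim
        (⟨x - f x, by rw [LinearMap.mem_ker, map_sub, hf, sub_self]⟩ : LinearMap.ker f) 0)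
      exact (sub_eq_zero.1 h1).symm
  · rintro ⟨h0, h⟩
    refine ⟨fun hz => ?_, fun Y Z φ => ?_⟩
    · have := ModuleCat.subsingleton_of_isZero hz
      exact not_subsingleton M this
    · let f := φ.hom ≫ Limits.biprod.fst ≫ Limits.biprod.inl ≫ φ.inv
      have hf : f ≫ f = f := by simp [f]
      rcases h f.hom (fun x => congrArg (fun g => g.hom x) hf) with h | h
      · left
        rw [Limits.IsZero.iff_id_eq_zero]
        have hf0 : f = 0 := by ext x; exact h x
        have : Limits.biprod.inl ≫ φ.inv ≫ f ≫ φ.hom ≫ Limits.biprod.fst = 𝟙 Y := by simp [f]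
        rw [← this, hf0]
        simp
      · right
        rw [Limits.IsZero.iff_id_eq_zero]
        have hf1 : f = 𝟙 M := by ext x; exact h x
        have h1 : Limits.biprod.inr ≫ φ.inv ≫ f ≫ φ.hom ≫ Limits.biprod.snd = (0 : Z ⟶ Z) := by
          simp [f]
        rw [hf1] at h1
        simpa using h1

theorem IsLocalModule.indecomposable {M : ModuleCat.{u} R} (h : IsLocalModule R M) :
    Indecomposable M := by
  refine indecomposable_iff.2 ⟨h.1, fun f hf => ?_⟩
  rcases h.2 f with ⟨n, hn⟩ | hb
  · left
    have hpow : ∀ n x, (f ^ (n + 1)) x = f x := by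
      intro n
      induction n with
      | zero => simp
      | succ n ih => intro x; rw [pow_succ', Module.End.mul_apply, ih, hf]
    intro x
    rw [← hpow n, pow_succ', Module.End.mul_apply, hn, map_zero]
  · right
    exact fun x => hb.1 (hf x)

theorem pow_apply_of_comm {P M : Type u} [AddCommGroup P] [Module R P] [AddCommGroup M]
    [Module R M] {i : P →ₗ[R] M} {f : P →ₗ[R] P} {g : M →ₗ[R] M} (h : ∀ x, g (i x) = i (f x))
    (n : ℕ) (x : P) : (g ^ n) (i x) = i ((f ^ n) x) := by
  induction n generalizing x with
  | zero => simp
  | succ n ih => rw [pow_succ', Module.End.mul_apply, ih, h, pow_succ', Module.End.mul_apply]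

variable [IsArtinianRing R] [IsNoetherianRing R]

theorem isLocalModule_of_indecomposable {M : ModuleCat.{u} R} [Module.Finite R M]
    (h : Indecomposable M) : IsLocalModule R M := by
  obtain ⟨h0, h⟩ := indecomposable_iff.1 h
  refine ⟨h0, fun f => ?_⟩
  obtain ⟨n, hn, hc⟩ := exists_isCompl_ker_pow_range_pow f
  obtain ⟨r, hr, hr'⟩ := exists_retraction hc
  rcases h ((LinearMap.range (f ^ n)).subtype ∘ₗ r) (fun x => by simp [hr]) with h | h
  · left
    refine ⟨n, fun x => ?_⟩
    have := h ((f ^ n) x)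
    rwa [LinearMap.comp_apply, hr ⟨_, x, rfl⟩] at this
  · right
    refine IsArtinian.bijective_of_injective_endomorphism f
      ((injective_iff_map_eq_zero f).2 fun x hx => ?_)
    rw [← h x, LinearMap.comp_apply, hr' x, map_zero]
    obtain ⟨m, rfl⟩ : ∃ m, n = m + 1 := ⟨n - 1, by omega⟩
    rw [LinearMap.mem_ker, pow_succ, Module.End.mul_apply, hx, map_zero]

/-- The Fitting image of `g` lies in the superfluous submodule `ker π`, so its complement, the
Fitting kernel, is everything. -/
theorem exists_pow_eq_zero_of_superfluous {P M : Type u} [AddCommGroup P] [Module R P]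
    [AddCommGroup M] [Module R M] [Module.Finite R P] {π : P →ₗ[R] M}
    (hπ : IsSuperfluous (LinearMap.ker π)) {g : P →ₗ[R] P} (hg : ∀ x, π (g x) = 0) :
    ∃ n, ∀ x, (g ^ n) x = 0 := by
  obtain ⟨n, hn, hc⟩ := exists_isCompl_ker_pow_range_pow g
  refine ⟨n, fun x => ?_⟩
  have : LinearMap.ker (g ^ n) = ⊤ := hπ _ (eq_top_iff.2 ?_)
  · exact LinearMap.mem_ker.1 (this ▸ Submodule.mem_top)
  · rw [← hc.sup_eq_top, sup_comm]
    refine sup_le_sup_right ?_ _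
    rintro _ ⟨y, rfl⟩
    obtain ⟨m, rfl⟩ : ∃ m, n = m + 1 := ⟨n - 1, by omega⟩
    rw [pow_succ', Module.End.mul_apply]
    exact hg _

theorem exists_pow_eq_zero_of_essential {Q M : Type u} [AddCommGroup Q] [Module R Q]
    [AddCommGroup M] [Module R M] [Module.Finite R Q] {i : M →ₗ[R] Q}
    (hi : IsEssential (LinearMap.range i)) {g : Q →ₗ[R] Q} (hg : ∀ x, g (i x) = 0) :
    ∃ n, ∀ x, (g ^ n) x = 0 := by
  obtain ⟨n, hn, hc⟩ := exists_isCompl_ker_pow_range_pow g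
  refine ⟨n, fun x => ?_⟩
  have : LinearMap.range (g ^ n) = ⊥ := hi _ (eq_bot_iff.2 ?_)
  · exact (Submodule.mem_bot R).1 (this ▸ ⟨x, rfl⟩)
  · rw [← hc.inf_eq_bot]
    refine inf_le_inf_right _ ?_
    rintro _ ⟨y, rfl⟩
    obtain ⟨m, rfl⟩ : ∃ m, n = m + 1 := ⟨n - 1, by omega⟩
    rw [LinearMap.mem_ker, pow_succ, Module.End.mul_apply, hg, map_zero]

/-- The syzygy of a local module whose projective cover is injective is local. -/
theorem isLocalModule_syzygy {X P M : Type u} [AddCommGroup X] [Module R X] [AddCommGroup P]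
    [Module R P] [AddCommGroup M] [Module R M] [Module.Finite R P] [Module.Finite R X]
    [Module.Injective R P] [Nontrivial X] {i : X →ₗ[R] P} {π : P →ₗ[R] M} (h : IsShortExact i π)
    (hπ : IsSuperfluous (LinearMap.ker π)) (hM : IsLocalModule R M) : IsLocalModule R X := by
  refine ⟨inferInstance, fun f => ?_⟩
  -- The endomorphism `f` extends to `g` on the injective `P` and induces `k` on `M`. Minimality of
  -- the cover carries both nilpotence and bijectivity from `k` to `g`, and so to `f`.
  obtain ⟨g, hg⟩ := Module.Injective.out i h.inj (i ∘ₗ f)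
  obtain ⟨k, hk⟩ := exists_factor π h.surj (π ∘ₗ g) (fun x hx => by
    obtain ⟨y, rfl⟩ := (h.exact x).1 hx
    rw [LinearMap.comp_apply, hg]
    exact h.comp_eq_zero _)
  rcases hM.2 k with ⟨n, hn⟩ | hb
  · left
    obtain ⟨m, hm⟩ := exists_pow_eq_zero_of_superfluous hπ (g := g ^ n) (fun x => by
      rw [← pow_apply_of_comm (g := k) hk, hn])
    refine ⟨n * m, fun x => h.inj ?_⟩
    rw [← pow_apply_of_comm (g := g) hg, pow_mul, hm, map_zero]
  · right
    have hsurj : LinearMap.range g = ⊤ := hπ _ (eq_top_iff.2 fun x _ => by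
      obtain ⟨m, hm⟩ := hb.2 (π x)
      obtain ⟨y, rfl⟩ := h.surj m
      rw [← sub_add_cancel x (g y)]
      refine Submodule.add_mem_sup ?_ ⟨y, rfl⟩
      rw [LinearMap.mem_ker, map_sub, ← hm, hk, LinearMap.comp_apply, sub_self])
    have hinj : Function.Injective g :=
      (IsNoetherian.bijective_of_surjective_endomorphism g (LinearMap.range_eq_top.1 hsurj)).1
    refine IsArtinian.bijective_of_injective_endomorphism f fun x y hxy => ?_
    apply h.inj
    apply hinj
    rw [hg, hg, LinearMap.comp_apply, LinearMap.comp_apply, hxy]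

/-- The cosyzygy of a local module whose injective envelope is projective is local. -/
theorem isLocalModule_cosyzygy {M Q N : Type u} [AddCommGroup M] [Module R M] [AddCommGroup Q]
    [Module R Q] [AddCommGroup N] [Module R N] [Module.Finite R Q]
    [Module.Projective R Q] [Nontrivial N] {i : M →ₗ[R] Q} {p : Q →ₗ[R] N} (h : IsShortExact i p)
    (hi : IsEssential (LinearMap.range i)) (hM : IsLocalModule R M) : IsLocalModule R N := by
  have : Module.Finite R N := Module.Finite.of_surjective p h.surj
  refine ⟨inferInstance, fun f => ?_⟩
  obtain ⟨g, hg'⟩ := Module.projective_lifting_property p (f ∘ₗ p) h.surj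
  have hg : ∀ x, p (g x) = f (p x) := LinearMap.congr_fun hg'
  have hgi : ∀ m, ∃ m', i m' = g (i m) := fun m =>
    (h.exact _).1 (by rw [hg, h.comp_eq_zero, map_zero])
  choose k hk using hgi
  let k' : M →ₗ[R] M :=
    { toFun := k
      map_add' := fun a b => h.inj (by rw [map_add, hk, hk, hk, map_add, map_add])
      map_smul' := fun r a => h.inj (by rw [hk, map_smul, map_smul, ← hk, RingHom.id_apply, map_smul]) }
  have hk' : ∀ m, g (i m) = i (k' m) := fun m => (hk m).symm
  rcases hM.2 k' with ⟨n, hn⟩ | hb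
  · left
    obtain ⟨m, hm⟩ := exists_pow_eq_zero_of_essential hi (g := g ^ n) (fun x => by
      rw [pow_apply_of_comm hk', hn, map_zero])
    refine ⟨n * m, fun x => ?_⟩
    obtain ⟨y, rfl⟩ := h.surj x
    rw [pow_apply_of_comm (f := g) (fun x => (hg x).symm), pow_mul, hm, map_zero]
  · right
    have hker : LinearMap.ker g = ⊥ := hi _ (eq_bot_iff.2 (by
      rintro _ ⟨⟨m, rfl⟩, hx⟩
      have h1 : i (k' m) = 0 := (hk' m).symm.trans hx
      have h2 : k' m = 0 := h.inj (h1.trans (map_zero i).symm)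
      rw [hb.1 (h2.trans (map_zero k').symm), map_zero]
      exact Submodule.zero_mem _))
    have hsurj : Function.Surjective g :=
      IsArtinian.surjective_of_injective_endomorphism g (LinearMap.ker_eq_bot.1 hker)
    refine IsNoetherian.bijective_of_surjective_endomorphism f fun x => ?_
    obtain ⟨y, rfl⟩ := h.surj x
    obtain ⟨z, rfl⟩ := hsurj y
    exact ⟨p z, (hg z).symm⟩

end LocalModules

/-! ### Almost split sequences and their irreducible maps. -/

section AlmostSplit

variable {R : Type u} [Ring R]

/-- An almost split sequence `0 → L → E → M → 0`. -/
structure IsAlmostSplit {L E M : ModuleCat.{u} R} (l : L →ₗ[R] E) (q : E →ₗ[R] M) : Prop where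
  ses : IsShortExact l q
  finite : Module.Finite R E
  no_section : ¬ HasSection q
  no_retraction : ¬ HasRetraction l
  right : ∀ (Z : ModuleCat.{u} R) (h : Z →ₗ[R] M), Module.Finite R Z → ¬ HasSection h →
    ∃ t : Z →ₗ[R] E, ∀ z, q (t z) = h z
  left : ∀ (Y : ModuleCat.{u} R) (f : L →ₗ[R] Y), Module.Finite R Y → ¬ HasRetraction f →
    ∃ t : E →ₗ[R] Y, ∀ x, t (l x) = f x

variable {L E M : ModuleCat.{u} R}

theorem IsShortExact.exists_lift {X P M Z : Type u} [AddCommGroup X] [AddCommGroup P]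
    [AddCommGroup M] [AddCommGroup Z] [Module R X] [Module R P] [Module R M] [Module R Z]
    {i : X →ₗ[R] P} {p : P →ₗ[R] M} (h : IsShortExact i p) (f : Z →ₗ[R] P)
    (hf : ∀ z, p (f z) = 0) : ∃ g : Z →ₗ[R] X, ∀ z, i (g z) = f z := by
  choose g hg using fun z => (h.exact _).1 (hf z)
  exact ⟨{ toFun := g
           map_add' := fun a b => h.inj (by rw [map_add, hg, hg, hg, map_add])
           map_smul' := fun r a => h.inj (by rw [map_smul, hg, hg, map_smul, RingHom.id_apply]) },
    hg⟩

theorem IsShortExact.hasSection_of_hasRetraction {l : L →ₗ[R] E} {q : E →ₗ[R] M}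
    (h : IsShortExact l q) (hl : HasRetraction l) : HasSection q := by
  obtain ⟨r, hr⟩ := hl
  obtain ⟨s, hs⟩ := exists_factor q h.surj (LinearMap.id - l ∘ₗ r) (fun x hx => by
    obtain ⟨y, rfl⟩ := (h.exact x).1 hx
    simp [hr])
  refine ⟨s, fun x => ?_⟩
  obtain ⟨y, rfl⟩ := h.surj x
  rw [hs]
  simp [h.comp_eq_zero]

theorem IsShortExact.hasRetraction_of_hasSection {l : L →ₗ[R] E} {q : E →ₗ[R] M}
    (h : IsShortExact l q) (hq : HasSection q) : HasRetraction l := by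
  obtain ⟨s, hs⟩ := hq
  obtain ⟨r, hr⟩ := h.exists_lift (LinearMap.id - s ∘ₗ q) (fun x => by simp [hs])
  exact ⟨r, fun x => h.inj (by rw [hr]; simp [h.comp_eq_zero])⟩

/-- A right almost split map with local kernel gives an almost split sequence. -/
theorem isAlmostSplit_of_right {l : L →ₗ[R] E} {q : E →ₗ[R] M} (h : IsShortExact l q)
    (hE : Module.Finite R E) (hq : ¬ HasSection q) (hL : IsLocalModule R L)
    (hr : ∀ (Z : ModuleCat.{u} R) (h : Z →ₗ[R] M), Module.Finite R Z → ¬ HasSection h →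
      ∃ t : Z →ₗ[R] E, ∀ z, q (t z) = h z) : IsAlmostSplit l q := by
  refine ⟨h, hE, hq, fun hl => hq (h.hasSection_of_hasRetraction hl), hr, fun Y f hY hf => ?_⟩
  -- `E'` is the pushout of `l` along `f`. If the pushed-out sequence splits, then `f` extends to
  -- `E`.
  let N : Submodule R (Y × E) := LinearMap.range (f.prod (-l))
  let E' := (Y × E) ⧸ N
  let q' : E' →ₗ[R] M := N.liftQ (q ∘ₗ LinearMap.snd R Y E) (by
    rintro _ ⟨x, rfl⟩
    simp [h.comp_eq_zero])
  have hq' : ∀ y x, q' (N.mkQ (y, x)) = q x := fun y x => rfl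
  let a : Y →ₗ[R] E' := N.mkQ ∘ₗ LinearMap.inl R Y E
  let c : E →ₗ[R] E' := N.mkQ ∘ₗ LinearMap.inr R Y E
  have hac : ∀ x, a (f x) = c (l x) := by
    intro x
    refine (Submodule.Quotient.eq N).2 ⟨x, ?_⟩
    simp
  have ses' : IsShortExact a q' := by
    refine ⟨(injective_iff_map_eq_zero a).2 fun y hy => ?_, fun m => ?_, fun z => ?_⟩
    · obtain ⟨x, hx⟩ := (Submodule.Quotient.mk_eq_zero N).1 hy
      have h1 : f x = y := congrArg Prod.fst hx
      have h2 : -l x = 0 := congrArg Prod.snd hx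
      rw [← h1, h.inj ((neg_eq_zero.1 h2).trans (map_zero l).symm), map_zero]
    · obtain ⟨x, rfl⟩ := h.surj m
      exact ⟨c x, rfl⟩
    · constructor
      · obtain ⟨⟨y, x⟩, rfl⟩ := N.mkQ_surjective z
        intro hz
        obtain ⟨w, rfl⟩ := (h.exact x).1 hz
        refine ⟨y + f w, ?_⟩
        rw [map_add, hac]
        refine (map_add N.mkQ (y, 0) (0, l w)).symm.trans ?_
        rw [Prod.mk_add_mk, add_zero, zero_add]
      · rintro ⟨y, rfl⟩
        exact map_zero q
  by_cases hs : HasSection q'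
  · obtain ⟨s, hs⟩ := hs
    obtain ⟨t, ht⟩ := ses'.exists_lift (c - s ∘ₗ q) (fun x => by
      rw [LinearMap.sub_apply, map_sub, LinearMap.comp_apply s, hs]
      exact sub_self (q x))
    refine ⟨t, fun x => ses'.inj ?_⟩
    rw [ht, hac]
    simp [h.comp_eq_zero]
  · exfalso
    obtain ⟨t, ht⟩ := hr (ModuleCat.of R E') q' (inferInstanceAs (Module.Finite R E')) hs
    let φ : E →ₗ[R] E := t ∘ₗ c
    have hφ : ∀ x, q (φ x) = q x := fun x => ht (c x)
    obtain ⟨g, hg⟩ := h.exists_lift (t ∘ₗ a) (fun y => (ht (a y)).trans (ses'.comp_eq_zero y))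
    have hψ : ∀ x, φ (l x) = l ((g ∘ₗ f) x) := fun x => by
      change t (c (l x)) = l (g (f x))
      rw [hg, ← hac]; rfl
    -- If the pushout does not split, `q'` lifts through `q`, giving an endomorphism `φ` of the
    -- original sequence over `M` that restricts to `g ∘ f` on `L`. Nilpotence of `g ∘ f` would
    -- split `q`, bijectivity would split `f`.
    rcases hL.2 (g ∘ₗ f) with ⟨n, hn⟩ | hb
    · have h1 : ∀ x, (φ ^ n) (l x) = 0 := fun x => by rw [pow_apply_of_comm hψ, hn, map_zero]
      obtain ⟨s, hs⟩ := exists_factor q h.surj (φ ^ n) (fun x hx => by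
        obtain ⟨y, rfl⟩ := (h.exact x).1 hx
        exact h1 y)
      have h2 : ∀ n x, q ((φ ^ n) x) = q x := by
        intro n
        induction n with
        | zero => simp
        | succ n ih => intro x; rw [pow_succ', Module.End.mul_apply, hφ, ih]
      refine hq ⟨s, fun m => ?_⟩
      obtain ⟨x, rfl⟩ := h.surj m
      rw [hs, h2]
    · exact hf ⟨(LinearEquiv.ofBijective _ hb).symm.toLinearMap ∘ₗ g, fun x =>
        (LinearEquiv.ofBijective _ hb).symm_apply_apply x⟩

variable [IsArtinianRing R]

/-- In an almost split sequence ending in a local module, the map on the left is left minimal. -/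
theorem IsAlmostSplit.left_minimal {l : L →ₗ[R] E} {q : E →ₗ[R] M} (h : IsAlmostSplit l q)
    (hM : IsLocalModule R M) {φ : E →ₗ[R] E} (hφ : ∀ x, φ (l x) = l x) :
    Function.Bijective φ := by
  have := h.finite
  obtain ⟨ψ, hψ⟩ := exists_factor q h.ses.surj (q ∘ₗ φ) (fun x hx => by
    obtain ⟨y, rfl⟩ := (h.ses.exact x).1 hx
    rw [LinearMap.comp_apply, hφ]
    exact h.ses.comp_eq_zero y)
  -- If the induced map `ψ` were nilpotent, a power of `φ` would map `E` into `L` while fixing `L`,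
  -- that is, be a retraction of `l`.
  rcases hM.2 ψ with ⟨n, hn⟩ | hb
  · exfalso
    obtain ⟨ρ, hρ⟩ := h.ses.exists_lift (φ ^ n) (fun x => by
      rw [← pow_apply_of_comm (g := ψ) hψ, hn])
    have hφn : ∀ n x, (φ ^ n) (l x) = l x := by
      intro n
      induction n with
      | zero => simp
      | succ n ih => intro x; rw [pow_succ', Module.End.mul_apply, ih, hφ]
    exact h.no_retraction ⟨ρ, fun x => h.ses.inj (by rw [hρ, hφn])⟩
  · refine IsArtinian.bijective_of_injective_endomorphism φ
      ((injective_iff_map_eq_zero φ).2 fun x hx => ?_)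
    have h1 : ψ (q x) = 0 := by rw [hψ, LinearMap.comp_apply, hx, map_zero]
    obtain ⟨y, rfl⟩ := (h.ses.exact x).1 (hb.1 (h1.trans (map_zero ψ).symm))
    rw [← hφ, hx]

/-- The components of the map on the left of an almost split sequence are irreducible. -/
theorem IsAlmostSplit.isIrreducibleMor {l : L →ₗ[R] E} {q : E →ₗ[R] M} (h : IsAlmostSplit l q)
    (hM : IsLocalModule R M) (hL : IsLocalModule R L) {X : ModuleCat.{u} R} (hX : Nontrivial X)
    (s : X →ₗ[R] E) (r : E →ₗ[R] X) (hrs : ∀ x, r (s x) = x) :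
    IsIrreducibleMor (ModuleCat.ofHom (r ∘ₗ l)) := by
  have h1 : ¬ HasRetraction (r ∘ₗ l) := fun ⟨t, ht⟩ => h.no_retraction ⟨t ∘ₗ r, ht⟩
  refine ⟨fun h' => h1 ((isSplitMono_iff _).1 h'), fun h' => ?_, fun Z g k hZ hgk => ?_⟩
  · obtain ⟨t, ht⟩ := (isSplitEpi_iff _).1 h'
    have hb := hL.bijective_of_retract (i := t) (r := r ∘ₗ l) ht
    refine h1 ⟨t, fun x => ?_⟩
    obtain ⟨y, rfl⟩ := hb.2 x
    exact congrArg t (ht y)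
  · by_cases hg : HasRetraction g.hom
    · exact Or.inl ((isSplitMono_iff _).2 hg)
    · right
      obtain ⟨t, ht⟩ := h.left Z g.hom hZ hg
      have hgk' : ∀ x, k.hom (g.hom x) = r (l x) := fun x => congrArg (fun f => f.hom x) hgk
      -- `φ` replaces the `X`-component of the identity by `k t`. It fixes the image of `l`, so left
      -- minimality makes it bijective and `k t` a split epimorphism.
      let φ : E →ₗ[R] E := LinearMap.id - s ∘ₗ r + s ∘ₗ k.hom ∘ₗ t
      have hφ : ∀ x, φ (l x) = l x := fun x => by simp [φ, ht, hgk']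
      let Φ := LinearEquiv.ofBijective φ (h.left_minimal hM hφ)
      refine (isSplitEpi_iff _).2 ⟨t ∘ₗ Φ.symm.toLinearMap ∘ₗ s, fun x => ?_⟩
      have h2 : ∀ y, k.hom (t y) = r (φ y) := fun y => by simp [φ, hrs]
      have h3 : φ (Φ.symm (s x)) = s x := Φ.apply_symm_apply (s x)
      change k.hom (t (Φ.symm (s x))) = x
      rw [h2, h3, hrs]

end AlmostSplit

/-! ### Syzygies, cosyzygies and almost split sequences of nonprojective biperfect modules. -/

section Core

variable {K : Type u} [Field K] {R : Type u} [Ring R] [Algebra K R]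

/-- `M` is a finitely generated indecomposable nonprojective module of infinite dominant and
codominant dimension. -/
structure IsCore (e : R) (lam : R →ₗ[K] K) (M : ModuleCat.{u} R) : Prop where
  finite : Module.Finite R M
  isLocal : IsLocalModule R M
  nonproj : ¬ Module.Projective R M
  biperfect : IsBiperfect e lam M

variable {e : R} {lam : R →ₗ[K] K} {M X P : ModuleCat.{u} R}

variable [FiniteDimensional K R]

theorem IsBiperfect.nonempty_dualBasis (hs : IsSymmIdempotent e lam) (hM : IsBiperfect e lam M)
    [Module.Finite R M] [Module.Projective R M] : Nonempty (DualBasis e M) :=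
  hM.hom.nonempty_dualBasis hs LinearMap.id
    (by rw [LinearMap.ker_id]; exact fun L hL => by rwa [bot_sup_eq] at hL) Function.surjective_id

/-- A projective syzygy would lie in `add(Re)`, hence be injective and split off `P`, which a
superfluous submodule cannot do unless it is zero. -/
theorem IsCore.syzygy (hs : IsSymmIdempotent e lam) (hM : IsCore e lam M) (b : DualBasis e P)
    {i : X →ₗ[R] P} {π : P →ₗ[R] M} (h : IsShortExact i π)
    (hπ : IsSuperfluous (LinearMap.ker π)) : IsCore e lam X := by
  have := isArtinianRing_of_finiteDimensional K (R := R)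
  have := isNoetherianRing_of_finiteDimensional K (R := R)
  have := b.finite
  have := b.projective
  have := b.injective hs
  have : Module.Finite R X := Module.Finite.of_injective i h.inj
  have hX : IsBiperfect e lam X := IsBiperfect.ker hs h b hM.biperfect
  have : Nontrivial X := by
    by_contra hX
    have := not_nontrivial_iff_subsingleton.1 hX
    have hinj : Function.Injective π := (injective_iff_map_eq_zero π).2 fun x hx => by
      obtain ⟨y, rfl⟩ := (h.exact x).1 hx
      rw [Subsingleton.elim y 0, map_zero]
    exact hM.nonproj (Module.Projective.of_equiv (LinearEquiv.ofBijective π ⟨hinj, h.surj⟩))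
  refine ⟨inferInstance, isLocalModule_syzygy h hπ hM.isLocal, fun hproj => ?_, hX⟩
  obtain ⟨c⟩ := hX.nonempty_dualBasis hs
  have := c.injective hs
  obtain ⟨r, hr⟩ := Module.Injective.out i h.inj (LinearMap.id : X →ₗ[R] X)
  have htop : LinearMap.ker r = ⊤ := hπ _ (eq_top_iff.2 fun x _ => by
    rw [← add_sub_cancel (i (r x)) x]
    refine Submodule.add_mem_sup (h.comp_eq_zero _) ?_
    rw [LinearMap.mem_ker, map_sub, hr, LinearMap.id_apply, sub_self])
  obtain ⟨x, hx⟩ := exists_ne (0 : X)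
  refine hx ?_
  rw [← LinearMap.id_apply (R := R) x, ← hr]
  exact LinearMap.mem_ker.1 (htop ▸ Submodule.mem_top)

/-- An essential embedding into a direct summand of a power of `Re`. -/
theorem exists_essential_embedding (hs : IsSymmIdempotent e lam) [Module.Finite R M]
    (hM : ∀ m : M, (∀ y, (e * y) • m = 0) → m = 0) :
    ∃ (Q : ModuleCat.{u} R) (_ : DualBasis e Q) (i : M →ₗ[R] Q), Function.Injective i ∧
      IsEssential (LinearMap.range i) := by
  have := isArtinianRing_of_finiteDimensional K (R := R)
  have := isNoetherianRing_of_finiteDimensional K (R := R)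
  have hex : ∃ (d : ℕ) (Q : ModuleCat.{u} R) (_ : DualBasis e Q) (i : M →ₗ[R] Q),
      Function.Injective i ∧ Module.finrank K Q = d := by
    obtain ⟨Q, b, i, hi⟩ := exists_embedding hs hM
    exact ⟨_, Q, b, i, hi, rfl⟩
  classical
  obtain ⟨Q, b, i, hi, hd⟩ := Nat.find_spec hex
  refine ⟨Q, b, i, hi, fun L hL => by_contra fun hL' => ?_⟩
  have := b.finite
  have := b.injective hs
  obtain ⟨U, V, hUV, hV, hU⟩ := exists_summand_ge_range i hi hL hL'
  obtain ⟨r, hr, hr'⟩ := exists_retraction hUV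
  refine Nat.find_min hex (m := Module.finrank K (ModuleCat.of R V)) ?_
    ⟨ModuleCat.of R V, b.ofRetract (X := ModuleCat.of R V) V.subtype r hr,
      i.codRestrict V fun m => hV ⟨m, rfl⟩, fun a c hac => hi (congrArg Subtype.val hac), rfl⟩
  rw [← hd]
  have := finiteDimensional_of_finite K Q
  have hlt : Module.finrank K (V.restrictScalars K) < Module.finrank K Q := by
    refine Submodule.finrank_lt (lt_top_iff_ne_top.2 fun h => hU ?_).ne
    have hV : V = ⊤ := by simpa using h
    have := hUV.inf_eq_bot
    rwa [hV, inf_top_eq] at this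
  refine lt_of_eq_of_lt ?_ hlt
  exact LinearEquiv.finrank_eq
    { toFun := fun v => v, invFun := fun v => v, map_add' := fun _ _ => rfl
      map_smul' := fun k v => Subtype.ext (algebraMap_smul R k (v : Q))
      left_inv := fun _ => rfl, right_inv := fun _ => rfl }

theorem IsCore.exists_cosyzygy (hs : IsSymmIdempotent e lam) (hM : IsCore e lam M) :
    ∃ (Q N : ModuleCat.{u} R) (_ : DualBasis e Q) (i : M →ₗ[R] Q) (p : Q →ₗ[R] N),
      IsShortExact i p ∧ IsSuperfluous (LinearMap.ker p) ∧ IsCore e lam N := by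
  have := isArtinianRing_of_finiteDimensional K (R := R)
  have := isNoetherianRing_of_finiteDimensional K (R := R)
  have := hM.finite
  obtain ⟨Q, b, i, hi, hess⟩ := exists_essential_embedding hs hM.biperfect.e_faithful
  obtain ⟨N, p, h⟩ : ∃ (N : ModuleCat.{u} R) (p : Q →ₗ[R] N), IsShortExact i p :=
    ⟨ModuleCat.of R (Q ⧸ LinearMap.range i), (LinearMap.range i).mkQ, isShortExact_range hi⟩
  have := b.finite
  have := b.projective
  have : Module.Finite R N := Module.Finite.of_surjective p h.surj
  have hnon : Nontrivial N := by
    by_contra hN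
    have := not_nontrivial_iff_subsingleton.1 hN
    have hsurj : Function.Surjective i := fun x => (h.exact x).1 (Subsingleton.elim _ _)
    exact hM.nonproj (Module.Projective.of_equiv (LinearEquiv.ofBijective i ⟨hi, hsurj⟩).symm)
  refine ⟨Q, N, b, i, p, h, fun L hL => by_contra fun hL' => ?_, inferInstance,
    isLocalModule_cosyzygy h hess hM.isLocal, fun hproj => ?_, IsBiperfect.coker hs h b hM.biperfect⟩
  -- If the kernel were not superfluous, a nonzero summand of `Q` would lie in `M`; being a summand
  -- of the local module `M`, it would equal `M`, which is not projective.
  · obtain ⟨U, V, hUV, hU, hU'⟩ := exists_summand_le_ker p hL hL'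
    obtain ⟨r, hr, -⟩ := exists_retraction hUV.symm
    obtain ⟨j, hj⟩ := h.exists_lift U.subtype (fun u => hU u.2)
    have : Nontrivial U := Submodule.nontrivial_iff_ne_bot.2 hU'
    have hb := hM.isLocal.bijective_of_retract (X := U) (i := j) (r := r ∘ₗ i) (fun u => by
      rw [LinearMap.comp_apply, hj]
      exact hr u)
    have : Module.Projective R U := Module.Projective.of_split U.subtype r (LinearMap.ext hr)
    exact hM.nonproj (Module.Projective.of_equiv (LinearEquiv.ofBijective j hb))
  · obtain ⟨s, hs'⟩ := Module.projective_lifting_property p LinearMap.id h.surj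
    obtain ⟨r, hr⟩ := h.hasRetraction_of_hasSection ⟨s, LinearMap.congr_fun hs'⟩
    exact hM.nonproj (Module.Projective.of_split i r (LinearMap.ext hr))

/-- Existence of an almost split sequence, in terms of a presentation by direct summands of powers
of `Re`. -/
theorem IsCore.exists_isAlmostSplit (hs : IsSymmIdempotent e lam) (hM : IsCore e lam M)
    {P₀ P₁ L : ModuleCat.{u} R} (b₀ : DualBasis e P₀) (b₁ : DualBasis e P₁) {ι : L →ₗ[R] P₁}
    {d : P₁ →ₗ[R] P₀} {π : P₀ →ₗ[R] M} (hι : Function.Injective ι)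
    (hd : ∀ x, d x = 0 ↔ ∃ y, ι y = x) (hπ : Function.Surjective π)
    (hπd : ∀ x, π x = 0 ↔ ∃ y, d y = x) (hL : IsLocalModule R L) :
    ∃ (E : ModuleCat.{u} R) (l : L →ₗ[R] E) (q : E →ₗ[R] M), IsAlmostSplit l q := by
  have := isArtinianRing_of_finiteDimensional K (R := R)
  have := isNoetherianRing_of_finiteDimensional K (R := R)
  have := hM.finite
  have := b₁.finite
  -- a functional on the endomorphisms of `M` that vanishes on the non-isomorphisms
  let J : Submodule K (M →ₗ[R] M) :=
    { carrier := {f | ¬ Function.Bijective f}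
      add_mem' := fun hf hg => hM.isLocal.add_not_bijective hf hg
      zero_mem' := fun h0 => by
        have := hM.isLocal.1
        obtain ⟨x, hx⟩ := exists_ne (0 : M)
        exact hx (h0.1 rfl)
      smul_mem' := fun k f hf hb => hf (by
        have hk : k ≠ 0 := by
          rintro rfl
          have := hM.isLocal.1
          obtain ⟨x, hx⟩ := exists_ne (0 : M)
          exact hx (hb.1 (by simp))
        refine ⟨fun x y hxy => hb.1 (by simp [hxy]), fun y => ?_⟩
        obtain ⟨x, hx⟩ := hb.2 (k • y)
        refine ⟨x, ?_⟩
        have := congrArg (fun z => k⁻¹ • z) hx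
        simpa [smul_smul, inv_mul_cancel₀ hk] using this) }
  have hJ : J < ⊤ := lt_top_iff_ne_top.2 fun h => by
    have : (LinearMap.id : M →ₗ[R] M) ∈ J := h ▸ Submodule.mem_top
    exact this Function.bijective_id
  obtain ⟨ξ, hξ, hξJ⟩ := Submodule.exists_le_ker_of_lt_top J hJ
  have hξ0 : ∀ w : M →ₗ[R] M, ¬ Function.Bijective w → ξ w = 0 := fun w hw => hξJ hw
  obtain ⟨g, hg⟩ := exists_extend_functional K (V := M →ₗ[R] M) (W := P₀ →ₗ[R] M)
    (LinearMap.lcomp K M π) (fun w w' h => by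
      ext m
      obtain ⟨x, rfl⟩ := hπ m
      exact LinearMap.congr_fun h x) ξ
  -- The trace pairing realizes the functional `ξ` by a map `u : M → P₀` with `trace (u w π) = ξ w`.
  -- It represents the class of the almost split sequence.
  obtain ⟨u, hu⟩ := b₀.exists_pairing_eq hs g
  have huξ : ∀ w : M →ₗ[R] M, b₀.trace lam (u ∘ₗ w ∘ₗ π) = ξ w := fun w => (hu _).trans (hg w)
  -- Embed `M` by `i` into a module in `add(Re)` and test `i π u` with the trace: cyclicity gives `ξ
  -- (v i)`, which is zero because an invertible `v i` would make `M` projective.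
  have hπu : ∀ m, π (u m) = 0 := by
    obtain ⟨Q, c, i, hi⟩ := exists_embedding hs hM.biperfect.e_faithful
    have h0 : i ∘ₗ π ∘ₗ u = 0 := c.pairing_left hs _ fun v => by
      have h1 := b₀.trace_comm hs c (i ∘ₗ π) (u ∘ₗ v)
      have h2 : (i ∘ₗ π ∘ₗ u) ∘ₗ v = (i ∘ₗ π) ∘ₗ (u ∘ₗ v) := rfl
      have h3 : (u ∘ₗ v) ∘ₗ (i ∘ₗ π) = u ∘ₗ (v ∘ₗ i) ∘ₗ π := rfl
      rw [h2, ← h1, h3, huξ]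
      refine hξ0 _ fun hb => ?_
      have := c.projective
      exact hM.nonproj (Module.Projective.of_split i
        ((LinearEquiv.ofBijective _ hb).symm.toLinearMap ∘ₗ v)
        (LinearMap.ext fun x => (LinearEquiv.ofBijective _ hb).symm_apply_apply x))
    exact fun m => hi ((LinearMap.congr_fun h0 m).trans (map_zero i).symm)
  -- The functional `v ↦ trace (u h v)` vanishes on every `v` with `v d = 0`, since then `v = w π`
  -- and `h w` is not invertible. So it factors through `v ↦ v d`, and the trace pairing for `P₁`
  -- yields `s` with `d s = u h`.
  have hfac : ∀ (Z : ModuleCat.{u} R) (h : Z →ₗ[R] M), Module.Finite R Z → ¬ HasSection h →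
      ∃ s : Z →ₗ[R] P₁, ∀ z, d (s z) = u (h z) := by
    intro Z h hZ hh
    let δ : (P₀ →ₗ[R] Z) →ₗ[K] (P₁ →ₗ[R] Z) := LinearMap.lcomp K Z d
    obtain ⟨σ, hσ⟩ := exists_factor (S := K) (P := P₀ →ₗ[R] Z) (M := LinearMap.range δ) (X := K)
      δ.rangeRestrict δ.surjective_rangeRestrict (b₀.pairing lam Z (u ∘ₗ h)) (fun v hv => by
        have hv' : v ∘ₗ d = 0 := congrArg Subtype.val hv
        obtain ⟨w, hw⟩ := exists_factor π hπ v (fun x hx => by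
          obtain ⟨y, rfl⟩ := (hπd x).1 hx
          exact LinearMap.congr_fun hv' y)
        have hv'' : v = w ∘ₗ π := (LinearMap.ext hw).symm
        rw [DualBasis.pairing_apply, hv'']
        refine (huξ (h ∘ₗ w)).trans (hξ0 _ fun hb => hh ?_)
        exact ⟨w ∘ₗ (LinearEquiv.ofBijective _ hb).symm.toLinearMap, fun x =>
          (LinearEquiv.ofBijective _ hb).apply_symm_apply x⟩)
    obtain ⟨σ', hσ'⟩ := exists_extend_functional K (LinearMap.range δ).subtype
      Subtype.val_injective σ
    obtain ⟨s, hs'⟩ := b₁.exists_pairing_eq hs σ'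
    refine ⟨s, fun z => ?_⟩
    have h0 : d ∘ₗ s - u ∘ₗ h = 0 := b₀.pairing_left hs _ fun v => by
      rw [← DualBasis.pairing_apply, map_sub, LinearMap.sub_apply, DualBasis.pairing_apply,
        DualBasis.pairing_apply, sub_eq_zero]
      have h1 := b₁.trace_comm hs b₀ d (s ∘ₗ v)
      have h2 : (d ∘ₗ s) ∘ₗ v = d ∘ₗ (s ∘ₗ v) := rfl
      have h3 : (s ∘ₗ v) ∘ₗ d = s ∘ₗ (v ∘ₗ d) := rfl
      rw [h2, ← h1, h3, hs']
      exact (hσ' (δ.rangeRestrict v)).trans (hσ v)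
    exact sub_eq_zero.1 (LinearMap.congr_fun h0 z)
  -- The pullback of `d` along `u`; its projection to `M` has kernel `ker d = L`, and a map to `M`
  -- lifts exactly when its composite with `u` factors through `d`.
  let N : Submodule R (P₁ × M) :=
    LinearMap.ker (d ∘ₗ LinearMap.fst R P₁ M - u ∘ₗ LinearMap.snd R P₁ M)
  have hN : ∀ x, x ∈ N ↔ d x.1 = u x.2 := fun x => by
    rw [LinearMap.mem_ker, LinearMap.sub_apply, sub_eq_zero]; rfl
  let l : L →ₗ[R] N := ((LinearMap.inl R P₁ M) ∘ₗ ι).codRestrict N fun y => (hN _).2 (by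
    simpa using (hd (ι y)).2 ⟨y, rfl⟩)
  let q : N →ₗ[R] M := LinearMap.snd R P₁ M ∘ₗ N.subtype
  have ses : IsShortExact l q := by
    refine ⟨fun a b hab => hι ?_, fun m => ?_, fun x => ?_⟩
    · exact congrArg (fun z : N => z.1.1) hab
    · obtain ⟨y, hy⟩ := (hπd _).1 (hπu m)
      exact ⟨⟨(y, m), (hN _).2 hy⟩, rfl⟩
    · obtain ⟨⟨y, m⟩, hx⟩ := x
      constructor
      · intro hm
        have hm' : m = 0 := hm
        have h1 := (hN _).1 hx
        rw [hm', map_zero] at h1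
        obtain ⟨z, rfl⟩ := (hd y).1 h1
        exact ⟨z, Subtype.ext (Prod.ext rfl hm'.symm)⟩
      · rintro ⟨z, hz⟩
        exact (congrArg (fun z : N => z.1.2) hz).symm
  refine ⟨ModuleCat.of R N, l, q, isAlmostSplit_of_right (E := ModuleCat.of R N) ses
    (inferInstanceAs (Module.Finite R N)) ?_ hL ?_⟩
  · rintro ⟨s, hs'⟩
    -- A splitting would give `u = d s'`, and then `ξ w = trace (d s' w π) = trace (s' w π d) = 0`.
    refine hξ (LinearMap.ext fun w => ?_)
    let s' : M →ₗ[R] P₁ := LinearMap.fst R P₁ M ∘ₗ N.subtype ∘ₗ s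
    have hus : u = d ∘ₗ s' := LinearMap.ext fun m => by
      have h1 := (hN _).1 (s m).2
      have h2 : (s m).1.2 = m := hs' m
      rw [h2] at h1
      exact h1.symm
    rw [← huξ, hus]
    have h1 := b₁.trace_comm hs b₀ d (s' ∘ₗ w ∘ₗ π)
    have h2 : (d ∘ₗ s') ∘ₗ w ∘ₗ π = d ∘ₗ (s' ∘ₗ w ∘ₗ π) := rfl
    have h3 : (s' ∘ₗ w ∘ₗ π) ∘ₗ d = 0 := LinearMap.ext fun x => by
      simp [(hπd (d x)).2 ⟨x, rfl⟩]
    rw [h2, ← h1, h3]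
    simp [DualBasis.trace]
  · intro Z h hZ hh
    obtain ⟨s, hs'⟩ := hfac Z h hZ hh
    exact ⟨(s.prod h).codRestrict N fun z => (hN _).2 (hs' z), fun z => rfl⟩

end Core

/-! ### Irreducible maps stay inside the class of good modules. -/

section Components

variable {K : Type u} [Field K] {R : Type u} [Ring R] [Algebra K R] [FiniteDimensional K R]
  {e : R} {lam : R →ₗ[K] K}

/-- The almost split sequence ending in `M`. -/
theorem IsCore.exists_tau (hs : IsSymmIdempotent e lam) {M : ModuleCat.{u} R}
    (hM : IsCore e lam M) :
    ∃ (L E : ModuleCat.{u} R) (l : L →ₗ[R] E) (q : E →ₗ[R] M),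
      IsCore e lam L ∧ IsTau K M L ∧ IsAlmostSplit l q := by
  have := hM.finite
  obtain ⟨p⟩ := nonempty_minProjPresentation K M
  obtain ⟨-, -, -, ⟨b₀⟩, ⟨b₁⟩⟩ := hM.biperfect.nonempty_tr_equiv hs p
  have h₀ : ∀ x, p.π.hom x = 0 ↔ ∃ y, p.d.hom y = x := fun x => by
    have : x ∈ LinearMap.range p.d.hom ↔ x ∈ LinearMap.ker p.π.hom := by rw [p.exact]
    exact this.symm
  have hX : IsCore e lam (ModuleCat.of R (LinearMap.ker p.π.hom)) :=
    hM.syzygy hs b₀ (isShortExact_ker p.surjective) p.superfluous₀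
  obtain ⟨d', hd'⟩ : ∃ d' : p.P₁ →ₗ[R] ModuleCat.of R (LinearMap.ker p.π.hom),
      ∀ x, (LinearMap.ker p.π.hom).subtype (d' x) = p.d.hom x :=
    ⟨p.d.hom.codRestrict _ fun x => (h₀ _).2 ⟨x, rfl⟩, fun x => rfl⟩
  have hd0 : ∀ x, d' x = 0 ↔ p.d.hom x = 0 := fun x => by
    rw [← hd']
    exact (Submodule.coe_eq_zero (x := d' x)).symm
  have hker : LinearMap.ker d' = LinearMap.ker p.d.hom := Submodule.ext hd0
  have hsurj : Function.Surjective d' := by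
    rintro ⟨y, hy⟩
    obtain ⟨x, rfl⟩ := (h₀ y).1 hy
    exact ⟨x, Subtype.ext (hd' x)⟩
  have hd : ∀ x, p.d.hom x = 0 ↔ ∃ k, (LinearMap.ker p.d.hom).subtype k = x := fun x =>
    ⟨fun h => ⟨⟨x, h⟩, rfl⟩, by rintro ⟨k, rfl⟩; exact k.2⟩
  have ses : IsShortExact (R := R) (K := LinearMap.ker p.d.hom) (P := p.P₁)
      (M := LinearMap.ker p.π.hom) (LinearMap.ker p.d.hom).subtype d' :=
    ⟨Subtype.val_injective, hsurj, fun x => (hd0 x).trans (hd x)⟩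
  have hL : IsCore e lam (ModuleCat.of R (LinearMap.ker p.d.hom)) :=
    hX.syzygy hs b₁ ses (hker ▸ p.superfluous₁)
  obtain ⟨E, l, q, h⟩ := hM.exists_isAlmostSplit (L := ModuleCat.of R (LinearMap.ker p.d.hom)) hs
    b₀ b₁ (ι := (LinearMap.ker p.d.hom).subtype) Subtype.val_injective hd p.surjective h₀ hL.isLocal
  exact ⟨_, E, l, q, hL, hM.biperfect.isTau hs p, h⟩

/-- The almost split sequence starting in `M`. -/
theorem IsCore.exists_tauInv (hs : IsSymmIdempotent e lam) {M : ModuleCat.{u} R}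
    (hM : IsCore e lam M) :
    ∃ (E N : ModuleCat.{u} R) (l : M →ₗ[R] E) (q : E →ₗ[R] N),
      IsCore e lam N ∧ IsTau K N M ∧ IsAlmostSplit l q := by
  obtain ⟨Q₀, N₁, b₁, i₀, p₀, h₀, hs₀, hN₁⟩ := hM.exists_cosyzygy hs
  obtain ⟨Q₁, N, b₀, i₁, p₁, h₁, hs₁, hN⟩ := hN₁.exists_cosyzygy hs
  have := hN.finite
  have hd0 : ∀ x, i₁ (p₀ x) = 0 ↔ p₀ x = 0 := fun x =>
    ⟨fun h => h₁.inj (h.trans (map_zero i₁).symm), fun h => by rw [h, map_zero]⟩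
  have hd : ∀ x, (i₁ ∘ₗ p₀) x = 0 ↔ ∃ y, i₀ y = x := fun x => (hd0 x).trans (h₀.exact x)
  have hπd : ∀ x, p₁ x = 0 ↔ ∃ y, (i₁ ∘ₗ p₀) y = x := fun x => by
    rw [h₁.exact]
    constructor
    · rintro ⟨y, rfl⟩
      obtain ⟨z, rfl⟩ := h₀.surj y
      exact ⟨z, rfl⟩
    · rintro ⟨y, rfl⟩
      exact ⟨p₀ y, rfl⟩
  have hker : LinearMap.ker (i₁ ∘ₗ p₀) = LinearMap.ker p₀ := Submodule.ext hd0
  -- Two cosyzygy sequences spliced together form a minimal presentation of `N` with kernel `M`, so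
  -- `M ≅ Ω²N ≅ τ N`.
  let p : MinProjPresentation N :=
    ⟨Q₀, Q₁, ModuleCat.ofHom (i₁ ∘ₗ p₀), ModuleCat.ofHom p₁, b₁.projective, b₀.projective, h₁.surj,
      Submodule.ext fun x => (hπd x).symm, hs₁, hker.symm ▸ hs₀⟩
  obtain ⟨E, l, q, h⟩ := hN.exists_isAlmostSplit hs b₀ b₁ h₀.inj hd h₁.surj hπd hM.isLocal
  refine ⟨E, N, l, q, hN, ?_, h⟩
  obtain ⟨p', ⟨φ⟩⟩ := hN.biperfect.isTau hs p
  have ι : M ≃ₗ[R] LinearMap.ker (i₁ ∘ₗ p₀) := LinearEquiv.ofBijective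
    (i₀.codRestrict _ fun m => (hd _).2 ⟨m, rfl⟩)
    ⟨fun a b hab => h₀.inj (congrArg Subtype.val hab), fun ⟨x, hx⟩ => by
      obtain ⟨y, rfl⟩ := (hd x).1 hx
      exact ⟨y, rfl⟩⟩
  exact ⟨p', ⟨(LinearEquiv.toModuleIso (X₂ := LinearMap.ker (i₁ ∘ₗ p₀)) ι) ≪≫ φ⟩⟩

section Top

variable {R : Type u} [Ring R] {P S : Type u} [AddCommGroup P] [Module R P] [AddCommGroup S]
  [Module R S]

/-- A submodule `L` mapping onto `S` would let `p` lift to an endomorphism with image in `L` that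
preserves `p`. It is not nilpotent, so it is bijective and `L` is everything: `ker p` is the
radical. -/
theorem le_ker_of_ne_top [Module.Projective R P] (hP : IsLocalModule R P) [IsSimpleModule R S]
    {p : P →ₗ[R] S} (hp : Function.Surjective p) {L : Submodule R P} (hL : L ≠ ⊤) :
    L ≤ LinearMap.ker p := by
  by_contra h
  have hmap : L.map p = ⊤ := (eq_bot_or_eq_top (L.map p)).resolve_left fun h0 =>
    h (LinearMap.le_ker_iff_map.2 h0)
  have hsurj : Function.Surjective (p ∘ₗ L.subtype) := by
    rw [← LinearMap.range_eq_top, LinearMap.range_comp, Submodule.range_subtype, hmap]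
  obtain ⟨t, ht⟩ := Module.projective_lifting_property _ p hsurj
  have hα : ∀ x, p ((L.subtype ∘ₗ t) x) = p x := LinearMap.congr_fun ht
  rcases hP.2 (L.subtype ∘ₗ t) with ⟨n, hn⟩ | hb
  · have hpow : ∀ n x, p (((L.subtype ∘ₗ t) ^ n) x) = p x := by
      intro n
      induction n with
      | zero => simp
      | succ n ih => intro x; rw [pow_succ', Module.End.mul_apply, hα, ih]
    have := IsSimpleModule.nontrivial R S
    obtain ⟨s, hs⟩ := exists_ne (0 : S)
    obtain ⟨x, rfl⟩ := hp s
    exact hs (by rw [← hpow n, hn, map_zero])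
  · refine hL (eq_top_iff.2 fun x _ => ?_)
    obtain ⟨y, rfl⟩ := hb.2 x
    exact (t y).2

/-- Dually, if `S` meets `N` trivially then an endomorphism fixing `S` factors through `P / N`; it
is bijective, so `N = 0`. Thus `S` is the socle and lies in every nonzero submodule. -/
theorem range_le_of_ne_bot [Module.Injective R P] (hP : IsLocalModule R P) [IsSimpleModule R S]
    {j : S →ₗ[R] P} (hj : Function.Injective j) {N : Submodule R P} (hN : N ≠ ⊥) :
    LinearMap.range j ≤ N := by
  rcases eq_bot_or_eq_top (N.comap j) with h | h
  · exfalso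
    have hinj : Function.Injective (N.mkQ ∘ₗ j) := by
      rw [← LinearMap.ker_eq_bot, LinearMap.ker_comp, Submodule.ker_mkQ, h]
    obtain ⟨β, hβ⟩ := Module.Injective.out (N.mkQ ∘ₗ j) hinj j
    have hα : ∀ s, (β ∘ₗ N.mkQ) (j s) = j s := hβ
    rcases hP.2 (β ∘ₗ N.mkQ) with ⟨n, hn⟩ | hb
    · have hpow : ∀ n s, ((β ∘ₗ N.mkQ) ^ n) (j s) = j s := by
        intro n
        induction n with
        | zero => simp
        | succ n ih => intro x; rw [pow_succ', Module.End.mul_apply, ih, hα]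
      have := IsSimpleModule.nontrivial R S
      obtain ⟨s, hs⟩ := exists_ne (0 : S)
      exact hs (hj (by rw [← hpow n, hn, map_zero]))
    · refine hN (eq_bot_iff.2 fun x hx => ?_)
      refine (Submodule.mem_bot R).2 (hb.1 ?_)
      rw [map_zero, LinearMap.comp_apply, Submodule.mkQ_apply,
        (Submodule.Quotient.mk_eq_zero N).2 hx, map_zero]
  · rintro _ ⟨s, rfl⟩
    have : s ∈ N.comap j := h ▸ Submodule.mem_top
    exact this

theorem exists_simple_quotient [IsNoetherianRing R] [Module.Finite R P] [Nontrivial P] :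
    ∃ (S : ModuleCat.{u} R) (p : P →ₗ[R] S), IsSimpleModule R S ∧ Function.Surjective p := by
  obtain ⟨J, hJ⟩ := IsCoatomic.exists_coatom (Submodule R P)
  exact ⟨ModuleCat.of R (P ⧸ J), J.mkQ, isSimpleModule_iff_isCoatom.2 hJ, J.mkQ_surjective⟩

end Top

/-- Since `Hom(S, P) ≅ D Hom(P, S)` by the trace pairing, a simple quotient of `P` is also a
submodule: top and socle agree. -/
theorem DualBasis.exists_socle (hs : IsSymmIdempotent e lam) {P S : ModuleCat.{u} R}
    (b : DualBasis e P) [IsSimpleModule R S] {p : P →ₗ[R] S} (hp : Function.Surjective p) :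
    ∃ j : S →ₗ[R] P, Function.Injective j := by
  have hp0 : p ≠ 0 := by
    rintro rfl
    have := IsSimpleModule.nontrivial R S
    obtain ⟨s, hs⟩ := exists_ne (0 : S)
    obtain ⟨x, rfl⟩ := hp s
    exact hs rfl
  by_contra h
  refine hp0 (b.pairing_right hs p fun u => ?_)
  have hu : u = 0 := by
    by_contra hu
    exact h ⟨u, (LinearMap.injective_or_eq_zero u).resolve_right hu⟩
  rw [hu]
  simp [DualBasis.trace]

/-- The modules in the Auslander–Reiten components of the indecomposable nonprojective modules of
infinite dominant and codominant dimension. -/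
structure IsGood (e : R) (lam : R →ₗ[K] K) (M : ModuleCat.{u} R) : Prop where
  finite : Module.Finite R M
  isLocal : IsLocalModule R M
  biperfect : IsBiperfect e lam M
  -- The neighbours of a projective member are summands of its radical and of its quotient by the
  -- socle. Both are biperfect once the simple top is, because the socle is isomorphic to it.
  top : Module.Projective R M → ∃ (S : ModuleCat.{u} R) (p : M →ₗ[R] S), IsSimpleModule R S ∧
    Function.Surjective p ∧ IsBiperfect e lam S

variable {M X Y P : ModuleCat.{u} R}

omit [FiniteDimensional K R] in
theorem IsCore.isGood (hM : IsCore e lam M) : IsGood e lam M :=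
  ⟨hM.finite, hM.isLocal, hM.biperfect, fun h => absurd h hM.nonproj⟩

omit [FiniteDimensional K R] in
theorem IsGood.isCore (hM : IsGood e lam M) (h : ¬ Module.Projective R M) : IsCore e lam M :=
  ⟨hM.finite, hM.isLocal, h, hM.biperfect⟩

omit [FiniteDimensional K R] in
theorem IsGood.of_linearEquiv (hM : IsGood e lam M) (E : M ≃ₗ[R] X) : IsGood e lam X where
  finite := have := hM.finite; Module.Finite.equiv E
  isLocal := isLocalModule_of_linearEquiv E hM.isLocal
  biperfect := hM.biperfect.of_linearEquiv E.symm
  top hX := by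
    obtain ⟨S, p, hS, hp, hb⟩ := hM.top (Module.Projective.of_equiv E.symm)
    exact ⟨S, p ∘ₗ E.symm.toLinearMap, hS, hp.comp E.symm.surjective, hb⟩

theorem irreducible_not_surjective [Module.Projective R Y] {f : X ⟶ Y}
    (hf : IsIrreducibleMor f) : ¬ Function.Surjective f.hom := fun h => by
  obtain ⟨s, hs⟩ := Module.projective_lifting_property f.hom LinearMap.id h
  exact hf.2.1 ((isSplitEpi_iff f).2 ⟨s, LinearMap.congr_fun hs⟩)

theorem irreducible_not_injective [Module.Injective R X] {f : X ⟶ Y}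
    (hf : IsIrreducibleMor f) : ¬ Function.Injective f.hom := fun h => by
  obtain ⟨r, hr⟩ := Module.Injective.out f.hom h (LinearMap.id : X →ₗ[R] X)
  exact hf.1 ((isSplitMono_iff f).2 ⟨r, hr⟩)

/-- An irreducible map into a projective module splits into the radical. -/
theorem irreducible_to_projective [IsNoetherianRing R] [Module.Finite R P] [Module.Projective R P]
    (hP : IsLocalModule R P) {S : ModuleCat.{u} R} [IsSimpleModule R S] {p : P →ₗ[R] S}
    (hp : Function.Surjective p) {f : Y ⟶ P} (hf : IsIrreducibleMor f) :
    ∃ (g : Y →ₗ[R] LinearMap.ker p) (r : LinearMap.ker p →ₗ[R] Y),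
      (∀ y, (g y : P) = f.hom y) ∧ ∀ y, r (g y) = y := by
  have hle : LinearMap.range f.hom ≤ LinearMap.ker p := le_ker_of_ne_top hP hp fun h =>
    irreducible_not_surjective hf (LinearMap.range_eq_top.1 h)
  let g : Y →ₗ[R] LinearMap.ker p := f.hom.codRestrict _ fun y => hle ⟨y, rfl⟩
  rcases hf.2.2 (ModuleCat.of R (LinearMap.ker p)) (ModuleCat.ofHom g)
    (ModuleCat.ofHom (LinearMap.ker p).subtype) (inferInstanceAs (Module.Finite R (LinearMap.ker p)))
    (by ext y; rfl) with h | h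
  · obtain ⟨r, hr⟩ := (isSplitMono_iff _).1 h
    exact ⟨g, r, fun y => rfl, hr⟩
  · exfalso
    obtain ⟨s, hs⟩ := (isSplitEpi_iff _).1 h
    have := IsSimpleModule.nontrivial R S
    obtain ⟨z, hz⟩ := exists_ne (0 : S)
    obtain ⟨x, rfl⟩ := hp z
    refine hz ?_
    have h1 : ((s x : LinearMap.ker p) : P) = x := hs x
    rw [← h1]
    exact (s x : LinearMap.ker p).2

/-- An irreducible map from an injective module splits off the quotient by the socle. -/
theorem irreducible_from_injective [Module.Finite R P] [Module.Injective R P]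
    (hP : IsLocalModule R P) {S : ModuleCat.{u} R} [IsSimpleModule R S] {j : S →ₗ[R] P}
    (hj : Function.Injective j) {f : P ⟶ Y} (hf : IsIrreducibleMor f) :
    ∃ (h : (P ⧸ LinearMap.range j) →ₗ[R] Y) (s : Y →ₗ[R] (P ⧸ LinearMap.range j)),
      (∀ x, h ((LinearMap.range j).mkQ x) = f.hom x) ∧ ∀ y, h (s y) = y := by
  have hle : LinearMap.range j ≤ LinearMap.ker f.hom := range_le_of_ne_bot hP hj fun h =>
    irreducible_not_injective hf (LinearMap.ker_eq_bot.1 h)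
  let h : (P ⧸ LinearMap.range j) →ₗ[R] Y := (LinearMap.range j).liftQ f.hom hle
  rcases hf.2.2 (ModuleCat.of R (P ⧸ LinearMap.range j)) (ModuleCat.ofHom (LinearMap.range j).mkQ)
    (ModuleCat.ofHom h) (inferInstanceAs (Module.Finite R (P ⧸ LinearMap.range j)))
    (by ext y; rfl) with h' | h'
  · exfalso
    obtain ⟨r, hr⟩ := (isSplitMono_iff _).1 h'
    have := IsSimpleModule.nontrivial R S
    obtain ⟨z, hz⟩ := exists_ne (0 : S)
    refine hz (hj ?_)
    have h1 : r ((LinearMap.range j).mkQ (j z)) = j z := hr (j z)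
    have h2 : (LinearMap.range j).mkQ (j z) = 0 := (Submodule.Quotient.mk_eq_zero _).2 ⟨z, rfl⟩
    rw [← h1, h2, map_zero, map_zero]
  · obtain ⟨s, hs⟩ := (isSplitEpi_iff _).1 h'
    exact ⟨h, s, fun x => rfl, hs⟩

theorem IsGood.of_irreducible_from (hs : IsSymmIdempotent e lam) (hX : IsGood e lam X)
    (hY : Module.Finite R Y) (hY' : IsLocalModule R Y) {f : X ⟶ Y} (hf : IsIrreducibleMor f) :
    IsGood e lam Y := by
  have := isNoetherianRing_of_finiteDimensional K (R := R)
  have := hX.finite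
  by_cases hproj : Module.Projective R X
  · obtain ⟨S, p, hS, hp, hb⟩ := hX.top hproj
    obtain ⟨b⟩ := hX.biperfect.nonempty_dualBasis hs
    have := b.injective hs
    obtain ⟨j, hj⟩ := b.exists_socle hs hp
    obtain ⟨h, s, hh, hhs⟩ := irreducible_from_injective hX.isLocal hj hf
    have hQ : IsBiperfect e lam (ModuleCat.of R (X ⧸ LinearMap.range j)) :=
      IsBiperfect.coker hs (isShortExact_range hj) b hb
    refine ⟨hY, hY', hQ.of_retract s h hhs, fun hYp => ?_⟩
    refine absurd (fun y => ?_) (irreducible_not_surjective hf)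
    obtain ⟨x, hx⟩ := (LinearMap.range j).mkQ_surjective (s y)
    exact ⟨x, by rw [← hh, hx, hhs]⟩
  · have hc := hX.isCore hproj
    obtain ⟨E, N, l, q, hN, -, h⟩ := hc.exists_tauInv hs
    obtain ⟨t, ht⟩ := h.left Y f.hom hY fun h' => hf.1 ((isSplitMono_iff f).2 h')
    have hsec : HasSection t := by
      rcases hf.2.2 E (ModuleCat.ofHom l) (ModuleCat.ofHom t) h.finite (by ext x; exact ht x)
        with h' | h'
      · exact absurd ((isSplitMono_iff _).1 h') h.no_retraction
      · exact (isSplitEpi_iff _).1 h'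
    obtain ⟨s, hts⟩ := hsec
    have hbY : IsBiperfect e lam Y :=
      (IsBiperfect.extension hs h.ses hc.biperfect hN.biperfect).of_retract s t hts
    -- If `Y` is projective, `X` is a summand of `rad Y`. It remains to see that it is all of it;
    -- then the top is the cokernel of `X → Y`.
    refine ⟨hY, hY', hbY, fun hYp => ?_⟩
    obtain ⟨b⟩ := hbY.nonempty_dualBasis hs
    have := b.injective hs
    have := hY'.1
    obtain ⟨S, p, hS, hp⟩ := exists_simple_quotient (R := R) (P := Y)
    obtain ⟨j, hj⟩ := b.exists_socle hs hp
    obtain ⟨g, r, hg, hr⟩ := irreducible_to_projective hY' hp hf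
    have hbij : Function.Bijective g := by
      refine ⟨Function.LeftInverse.injective hr, ?_⟩
      -- A nonzero complement of `X` in `rad Y` would contain the simple socle of `Y`, and so would
      -- `X`; but the two meet in zero.
      have hker : (LinearMap.ker r).map (LinearMap.ker p).subtype = ⊥ := by
        by_contra h0
        have h1 := range_le_of_ne_bot hY' hj h0
        have h2 : (LinearMap.range g).map (LinearMap.ker p).subtype ≠ ⊥ := by
          intro h3
          have := hX.isLocal.1
          obtain ⟨x, hx⟩ := exists_ne (0 : X)
          have h4 : ((g x : LinearMap.ker p) : Y) ∈
              (LinearMap.range g).map (LinearMap.ker p).subtype := ⟨g x, ⟨x, rfl⟩, rfl⟩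
          rw [h3, Submodule.mem_bot] at h4
          exact hx (by rw [← hr x, Submodule.coe_eq_zero.1 h4, map_zero])
        have h3 := range_le_of_ne_bot hY' hj h2
        have := IsSimpleModule.nontrivial R S
        obtain ⟨z, hz⟩ := exists_ne (0 : S)
        obtain ⟨a, ha, haz⟩ := h1 ⟨z, rfl⟩
        obtain ⟨c, ⟨x, rfl⟩, hcz⟩ := h3 ⟨z, rfl⟩
        have hac : a = g x := Subtype.ext (haz.trans hcz.symm)
        have hx0 : x = 0 := by rw [← hr x, ← hac]; exact ha
        refine hz (hj ?_)
        rw [← hcz, hx0]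
        simp
      intro y
      refine ⟨r y, ?_⟩
      have h1 : y - g (r y) ∈ LinearMap.ker r := by
        rw [LinearMap.mem_ker, map_sub, hr, sub_self]
      have h2 : ((y - g (r y) : LinearMap.ker p) : Y) ∈
          (LinearMap.ker r).map (LinearMap.ker p).subtype := ⟨_, h1, rfl⟩
      rw [hker, Submodule.mem_bot] at h2
      exact (sub_eq_zero.1 (Submodule.coe_eq_zero.1 h2)).symm
    have hJ : IsBiperfect e lam (ModuleCat.of R (LinearMap.ker p)) :=
      hc.biperfect.of_linearEquiv (X := ModuleCat.of R (LinearMap.ker p))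
        (LinearEquiv.ofBijective g hbij).symm
    exact ⟨S, p, hS, hp, IsBiperfect.coker (X := ModuleCat.of R (LinearMap.ker p)) hs
      (isShortExact_ker hp) b hJ⟩

theorem IsGood.of_irreducible_to (hs : IsSymmIdempotent e lam) (hX : IsGood e lam X)
    (hY : Module.Finite R Y) (hY' : IsLocalModule R Y) {f : Y ⟶ X} (hf : IsIrreducibleMor f) :
    IsGood e lam Y := by
  have := isNoetherianRing_of_finiteDimensional K (R := R)
  have := hX.finite
  by_cases hproj : Module.Projective R X
  · obtain ⟨S, p, hS, hp, hb⟩ := hX.top hproj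
    obtain ⟨b⟩ := hX.biperfect.nonempty_dualBasis hs
    obtain ⟨g, r, hg, hr⟩ := irreducible_to_projective hX.isLocal hp hf
    have hJ : IsBiperfect e lam (ModuleCat.of R (LinearMap.ker p)) :=
      IsBiperfect.ker hs (isShortExact_ker hp) b hb
    have hbY : IsBiperfect e lam Y := hJ.of_retract g r hr
    refine ⟨hY, hY', hbY, fun hYp => ?_⟩
    obtain ⟨c⟩ := hbY.nonempty_dualBasis hs
    have := c.injective hs
    refine absurd (fun a c hac => ?_) (irreducible_not_injective hf)
    rw [← hg, ← hg] at hac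
    exact Function.LeftInverse.injective hr (Subtype.ext hac)
  · have hc := hX.isCore hproj
    obtain ⟨L, E, l, q, hL, -, h⟩ := hc.exists_tau hs
    obtain ⟨t, ht⟩ := h.right Y f.hom hY fun h' => hf.2.1 ((isSplitEpi_iff f).2 h')
    have hret : HasRetraction t := by
      rcases hf.2.2 E (ModuleCat.ofHom t) (ModuleCat.ofHom q) h.finite (by ext x; exact ht x)
        with h' | h'
      · exact (isSplitMono_iff _).1 h'
      · exact absurd ((isSplitEpi_iff _).1 h') h.no_section
    obtain ⟨r, hr⟩ := hret
    have hbY : IsBiperfect e lam Y :=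
      (IsBiperfect.extension hs h.ses hL.biperfect hc.biperfect).of_retract t r hr
    refine ⟨hY, hY', hbY, fun hYp => ?_⟩
    obtain ⟨b⟩ := hbY.nonempty_dualBasis hs
    have := b.injective hs
    have := hY'.1
    obtain ⟨S, p, hS, hp⟩ := exists_simple_quotient (R := R) (P := Y)
    obtain ⟨j, hj⟩ := b.exists_socle hs hp
    obtain ⟨k, s, hk, hks⟩ := irreducible_from_injective hY' hj hf
    have hmk := (LinearMap.range j).mkQ_surjective
    -- `X` is a summand of `Y / soc Y`. Were it proper, its preimage in `Y` and `ker f` would both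
    -- lie in the radical `ker p`; together they span `Y`, which is absurd.
    have hbij : Function.Bijective s := by
      refine ⟨Function.LeftInverse.injective hks, ?_⟩
      rw [← LinearMap.range_eq_top]
      by_contra hne
      have h1 : (LinearMap.range s).comap (LinearMap.range j).mkQ ≤ LinearMap.ker p :=
        le_ker_of_ne_top hY' hp fun h0 => hne (eq_top_iff.2 fun z _ => by
          obtain ⟨y, rfl⟩ := hmk z
          have : y ∈ (LinearMap.range s).comap (LinearMap.range j).mkQ := h0 ▸ Submodule.mem_top
          exact this)
      have h2 : LinearMap.ker f.hom ≤ LinearMap.ker p :=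
        le_ker_of_ne_top hY' hp fun h0 => by
          have := hX.isLocal.1
          obtain ⟨x, hx⟩ := exists_ne (0 : X)
          obtain ⟨y, hy⟩ := hmk (s x)
          refine hx ?_
          rw [← hks x, ← hy, hk]
          exact LinearMap.mem_ker.1 (h0 ▸ Submodule.mem_top)
      have := IsSimpleModule.nontrivial R S
      obtain ⟨z, hz⟩ := exists_ne (0 : S)
      obtain ⟨y, rfl⟩ := hp z
      obtain ⟨w, hw⟩ := hmk (s (f.hom y))
      have hw1 : p w = 0 := h1 ⟨f.hom y, hw.symm⟩
      have hw2 : p (y - w) = 0 := h2 (by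
        rw [LinearMap.mem_ker, map_sub, ← hk w, hw, hks, sub_self])
      rw [map_sub, hw1, sub_zero] at hw2
      exact hz hw2
    have hQ : IsBiperfect e lam (ModuleCat.of R (Y ⧸ LinearMap.range j)) :=
      hc.biperfect.of_linearEquiv (X := ModuleCat.of R (Y ⧸ LinearMap.range j))
        (LinearEquiv.ofBijective s hbij).symm
    exact ⟨S, p, hS, hp, IsBiperfect.ker (M := ModuleCat.of R (Y ⧸ LinearMap.range j)) hs
      (isShortExact_range hj) b hQ⟩

end Components

/-! ### The statements on Auslander–Reiten components and stable components. -/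

section Vertices

variable {K : Type u} [Field K] {R : Type u} [Ring R] [Algebra K R] [FiniteDimensional K R]
  {e : R} {lam : R →ₗ[K] K}

variable (K) in
include K in
theorem IndMod.isLocalModule (X : IndMod R) : IsLocalModule R X.1 := by
  have := isArtinianRing_of_finiteDimensional K (R := R)
  have := isNoetherianRing_of_finiteDimensional K (R := R)
  have := X.2.1
  exact isLocalModule_of_indecomposable X.2.2

omit [FiniteDimensional K R] in
theorem IsGood.of_iso {X Y : ModuleCat.{u} R} (hX : IsGood e lam X) (φ : X ≅ Y) :
    IsGood e lam Y :=
  hX.of_linearEquiv φ.toLinearEquiv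

theorem isGood_iff_of_edge (hs : IsSymmIdempotent e lam) {X Y : IndMod R} (h : AREdge X Y) :
    IsGood e lam X.1 ↔ IsGood e lam Y.1 := by
  obtain ⟨⟨φ⟩⟩ | ⟨f, hf⟩ := h
  · exact ⟨fun h => h.of_iso φ, fun h => h.of_iso φ.symm⟩
  · exact ⟨fun h => h.of_irreducible_from hs Y.2.1 (Y.isLocalModule K) hf,
      fun h => h.of_irreducible_to hs X.2.1 (X.isLocalModule K) hf⟩

theorem isGood_iff_of_eqvGen (hs : IsSymmIdempotent e lam) {X Y : IndMod R}
    (h : Relation.EqvGen AREdge X Y) : IsGood e lam X.1 ↔ IsGood e lam Y.1 := by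
  induction h with
  | rel _ _ h => exact isGood_iff_of_edge hs h
  | refl => rfl
  | symm _ _ _ ih => exact ih.symm
  | trans _ _ _ _ _ ih₁ ih₂ => exact ih₁.trans ih₂

theorem IsGorensteinProjInj.isCore (hs : IsSymmIdempotent e lam) {M : IndMod R}
    (hM : IsGorensteinProjInj K M.1) (h : ¬ Module.Projective R M.1) : IsCore e lam M.1 :=
  have := M.2.1
  ⟨M.2.1, M.isLocalModule K, h, hM.isBiperfect hs⟩

theorem gorensteinProjInj_of_component (hs : IsSymmIdempotent e lam) {C : Set (IndMod R)}
    (hC : IsARComponent C)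
    (hM : ∃ M ∈ C, ¬ Module.Projective R M.1 ∧ IsGorensteinProjInj K M.1) :
    ∀ N ∈ C, IsGorensteinProjInj K N.1 := by
  obtain ⟨X, rfl⟩ := hC
  obtain ⟨M, hM, hp, hg⟩ := hM
  intro N hN
  have hG := (isGood_iff_of_eqvGen hs ((hM.symm _ _).trans _ _ _ hN)).1 (hg.isCore hs hp).isGood
  have := N.2.1
  exact hG.biperfect.isGorensteinProjInj hs

/-- The class is closed under `τ` and `τ⁻¹` and has no projective members, so iterating in both
directions gives the whole orbit. -/
theorem IsCore.isStable (hs : IsSymmIdempotent e lam) {M : IndMod R} (hM : IsCore e lam M.1) :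
    IsStable K M := by
  let T := {M : IndMod R // IsCore e lam M.1}
  have h₁ : ∀ M : T, ∃ N : T, IsTau K M.1.1 N.1.1 := fun M => by
    obtain ⟨L, -, -, -, hL, hτ, -⟩ := M.2.exists_tau hs
    exact ⟨⟨⟨L, hL.finite, hL.isLocal.indecomposable⟩, hL⟩, hτ⟩
  have h₂ : ∀ M : T, ∃ N : T, IsTau K N.1.1 M.1.1 := fun M => by
    obtain ⟨-, L, -, -, hL, hτ, -⟩ := M.2.exists_tauInv hs
    exact ⟨⟨⟨L, hL.finite, hL.isLocal.indecomposable⟩, hL⟩, hτ⟩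
  choose next hnext using h₁
  choose prev hprev using h₂
  let X : ℤ → T
    | Int.ofNat n => next^[n] ⟨M, hM⟩
    | Int.negSucc n => prev^[n + 1] ⟨M, hM⟩
  refine ⟨fun n => (X n).1, rfl, fun n => (X n).2.nonproj, fun n => ?_⟩
  match n with
  | Int.ofNat n =>
    have : X (Int.ofNat n + 1) = next (X (Int.ofNat n)) := Function.iterate_succ_apply' next n _
    simp only [this]
    exact hnext _
  | Int.negSucc 0 => exact hprev _
  | Int.negSucc (n + 1) =>
    have : X (Int.negSucc (n + 1)) = prev (X (Int.negSucc n)) :=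
      Function.iterate_succ_apply' prev (n + 1) _
    have h : Int.negSucc (n + 1) + 1 = Int.negSucc n := by omega
    simp only [this, h]
    exact hprev _

omit [FiniteDimensional K R] in
theorem IsStable.nonproj {M : IndMod R} (h : IsStable K M) : ¬ Module.Projective R M.1 := by
  obtain ⟨X, rfl, hX, -⟩ := h
  exact hX 0

theorem isCore_iff_of_eqvGen (hs : IsSymmIdempotent e lam) {X Y : IndMod R}
    (h : Relation.EqvGen (fun U V => IsStable K U ∧ IsStable K V ∧ AREdge U V) X Y) :
    IsCore e lam X.1 ↔ IsCore e lam Y.1 := by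
  induction h with
  | rel _ _ h =>
    have := isGood_iff_of_edge hs h.2.2
    exact ⟨fun hX => (this.1 hX.isGood).isCore h.2.1.nonproj,
      fun hY => (this.2 hY.isGood).isCore h.1.nonproj⟩
  | refl => rfl
  | symm _ _ _ ih => exact ih.symm
  | trans _ _ _ _ _ ih₁ ih₂ => exact ih₁.trans ih₂

theorem gorensteinProjInj_eq_sUnion (hs : IsSymmIdempotent e lam) :
    ∃ S : Set (Set (IndMod R)), (∀ C ∈ S, IsStableARComponent K C) ∧
      {M : IndMod R | ¬ Module.Projective R M.1 ∧ IsGorensteinProjInj K M.1} = ⋃₀ S := by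
  refine ⟨{C | ∃ X : IndMod R, IsCore e lam X.1 ∧ C = {Y | Relation.EqvGen
    (fun U V => IsStable K U ∧ IsStable K V ∧ AREdge U V) X Y}}, ?_, Set.ext fun M => ⟨?_, ?_⟩⟩
  · rintro C ⟨X, hX, rfl⟩
    exact ⟨X, hX.isStable hs, rfl⟩
  · rintro ⟨hp, hg⟩
    exact ⟨_, ⟨M, hg.isCore hs hp, rfl⟩, Relation.EqvGen.refl _⟩
  · rintro ⟨-, ⟨X, hX, rfl⟩, hM⟩
    have hM := (isCore_iff_of_eqvGen hs hM).1 hX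
    have := hM.finite
    exact ⟨hM.nonproj, hM.biperfect.isGorensteinProjInj hs⟩

end Vertices

/-! ### Decomposition into indecomposable summands. -/

section Decomposition

variable {R : Type u} [Ring R]

/-- A decomposition of `M` into indecomposable direct summands. -/
structure LocalDecomposition (M : ModuleCat.{u} R) where
  κ : Type
  fintype : Fintype κ
  part : κ → ModuleCat.{u} R
  incl : ∀ k, part k →ₗ[R] M
  proj : ∀ k, M →ₗ[R] part k
  isLocal : ∀ k, IsLocalModule R (part k)
  proj_incl : ∀ k x, proj k (incl k x) = x
  sum_incl : ∀ x, ∑ k, incl k (proj k x) = x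

attribute [instance] LocalDecomposition.fintype

namespace LocalDecomposition

variable {M N : ModuleCat.{u} R}

theorem finite_part (c : LocalDecomposition M) [Module.Finite R M] (k : c.κ) :
    Module.Finite R (c.part k) :=
  Module.Finite.of_surjective (c.proj k) fun x => ⟨_, c.proj_incl k x⟩

theorem exists_proj_comp_ne_zero (c : LocalDecomposition M) {X : Type*} [AddCommGroup X]
    [Module R X] {f : X →ₗ[R] M} (hf : f ≠ 0) : ∃ k, c.proj k ∘ₗ f ≠ 0 := by
  by_contra! h
  refine hf (LinearMap.ext fun x => ?_)
  rw [← c.sum_incl (f x)]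
  exact Finset.sum_eq_zero fun k _ => by rw [← LinearMap.comp_apply (c.proj k), h]; simp

theorem exists_comp_incl_ne_zero (c : LocalDecomposition M) {X : Type*} [AddCommGroup X]
    [Module R X] {f : M →ₗ[R] X} (hf : f ≠ 0) : ∃ k, f ∘ₗ c.incl k ≠ 0 := by
  by_contra! h
  refine hf (LinearMap.ext fun x => ?_)
  rw [← c.sum_incl x, map_sum]
  exact Finset.sum_eq_zero fun k _ => by rw [← LinearMap.comp_apply f, h]; simp

theorem projective (c : LocalDecomposition M) (h : ∀ k, Module.Projective R (c.part k)) :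
    Module.Projective R M := by
  refine Module.Projective.of_lifting_property'' fun f hf => ?_
  have := fun k => Module.projective_lifting_property f (c.incl k) hf
  choose t ht using this
  refine ⟨∑ k, t k ∘ₗ c.proj k, LinearMap.ext fun x => ?_⟩
  have ht' : ∀ k y, f (t k y) = c.incl k y := fun k => LinearMap.congr_fun (ht k)
  simp only [LinearMap.comp_apply, LinearMap.sum_apply, map_sum, ht', c.sum_incl,
    LinearMap.id_apply]

/-- The decomposition of `M` given by decompositions of two complementary summands. -/
def glue {U V : ModuleCat.{u} R} (c : LocalDecomposition U) (d : LocalDecomposition V)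
    (i : U →ₗ[R] M) (r : M →ₗ[R] U) (hri : ∀ x, r (i x) = x) (j : V →ₗ[R] M) (s : M →ₗ[R] V)
    (hsj : ∀ x, s (j x) = x) (h : ∀ x, i (r x) + j (s x) = x) : LocalDecomposition M where
  κ := c.κ ⊕ d.κ
  fintype := inferInstance
  part := Sum.elim c.part d.part
  incl k := match k with
    | .inl k => i ∘ₗ c.incl k
    | .inr k => j ∘ₗ d.incl k
  proj k := match k with
    | .inl k => c.proj k ∘ₗ r
    | .inr k => d.proj k ∘ₗ s
  isLocal k := match k with
    | .inl k => c.isLocal k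
    | .inr k => d.isLocal k
  proj_incl k := match k with
    | .inl k => fun x => (congrArg (c.proj k) (hri _)).trans (c.proj_incl k x)
    | .inr k => fun x => (congrArg (d.proj k) (hsj _)).trans (d.proj_incl k x)
  sum_incl x := by
    rw [Fintype.sum_sum_type]
    change ∑ k, i (c.incl k (c.proj k (r x))) + ∑ k, j (d.incl k (d.proj k (s x))) = x
    rw [← map_sum, ← map_sum, c.sum_incl, d.sum_incl, h]

end LocalDecomposition

/-- The Krull–Schmidt decomposition. -/
theorem nonempty_localDecomposition (K : Type u) [Field K] [Algebra K R] [FiniteDimensional K R]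
    (M : ModuleCat.{u} R) [Module.Finite R M] : Nonempty (LocalDecomposition M) := by
  have := isArtinianRing_of_finiteDimensional K (R := R)
  have := isNoetherianRing_of_finiteDimensional K (R := R)
  induction hd : Module.finrank K M using Nat.strong_induction_on generalizing M with
  | _ d ih =>
  subst hd
  have := finiteDimensional_of_finite K M
  by_cases hM : Nontrivial M
  swap
  · rw [not_nontrivial_iff_subsingleton] at hM
    exact ⟨⟨Empty, inferInstance, nofun, nofun, nofun, nofun, nofun, fun x =>
      Subsingleton.elim _ _⟩⟩
  by_cases hi : Indecomposable M
  · have hl := isLocalModule_of_indecomposable hi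
    exact ⟨⟨Unit, inferInstance, fun _ => M, fun _ => LinearMap.id, fun _ => LinearMap.id,
      fun _ => hl, fun _ _ => rfl, fun x => by simp⟩⟩
  rw [indecomposable_iff] at hi
  push Not at hi
  obtain ⟨f, hf, ⟨x, hx⟩, ⟨y, hy⟩⟩ := hi hM
  -- This is applied to a nontrivial idempotent `f` and to `1 - f`; both images have smaller
  -- dimension, so induction applies.
  have key : ∀ g : M →ₗ[R] M, (∀ x, g (g x) = g x) → (∃ x, g x ≠ x) →
      ∃ (U : ModuleCat.{u} R) (_ : LocalDecomposition U) (i : U →ₗ[R] M) (r : M →ₗ[R] U),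
        (∀ x, r (i x) = x) ∧ ∀ x, i (r x) = g x := by
    intro g hg ⟨x, hx⟩
    have hlt : Module.finrank K (LinearMap.range g) < Module.finrank K M := by
      refine Submodule.finrank_lt (s := (LinearMap.range g).restrictScalars K)
        (fun h => hx ?_)
      have : x ∈ (LinearMap.range g).restrictScalars K := h ▸ Submodule.mem_top
      obtain ⟨z, rfl⟩ := this
      exact hg z
    obtain ⟨c⟩ := ih _ hlt (ModuleCat.of R (LinearMap.range g)) rfl
    refine ⟨_, c, (LinearMap.range g).subtype, g.rangeRestrict, ?_, fun x => rfl⟩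
    rintro ⟨_, z, rfl⟩
    exact Subtype.ext (hg z)
  obtain ⟨U, c, i, r, hri, hir⟩ := key f hf ⟨y, hy⟩
  obtain ⟨V, d, j, s, hsj, hjs⟩ := key (LinearMap.id - f) (fun x => by simp [hf])
    ⟨x, fun h => hx (by simpa using h)⟩
  exact ⟨c.glue d i r hri j s hsj fun x => by rw [hir, hjs]; simp⟩

end Decomposition

/-! ### Left almost split maps out of good modules. -/

section LeftAlmostSplit

variable {K : Type u} [Field K] {R : Type u} [Ring R] [Algebra K R] [FiniteDimensional K R]
  {e : R} {lam : R →ₗ[K] K}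

/-- For projective `X` the map is `X → X / soc X`, since a map that is not a section kills the
socle; otherwise it starts the almost split sequence. -/
theorem IsGood.exists_leftAlmostSplit (hs : IsSymmIdempotent e lam) {X : ModuleCat.{u} R}
    (hX : IsGood e lam X) :
    ∃ (E : ModuleCat.{u} R) (l : X →ₗ[R] E), Module.Finite R E ∧ ¬ HasRetraction l ∧
      (∀ (Q : ModuleCat.{u} R) (f : X →ₗ[R] Q), Module.Finite R Q → ¬ HasRetraction f →
        ∃ t : E →ₗ[R] Q, ∀ x, t (l x) = f x) ∧
      ∀ (Y : ModuleCat.{u} R) (s : Y →ₗ[R] E) (r : E →ₗ[R] Y), (∀ y, r (s y) = y) →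
        IsLocalModule R Y → IsGood e lam Y := by
  have := isArtinianRing_of_finiteDimensional K (R := R)
  have := isNoetherianRing_of_finiteDimensional K (R := R)
  have := hX.finite
  by_cases hproj : Module.Projective R X
  · obtain ⟨S, p, hS, hp, hb⟩ := hX.top hproj
    obtain ⟨b⟩ := hX.biperfect.nonempty_dualBasis hs
    have := b.injective hs
    obtain ⟨j, hj⟩ := b.exists_socle hs hp
    have := IsSimpleModule.nontrivial R S
    obtain ⟨z, hz⟩ := exists_ne (0 : S)
    have hjz : j z ≠ 0 := fun h => hz (hj (h.trans (map_zero j).symm))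
    have hmk : (LinearMap.range j).mkQ (j z) = 0 := (Submodule.Quotient.mk_eq_zero _).2 ⟨z, rfl⟩
    have hQ : IsBiperfect e lam (ModuleCat.of R (X ⧸ LinearMap.range j)) :=
      IsBiperfect.coker hs (isShortExact_range hj) b hb
    refine ⟨ModuleCat.of R (X ⧸ LinearMap.range j), (LinearMap.range j).mkQ,
      inferInstanceAs (Module.Finite R (X ⧸ LinearMap.range j)), ?_, ?_, ?_⟩
    · rintro ⟨t, ht⟩
      exact hjz (by rw [← ht (j z), hmk, map_zero])
    · intro Q f hQ hf
      have hle : LinearMap.range j ≤ LinearMap.ker f := range_le_of_ne_bot hX.isLocal hj fun h => by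
        obtain ⟨t, ht⟩ := Module.Injective.out f (LinearMap.ker_eq_bot.1 h)
          (LinearMap.id : X →ₗ[R] X)
        exact hf ⟨t, ht⟩
      exact ⟨(LinearMap.range j).liftQ f hle, fun x => rfl⟩
    · intro Y s r hrs hY
      refine ⟨Module.Finite.of_surjective (r ∘ₗ (LinearMap.range j).mkQ) ?_, hY,
        hQ.of_retract s r hrs, fun hYp => ?_⟩
      · exact (Function.LeftInverse.surjective hrs).comp (LinearMap.range j).mkQ_surjective
      · exfalso
        obtain ⟨t, ht⟩ := Module.projective_lifting_property (r ∘ₗ (LinearMap.range j).mkQ)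
          LinearMap.id
          ((Function.LeftInverse.surjective hrs).comp (LinearMap.range j).mkQ_surjective)
        have := hY.1
        obtain ⟨y, hy⟩ := (hX.isLocal.bijective_of_retract (i := t)
          (r := r ∘ₗ (LinearMap.range j).mkQ) (LinearMap.congr_fun ht)).2 (j z)
        have h1 : (r ∘ₗ (LinearMap.range j).mkQ) (t y) = y := LinearMap.congr_fun ht y
        rw [hy, LinearMap.comp_apply, hmk, map_zero] at h1
        exact hjz (by rw [← hy, ← h1, map_zero])
  · have hc := hX.isCore hproj
    obtain ⟨E, N, l, q, hN, -, h⟩ := hc.exists_tauInv hs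
    refine ⟨E, l, h.finite, h.no_retraction, h.left, fun Y s r hrs hY => ?_⟩
    have := h.finite
    exact hX.of_irreducible_from hs
      (Module.Finite.of_surjective r (Function.LeftInverse.surjective hrs)) hY
      (h.isIrreducibleMor hN.isLocal hX.isLocal hY.1 s r hrs)

end LeftAlmostSplit

/-! ### Finitely many good modules force selfinjectivity. -/

section Vanishing

variable {R : Type u} [Ring R]

/-- Every left multiple is nilpotent: going around through the local module `X` gives an
endomorphism that cannot be bijective, as that would split `r`. -/
theorem mem_jacobson_of_not_hasRetraction {G X Y : ModuleCat.{u} R} (hX : IsLocalModule R X)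
    {r : X →ₗ[R] Y} (hr : ¬ HasRetraction r) (π : G →ₗ[R] X) (σ : Y →ₗ[R] G) :
    (σ ∘ₗ r ∘ₗ π : Module.End R G) ∈ Ideal.jacobson (⊥ : Ideal (Module.End R G)) := by
  refine Ideal.mem_jacobson_iff.2 fun y => ?_
  suffices h : IsNilpotent (y * (σ ∘ₗ r ∘ₗ π : Module.End R G)) by
    obtain ⟨z, hz⟩ := h.isUnit_add_one.exists_left_inv
    refine ⟨z, ?_⟩
    rw [mul_add, mul_one, ← mul_assoc] at hz
    rw [hz, sub_self]
    exact Submodule.zero_mem _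
  obtain ⟨n, hn⟩ : ∃ n, ∀ x, ((π ∘ₗ (y : G →ₗ[R] G) ∘ₗ σ ∘ₗ r) ^ n) x = 0 :=
    (hX.2 _).resolve_right fun hb => hr
      ⟨(LinearEquiv.ofBijective _ hb).symm.toLinearMap ∘ₗ π ∘ₗ (y : G →ₗ[R] G) ∘ₗ σ,
        fun x => (LinearEquiv.ofBijective _ hb).symm_apply_apply x⟩
  refine ⟨n + 1, LinearMap.ext fun x => ?_⟩
  have h : π (((y * (σ ∘ₗ r ∘ₗ π : Module.End R G)) ^ n) x) = 0 := by
    rw [← pow_apply_of_comm (i := π) (g := π ∘ₗ (y : G →ₗ[R] G) ∘ₗ σ ∘ₗ r) (fun x => rfl), hn]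
  rw [pow_succ', Module.End.mul_apply, Module.End.mul_apply]
  simp [h]

variable {K : Type u} [Field K] [Algebra K R] [FiniteDimensional K R]
  {e : R} {lam : R →ₗ[K] K}

/-- If there are finitely many good modules, there are no maps from good modules to other
indecomposable modules. -/
theorem IsGood.hom_eq_zero (hs : IsSymmIdempotent e lam) {n : ℕ} {F : Fin n → ModuleCat.{u} R}
    (hF : ∀ k, IsGood e lam (F k))
    (hF' : ∀ X : ModuleCat.{u} R, IsGood e lam X → ∃ k, Nonempty (X ≃ₗ[R] F k))
    {X Q : ModuleCat.{u} R} (hX : IsGood e lam X) (hQ : IsLocalModule R Q) [Module.Finite R Q]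
    (hQ' : ¬ IsGood e lam Q) (f : X →ₗ[R] Q) : f = 0 := by
  have hfin := fun k => (hF k).finite
  obtain ⟨G, σ, π, hG, hπσ, hσπ⟩ : ∃ (G : ModuleCat.{u} R) (σ : ∀ k, F k →ₗ[R] G)
      (π : ∀ k, G →ₗ[R] F k), Module.Finite R G ∧ (∀ k x, π k (σ k x) = x) ∧
        ∀ x, ∑ k, σ k (π k x) = x :=
    ⟨ModuleCat.of R (∀ k, F k), LinearMap.single R (fun k => F k), LinearMap.proj,
      inferInstanceAs (Module.Finite R (∀ k, F k)), fun k x => by simp,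
      fun x => Finset.univ_sum_single x⟩
  have := finiteDimensional_of_finite K G
  have : FiniteDimensional K (Module.End R G) := Module.Finite.of_injective
    (LinearMap.restrictScalarsₗ K R G G K) (LinearMap.restrictScalars_injective K)
  have := isArtinianRing_of_finiteDimensional K (R := Module.End R G)
  obtain ⟨N, hN⟩ := IsArtinianRing.isNilpotent_jacobson_bot (R := Module.End R G)
  set J := Ideal.jacobson (⊥ : Ideal (Module.End R G))
  -- Descending induction on the power of the radical. Each factorization of `f` through left almost
  -- split maps multiplies `a` by a radical element, until `J ^ N = 0`; the case `m = N`, `a = 1` is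
  -- the claim.
  have key : ∀ m, m ≤ N → ∀ a ∈ J ^ (N - m), ∀ (f : G →ₗ[R] Q) (x : G), f (a x) = 0 := by
    intro m
    induction m with
    | zero =>
      intro _ a ha f x
      rw [Nat.sub_zero, hN] at ha
      rw [show a = 0 from ha]
      simp
    | succ m ih =>
      intro hm a ha f x
      have hstep : ∀ k, f (σ k (π k (a x))) = 0 := by
        intro k
        obtain ⟨E, l, hE, hl, hfac, hgood⟩ := (hF k).exists_leftAlmostSplit hs
        obtain ⟨t, ht⟩ := hfac Q (f ∘ₗ σ k) inferInstance fun ⟨r, hr⟩ => by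
          have := (hF k).isLocal.1
          exact hQ' ((hF k).of_linearEquiv
            (LinearEquiv.ofBijective (f ∘ₗ σ k) (hQ.bijective_of_retract hr)))
        obtain ⟨c⟩ := nonempty_localDecomposition K E
        rw [← LinearMap.comp_apply f, ← ht, ← c.sum_incl (l _), map_sum]
        refine Finset.sum_eq_zero fun i _ => ?_
        obtain ⟨j, ⟨φ⟩⟩ := hF' _ (hgood _ (c.incl i) (c.proj i) (c.proj_incl i) (c.isLocal i))
        have hr : ¬ HasRetraction (φ.toLinearMap ∘ₗ c.proj i ∘ₗ l) := fun ⟨r, hr⟩ =>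
          hl ⟨r ∘ₗ φ.toLinearMap ∘ₗ c.proj i, hr⟩
        have hmem := mem_jacobson_of_not_hasRetraction (hF k).isLocal hr (π k) (σ j)
        have hmem' : (σ j ∘ₗ (φ.toLinearMap ∘ₗ c.proj i ∘ₗ l) ∘ₗ π k : Module.End R G) * a ∈
            J ^ (N - m) := by
          rw [show N - m = (N - (m + 1)) + 1 by omega, Ideal.IsTwoSided.pow_succ]
          exact Ideal.mul_mem_mul hmem ha
        have h0 := ih (by omega) _ hmem'
          (t ∘ₗ c.incl i ∘ₗ φ.symm.toLinearMap ∘ₗ π j) x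
        simpa [hπσ] using h0
      rw [← hσπ (a x), map_sum]
      exact Finset.sum_eq_zero fun k _ => hstep k
  obtain ⟨k, ⟨φ⟩⟩ := hF' X hX
  ext x
  have := key N le_rfl 1
    (by rw [Nat.sub_self, Submodule.pow_zero]; exact Submodule.one_le.1 le_rfl) (f ∘ₗ φ.symm.toLinearMap ∘ₗ π k) (σ k (φ x))
  simpa [hπσ] using this

/-- A map from an indecomposable module that is not good to a good projective module vanishes. -/
theorem IsGood.hom_eq_zero_of_projective (hs : IsSymmIdempotent e lam) {n : ℕ}
    {F : Fin n → ModuleCat.{u} R} (hF : ∀ k, IsGood e lam (F k))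
    (hF' : ∀ X : ModuleCat.{u} R, IsGood e lam X → ∃ k, Nonempty (X ≃ₗ[R] F k))
    {P Q : ModuleCat.{u} R} (hP : IsGood e lam P) [Module.Projective R P] (hQ : IsLocalModule R Q)
    [Module.Finite R Q] (hQ' : ¬ IsGood e lam Q) (f : Q →ₗ[R] P) : f = 0 := by
  have := hP.finite
  obtain ⟨b⟩ := hP.biperfect.nonempty_dualBasis hs
  refine b.pairing_left hs f fun v => ?_
  rw [hP.hom_eq_zero hs hF hF' hQ hQ' v]
  simp [DualBasis.trace]

/-- If there are finitely many good modules and one of them is not projective, a connected algebra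
is selfinjective. -/
theorem injective_of_finite (hs : IsSymmIdempotent e lam) (hconn : IsConnectedAlg R) {n : ℕ}
    {F : Fin n → ModuleCat.{u} R} (hF : ∀ k, IsGood e lam (F k))
    (hF' : ∀ X : ModuleCat.{u} R, IsGood e lam X → ∃ k, Nonempty (X ≃ₗ[R] F k))
    {X : ModuleCat.{u} R} (hX : IsGood e lam X) : Module.Injective R R := by
  classical
  obtain ⟨c⟩ := nonempty_localDecomposition K (ModuleCat.of R R)
  have hfin : ∀ k, Module.Finite R (c.part k) := fun k =>
    have : Module.Finite R (ModuleCat.of R R) := inferInstanceAs (Module.Finite R R)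
    c.finite_part k
  have hproj : ∀ k, Module.Projective R (c.part k) := fun k =>
    have : Module.Projective R (ModuleCat.of R R) := inferInstanceAs (Module.Projective R R)
    Module.Projective.of_split (c.incl k) (c.proj k) (LinearMap.ext (c.proj_incl k))
  let ι : ∀ k, c.part k →ₗ[R] R := c.incl
  let π : ∀ k, R →ₗ[R] c.part k := c.proj
  have hπι : ∀ k x, π k (ι k x) = x := c.proj_incl
  have hsum : ∀ x : R, ∑ k, ι k (π k x) = x := c.sum_incl
  let g : c.κ → Prop := fun k => IsGood e lam (c.part k)
  have h₁ : ∀ j k (φ : c.part j →ₗ[R] c.part k), g j → ¬ g k → φ = 0 := fun j k φ hj hk =>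
    hj.hom_eq_zero hs hF hF' (c.isLocal k) hk φ
  have h₂ : ∀ j k (φ : c.part j →ₗ[R] c.part k), ¬ g j → g k → φ = 0 := fun j k φ hj hk =>
    hk.hom_eq_zero_of_projective hs hF hF' (c.isLocal j) hj φ
  -- The projection onto the good summands of `R`. As no nonzero maps connect good and other
  -- summands, it commutes with all endomorphisms, so `ε 1` is a central idempotent.
  let ε : R →ₗ[R] R := ∑ k with g k, ι k ∘ₗ π k
  have hε : ∀ x, ε x = ∑ k with g k, ι k (π k x) := fun x => by simp [ε]
  have hε₁ : ∀ k, g k → ∀ x, π k (ε x) = π k x := fun k hk x => by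
    conv_rhs => rw [← hsum x, map_sum]
    rw [hε, map_sum]
    refine Finset.sum_subset (Finset.subset_univ _) fun j _ hj => ?_
    exact LinearMap.congr_fun (h₂ j k (π k ∘ₗ ι j) (by simpa using hj) hk) (π j x)
  have hcomm : ∀ (φ : R →ₗ[R] R) (x : R), ε (φ x) = φ (ε x) := by
    intro φ x
    rw [← hsum (φ (ε x)), hε]
    rw [← Finset.sum_subset (Finset.subset_univ (Finset.univ.filter g))]
    · refine Finset.sum_congr rfl fun k hk => ?_
      have hk : g k := by simpa using hk
      congr 1
      conv_lhs => rw [← hsum x, map_sum, map_sum]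
      rw [hε, map_sum, map_sum]
      refine (Finset.sum_subset (Finset.subset_univ _) fun j _ hj => ?_).symm
      exact LinearMap.congr_fun (h₂ j k (π k ∘ₗ φ ∘ₗ ι j) (by simpa using hj) hk) (π j x)
    · intro k _ hk
      have hk : ¬ g k := by simpa using hk
      rw [hε, map_sum, map_sum, Finset.sum_eq_zero, map_zero]
      intro j hj
      exact LinearMap.congr_fun (h₁ j k (π k ∘ₗ φ ∘ₗ ι j) (by simpa using hj) hk) (π j x)
  have hε' : ∀ x, ε x = x * ε 1 := fun x => by
    conv_lhs => rw [← mul_one x, ← smul_eq_mul, map_smul, smul_eq_mul]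
  have hcen : ε 1 ∈ Subring.center R := Subring.mem_center_iff.2 fun y => by
    have := hcomm (LinearMap.toSpanSingleton R R y) 1
    rw [LinearMap.toSpanSingleton_apply, LinearMap.toSpanSingleton_apply, smul_eq_mul, smul_eq_mul,
      one_mul, hε' y] at this
    exact this
  have hidem : IsIdempotentElem (ε 1) := by
    change ε 1 * ε 1 = ε 1
    rw [← hε']
    exact (hε _).trans ((Finset.sum_congr rfl fun k hk => by
      rw [hε₁ k (by simpa using hk)]).trans (hε 1).symm)
  rcases hconn.2 _ hidem hcen with h0 | h1
  · exfalso
    have hnone : ∀ k, ¬ g k := fun k hk => by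
      have := (c.isLocal k).1
      obtain ⟨x, hx⟩ := exists_ne (0 : c.part k)
      refine hx ?_
      rw [← hπι k x, ← hε₁ k hk, hε', h0, mul_zero, map_zero]
    have := hX.finite
    -- If `R` has no good summand, embed `X` in `add(Re)`. Some projective summand receives a
    -- nonzero map from `X`, hence is good, yet no summand of `R` maps to it nontrivially.
    obtain ⟨Q, b, i, hi⟩ := exists_embedding hs hX.biperfect.e_faithful
    have := b.finite
    have := b.projective
    have hi0 : i ≠ 0 := by
      rintro rfl
      have := hX.isLocal.1
      obtain ⟨x, hx⟩ := exists_ne (0 : X)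
      exact hx (hi (by simp))
    obtain ⟨d⟩ := nonempty_localDecomposition K Q
    obtain ⟨m, hm⟩ := d.exists_proj_comp_ne_zero hi0
    have := d.finite_part m
    have hgm : IsGood e lam (d.part m) := by
      by_contra hgm
      exact hm (hX.hom_eq_zero hs hF hF' (d.isLocal m) hgm _)
    have : Module.Projective R (d.part m) :=
      Module.Projective.of_split (d.incl m) (d.proj m) (LinearMap.ext (d.proj_incl m))
    have := (d.isLocal m).1
    obtain ⟨y, hy⟩ := exists_ne (0 : d.part m)
    obtain ⟨k, hk⟩ := c.exists_comp_incl_ne_zero (f := LinearMap.toSpanSingleton R (d.part m) y)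
      (fun h => hy (by simpa using LinearMap.congr_fun h (1 : R)))
    exact hk (hgm.hom_eq_zero_of_projective hs hF hF' (c.isLocal k) (hnone k) _)
  -- Now `R` is the sum of its good summands, which lie in `add(Re)` and are injective.
  · have hid : ∀ x, ∑ k with g k, ι k (π k x) = x := fun x => by rw [← hε, hε', h1, mul_one]
    refine ⟨fun U V _ _ _ _ i hi f => ?_⟩
    have hext : ∀ k, ∃ t : V →ₗ[R] c.part k, g k → ∀ x, t (i x) = π k (f x) := fun k => by
      by_cases hk : g k
      · obtain ⟨b⟩ := IsBiperfect.nonempty_dualBasis hs (IsGood.biperfect hk)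
        obtain ⟨t, ht⟩ := (b.injective hs).out i hi (π k ∘ₗ f)
        exact ⟨t, fun _ => ht⟩
      · exact ⟨0, fun h => absurd h hk⟩
    choose t ht using hext
    refine ⟨∑ k with g k, ι k ∘ₗ t k, fun x => ?_⟩
    rw [LinearMap.sum_apply, ← hid (f x)]
    refine Finset.sum_congr rfl fun k hk => ?_
    rw [LinearMap.comp_apply, ht k (by simpa using hk)]

/-- A connected CM-finite gendo-symmetric algebra that is not selfinjective has no nonprojective
Gorenstein projective-injective modules. -/
theorem projective_of_isCMFinite (hs : IsSymmIdempotent e lam) (hconn : IsConnectedAlg R)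
    (hinj : ¬ Module.Injective R R) (hfin : IsCMFinite R) (M : ModuleCat.{u} R)
    [Module.Finite R M] (hM : IsGorensteinProjInj K M) : Module.Projective R M := by
  obtain ⟨c⟩ := nonempty_localDecomposition K M
  refine c.projective fun k => ?_
  by_contra hk
  have hX : IsCore e lam (c.part k) := ⟨c.finite_part k, c.isLocal k, hk,
    (hM.isBiperfect hs).of_retract (c.incl k) (c.proj k) (c.proj_incl k)⟩
  obtain ⟨S, hS, hS'⟩ := hfin
  have hT : {N ∈ S | IsGood e lam N}.Finite := hS.subset (Set.sep_subset _ _)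
  obtain ⟨n, F, hF⟩ := hT.fin_param
  refine hinj (injective_of_finite hs hconn (F := F) (fun k => ?_) (fun X hX => ?_) hX.isGood)
  · have : F k ∈ {N ∈ S | IsGood e lam N} := hF.2 ▸ ⟨k, rfl⟩
    exact this.2
  · have := hX.finite
    obtain ⟨N, hN, ⟨φ⟩⟩ := hS' ⟨X, hX.finite, hX.isLocal.indecomposable⟩
      (hX.biperfect.isGorensteinProjective hs)
    have : N ∈ Set.range F := hF.2 ▸ ⟨hN, hX.of_iso φ⟩
    obtain ⟨k, rfl⟩ := this
    exact ⟨k, ⟨φ.toLinearEquiv⟩⟩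

end Vanishing

/-! ### From a gendo-symmetric algebra to a symmetric idempotent. -/

section GendoSymmetric

variable {K : Type u} [Field K] {A : Type u} [Ring A] [Algebra K A]

theorem mem_span_left {e : A} (he : e * e = e) {x : A} :
    x ∈ Submodule.span A {e} ↔ x * e = x := by
  rw [Submodule.mem_span_singleton]
  constructor
  · rintro ⟨a, rfl⟩
    rw [smul_eq_mul, mul_assoc, he]
  · exact fun h => ⟨x, h⟩

theorem mem_span_right {e : A} (he : e * e = e) {y : A} :
    y ∈ Submodule.span Aᵐᵒᵖ {e} ↔ e * y = y := by
  rw [Submodule.mem_span_singleton]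
  constructor
  · rintro ⟨a, rfl⟩
    rw [MulOpposite.smul_eq_mul_unop, ← mul_assoc, he]
  · exact fun h => ⟨MulOpposite.op y, h⟩

/-- The double centralizer property of a faithful idempotent of an algebra of dominant dimension at
least `2`, in terms of the form induced by `lam`. -/
theorem exists_form_of_domDim [FiniteDimensional K A] (hdom : DomDimAtLeast 2 (ModuleCat.of A A))
    {e : A} {lam : A →ₗ[K] K} (idem : e * e = e) (supp : ∀ z, lam z = lam (e * z * e))
    (symm : ∀ a q, lam (e * a * e * q) = lam (q * (e * a * e)))
    (nondeg_left : ∀ x, x * e = x → (∀ y, lam (y * x) = 0) → x = 0)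
    (nondeg_right : ∀ y, e * y = y → (∀ x, lam (y * x) = 0) → y = 0)
    (faithful_left : ∀ a, (∀ x, a * x * e = 0) → a = 0)
    (faithful_right : ∀ a, (∀ y, e * y * a = 0) → a = 0)
    (γ : A →ₗ[K] A →ₗ[K] K) (hγ : ∀ x y, γ (x * e) (e * y) = γ x y)
    (hγ' : ∀ a x y, γ (x * (e * a * e)) y = γ x (e * a * e * y)) :
    ∃ a, ∀ x y, γ x y = lam (y * a * x) := by
  have lam_mul_e : ∀ z, lam (z * e) = lam z := fun z => by
    rw [supp, supp z, mul_assoc, mul_assoc, idem, ← mul_assoc]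
  have lam_e_mul : ∀ z, lam (e * z) = lam z := fun z => by
    rw [supp, supp z, ← mul_assoc e e, idem]
  have hleft : ∀ x, ∃ v, ∀ y, lam (y * v) = γ x y := fun x => by
    obtain ⟨w, hw⟩ := exists_eq_of_vanish (((LinearMap.mul K A).compr₂ lam).flip) (γ x)
      fun y hy => by
        have h0 : e * y = 0 := nondeg_right _ (by rw [← mul_assoc, idem]) fun w => by
          rw [mul_assoc, lam_e_mul]
          exact hy w
        rw [← hγ, h0, map_zero]
    exact ⟨w, fun y => LinearMap.congr_fun hw y⟩
  have hright : ∀ y, ∃ w, ∀ x, lam (w * x) = γ x y := fun y => by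
    obtain ⟨w, hw⟩ := exists_eq_of_vanish ((LinearMap.mul K A).compr₂ lam) (γ.flip y)
      fun x hx => by
        have h0 : x * e = 0 := nondeg_left _ (by rw [mul_assoc, idem]) fun w => by
          rw [← mul_assoc, lam_mul_e]
          exact hx w
        rw [LinearMap.flip_apply, ← hγ, h0, map_zero, LinearMap.zero_apply]
    exact ⟨w, fun x => LinearMap.congr_fun hw x⟩
  choose v hv using hleft
  choose w hw using hright
  -- The form is represented by `v x` in one variable and by `w y` in the other; balancedness makes
  -- the two representations compatible.
  have key : ∀ x y, e * y * v x * e = e * w y * x * e := fun x y => by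
    rw [← sub_eq_zero]
    refine nondeg_right _ (by simp [mul_sub, ← mul_assoc, idem]) fun q => ?_
    have h1 : lam (e * y * v x * e * q) = γ x (e * q * e * y) := by
      rw [← hv, ← lam_mul_e, mul_assoc _ e q, mul_assoc _ (e * q) e, mul_assoc (e * q * e),
        symm, mul_assoc e y, mul_assoc e (y * v x), lam_e_mul]
    have h2 : lam (e * w y * x * e * q) = γ x (e * q * e * y) := by
      rw [← hγ', ← hw, ← lam_mul_e, ← lam_e_mul (w y * _)]
      simp only [mul_assoc]
    rw [sub_mul, map_sub, h1, h2, sub_self]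
  obtain ⟨I, ι, hι, -, I₁, ι₁, hι₁, hproj, -⟩ := hdom
  let i : A →ₗ[A] (A → A) := LinearMap.pi fun x => LinearMap.toSpanSingleton A A (x * e)
  have hi_apply : ∀ a x, i a x = a * x * e := fun a x => (mul_assoc a x e).symm
  have hi : Function.Injective i := (injective_iff_map_eq_zero i).2 fun a ha =>
    faithful_left a fun x => by rw [← hi_apply, ha]; rfl
  let ι' : A →ₗ[A] I := ι.hom
  have hι' : Function.Injective ι' := hι.mono
  -- The family `(v x e)` should be `i a` for the element `a` sought. Extending `ι` along `i` turns
  -- it into a point of the injective envelope `I` that `eA` multiplies into `A`.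
  obtain ⟨r, hr⟩ := hι.injective.out i hi ι'
  have hrv : ∀ y, (e * y) • r (fun x => v x * e) = ι' (e * w y) := fun y => by
    rw [← hr, ← map_smul]
    congr 1
    funext x
    rw [hi_apply, ← key, Pi.smul_apply, smul_eq_mul, ← mul_assoc]
  -- This is where the second term is used: `I / A` embeds in the projective `I₁`, where only zero
  -- is annihilated by `eA`. So the point of `I` lies in `A`.
  have hker : ∀ m : I ⧸ LinearMap.range ι.hom, (∀ y, (e * y) • m = 0) → m = 0 := fun m hm => by
    obtain ⟨s, hs⟩ := Module.projective_def.1 hproj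
    have h0 : s (ι₁.hom m) = 0 := Finsupp.ext fun t => faithful_right _ fun y => by
      have : (e * y) • s (ι₁.hom m) = 0 := by
        rw [← map_smul, ← map_smul]
        erw [hm y]
        rw [map_zero, map_zero]
      exact DFunLike.congr_fun this t
    refine hι₁.mono (Function.LeftInverse.injective hs ?_)
    rw [h0, map_zero, map_zero]
  obtain ⟨a, ha⟩ : ∃ a, ι' a = r (fun x => v x * e) :=
    (Submodule.Quotient.mk_eq_zero (LinearMap.range ι.hom)).1 (hker _ fun y => by
      rw [← Submodule.Quotient.mk_smul, hrv]
      exact (Submodule.Quotient.mk_eq_zero _).2 ⟨_, rfl⟩)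
  have hwa : ∀ y, e * w y = e * y * a := fun y => hι' (by
    rw [← hrv, ← ha, ← map_smul, smul_eq_mul])
  refine ⟨a, fun x y => ?_⟩
  rw [← hw, ← lam_e_mul, ← mul_assoc, hwa, mul_assoc, mul_assoc, lam_e_mul, ← mul_assoc]

theorem IsGendoSymmetric.exists_isSymmIdempotent [FiniteDimensional K A]
    (h : IsGendoSymmetric K A) : ∃ (e : A) (lam : A →ₗ[K] K), IsSymmIdempotent e lam := by
  obtain ⟨hdom, e, he, ⟨-, hfaith, -⟩, Φ, hΦ, hΦ'⟩ := h
  have idem : e * e = e := he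
  let L : ∀ x : A, x * e = x → Submodule.span A {e} := fun x hx => ⟨x, (mem_span_left idem).2 hx⟩
  let ρ : A →ₗ[K] Submodule.span Aᵐᵒᵖ {e} :=
    { toFun := fun y => ⟨e * y, (mem_span_right idem).2 (by rw [← mul_assoc, idem])⟩
      map_add' := fun x y => Subtype.ext (mul_add _ _ _)
      map_smul' := fun k y => Subtype.ext (mul_smul_comm _ _ _) }
  -- The image of the generator `e` under `Ae ≅ D(eA)`, extended to `A` through `y ↦ e y`. Left
  -- linearity determines `Φ` from it, and right linearity is the trace property.
  let lam : A →ₗ[K] K := Φ (L e idem) ∘ₗ ρ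
  have hρ : ∀ y : Submodule.span Aᵐᵒᵖ {e}, ρ y = y := fun y =>
    Subtype.ext ((mem_span_right idem).1 y.2)
  have hlam : ∀ (x : A) (hx : x * e = x) y, lam (y * x) = Φ (L x hx) (ρ y) := fun x hx y => by
    have h1 : L x hx = x • L e idem := Subtype.ext hx.symm
    rw [h1, hΦ]
    exact congrArg (Φ (L e idem)) (Subtype.ext (mul_assoc e y x).symm)
  have supp : ∀ z, lam z = lam (e * z * e) := fun z => by
    rw [hlam e idem]
    exact congrArg (Φ (L e idem)) (Subtype.ext (by simp [ρ, ← mul_assoc, idem]))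
  have symm : ∀ a q, lam (e * a * e * q) = lam (q * (e * a * e)) := fun a q => by
    have hx : e * a * e * e = e * a * e := by rw [mul_assoc, idem]
    rw [hlam _ hx]
    refine (hΦ' a (L e idem) (L _ hx) (ρ q) (ρ (e * a * e * q)) ?_ ?_).symm
    · simp [L, ← mul_assoc, idem]
    · simp [ρ, ← mul_assoc, idem]
      simp [mul_assoc, idem]
  have nondeg_left : ∀ x, x * e = x → (∀ y, lam (y * x) = 0) → x = 0 := fun x hx h0 => by
    have : L x hx = 0 := Φ.map_eq_zero_iff.1 (LinearMap.ext fun y => by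
      rw [← hρ y, ← hlam x hx, h0, LinearMap.zero_apply])
    exact congrArg Subtype.val this
  have nondeg_right : ∀ y, e * y = y → (∀ x, lam (y * x) = 0) → y = 0 := fun y hy h0 => by
    have : ρ y = 0 := (Module.forall_dual_apply_eq_zero_iff K _).1 fun f => by
      obtain ⟨x, rfl⟩ := Φ.surjective f
      rw [← hlam x ((mem_span_left idem).1 x.2) y, h0]
    exact hy.symm.trans (congrArg Subtype.val this)
  have faithful_left : ∀ a, (∀ x, a * x * e = 0) → a = 0 := fun a ha =>
    hfaith.eq_of_smul_eq_smul fun x => Subtype.ext (by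
      have := ha x
      rw [mul_assoc, (mem_span_left idem).1 x.2] at this
      simpa using this)
  -- If `eA` kills `a`, then `lam (y a x e) = 0` for all `x`, `y`; nondegeneracy gives `a x e = 0`,
  -- and `Ae` is faithful.
  have faithful_right : ∀ a, (∀ y, e * y * a = 0) → a = 0 := fun a ha =>
    faithful_left a fun x => nondeg_left _ (by rw [mul_assoc, idem]) fun y => by
      rw [supp, ← mul_assoc, ← mul_assoc, ← mul_assoc, ha]
      simp
  exact ⟨e, lam, idem, supp, symm, nondeg_left, nondeg_right, faithful_left, faithful_right,
    exists_form_of_domDim hdom idem supp symm nondeg_left nondeg_right faithful_left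
      faithful_right⟩

end GendoSymmetric

end

end FinDimAlg

theorem mainTheorem2 (K : Type u) [Field K] (A : Type u) [Ring A] [Algebra K A]
    [FiniteDimensional K A] (hconn : FinDimAlg.IsConnectedAlg A)
    (hgendo : FinDimAlg.IsGendoSymmetric K A) (hnsi : ¬ Module.Injective A A) :
    (∀ C : Set (FinDimAlg.IndMod A), FinDimAlg.IsARComponent C →
      (∃ M ∈ C, ¬ Module.Projective A M.1 ∧ FinDimAlg.IsGorensteinProjInj K M.1) →
      ∀ N ∈ C, FinDimAlg.IsGorensteinProjInj K N.1) ∧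
    (∃ S : Set (Set (FinDimAlg.IndMod A)), (∀ C ∈ S, FinDimAlg.IsStableARComponent K C) ∧
      {M : FinDimAlg.IndMod A |
        ¬ Module.Projective A M.1 ∧ FinDimAlg.IsGorensteinProjInj K M.1} = ⋃₀ S) ∧
    (FinDimAlg.IsCMFinite A → ∀ M : ModuleCat.{u} A, Module.Finite A M →
      FinDimAlg.IsGorensteinProjInj K M → Module.Projective A M) := by
  obtain ⟨e, lam, hs⟩ := hgendo.exists_isSymmIdempotent
  exact ⟨fun C hC hM => FinDimAlg.gorensteinProjInj_of_component hs hC hM,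
    FinDimAlg.gorensteinProjInj_eq_sUnion hs,
    fun hfin M _ hM => FinDimAlg.projective_of_isCMFinite hs hconn hnsi hfin M hM⟩
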